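/- **Setting.** There are $M\ge1$ clients. Client $i$ has a data distribution $\mathcal D_i$ and a loss $f_i(x,y;\xi)$, differentiable in $(x,y)\in\mathbb R^{d_1}\times\mathbb R^{d_2}$; put $f_i(x,y)=\mathbb E_{\xi\sim\mathcal D_i}f_i(x,y;\xi)$ and $f=\frac1M\sum_i f_i$. Let $l>0$, $\sigma,\sigma_G\ge0$ and $0<\mu_1,\mu_2\le l$, and assume: 1. every $f_i$ is differentiable with $\|\nabla f_i(x_1,y_1)-\nabla f_i(x_2,y_2)\|\le l(\|x_1-x_2\|+\|y_1-y_2\|)$; 2. $\mathbb E\nabla f_i(x,y;\xi)=\nabla f_i(x,y)$ and $\mathbb E\|\nabla f_i(x,y;\xi)-\nabla f_i(x,y)\|^2\le\sigma^2$ for all $i,x,y$; 3. $\|\nabla f_i(x,y)-\nabla f(x,y)\|^2\le\sigma_G^2$ for all $i,x,y$; 4. $\Phi(x)=\max_yf(x,y)$ is bounded below; 5. (two-sided PL) $\min_xf(x,y)$ and $\max_yf(x,y)$ are attained for every fixed $y$, respectively $x$, and $\|\nabla_xf(x,y)\|^2\ge2\mu_1[f(x,y)-\min_{x'}f(x',y)]$,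 $\|\nabla_yf(x,y)\|^2\ge2\mu_2[\max_{y'}f(x,y')-f(x,y)]$; 6. $f$ has a saddle point: the set $\mathcal S$ of all $(x^*,y^*)$ with $f(x^*,y)\le f(x^*,y^*)\le f(x,y^*)$ for all $x,y$ is non-empty. **Algorithm (FESS-GDA with $p=0$).** It has step sizes $\eta_{x,l},\eta_{y,l},\eta_{x,g},\eta_{y,g}>0$, $\beta\in(0,1)$ and a number $K\ge1$ of local steps. In round $t$ the server draws a uniformly random set $S_t$ of $m$ clients ($1\le m\le M$). Each $i\in S_t$ starts from $(x^1_{t,i},y^1_{t,i})=(x_t,y_t)$ and performs, for $k=1,\dots,K$, with fresh independent samples $\xi^k_{t,i}\sim\mathcal D_i$, $$x^{k+1}_{t,i}=x^k_{t,i}-\eta_{x,l}\nabla_xf_i(x^k_{t,i},y^k_{t,i};\xi^k_{t,i}),\qquad y^{k+1}_{t,i}=y^k_{t,i}+\eta_{y,l}\nabla_yf_i(x^k_{t,i},y^k_{t,i};\xi^k_{t,i}).$$ Then $x_{t+1}=x_t+\eta_{x,g}\bigl(\frac1m\sum_{i\in S_t}x^{K+1}_{t,i}-x_t\bigr)$,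 $y_{t+1}=y_t+\eta_{y,g}\bigl(\frac1m\sum_{i\in S_t}y^{K+1}_{t,i}-y_t\bigr)$ and $z_{t+1}=z_t+\beta(x_{t+1}-z_t)$. After $T$ rounds the communication complexity is $T$ and the per-client sample complexity is $KT$. **Theorem.** Write $\kappa'=\max\{l/\mu_1,l/\mu_2\}$ and $\kappa''=\min\{l/\mu_1,l/\mu_2\}$. For all $l,\sigma,\sigma_G$ and $D\ge0$ there is a constant $C>0$, depending on these four numbers only, such that for all $\mu_1,\mu_2\in(0,l]$, all $1\le m\le M$ and all $0<\varepsilon\le\frac12$ there are step sizes, $\beta$ and $K$, depending only on $l,\sigma,\sigma_G,D,\mu_1,\mu_2,M,m,\varepsilon$, with the following property. For every problem as above and every initial point $(x_0,y_0,z_0)$ for which $(x_0,y_0)$ has distance at most $D$ from $\mathcal S$, there is a $T$ for which FESS-GDA satisfies $$\mathbb E\Bigl[\|x_T-x^*\|^2+\|y_T-y^*\|^2\Bigr]\le\varepsilon^2,$$ where $(x^*,y^*)$ is the saddle point nearest to $(x_T,y_T)$ (the saddle point, if it is unique), and such that: * the per-client sample complexity satisfies $KT\le C\max\{m^{-1}\kappa'^3\kappa''^4\varepsilon^{-2},\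 \kappa'\kappa''^2\}\log(\kappa'/\varepsilon)$, which is $C\,m^{-1}\kappa'^3\kappa''^4\varepsilon^{-2}\log(\kappa'/\varepsilon)$ as soon as $m\varepsilon^2\le\kappa'^2\kappa''^2$; * if $m=M$ (full participation) or $\sigma_G=0$ (homogeneous data), the communication complexity satisfies $T\le C\,\kappa'\kappa''^2\log(\kappa'/\varepsilon)$; * if $m<M$ and $\sigma_G>0$, the communication complexity $T$ satisfies the same bound as the per-client sample complexity. -/

import Mathlib

open MeasureTheory ProbabilityTheory
open scoped Gradient

noncomputable section

namespace FessGda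

/-- Euclidean space `ℝᵈ`. -/
abbrev Vec (d : ℕ) := EuclideanSpace ℝ (Fin d)

/-- The joint variable `w = (x, y) ∈ ℝ^{d₁} × ℝ^{d₂}` with the Euclidean norm
`‖w‖² = ‖x‖² + ‖y‖²`; `w.fst = x` and `w.snd = y`. For `g` on this space, the components of the
gradient `∇ g w` are the partial gradients `∇ₓ g (x, y)` and `∇_y g (x, y)`. -/
abbrev Pt (d₁ d₂ : ℕ) := WithLp 2 (Vec d₁ × Vec d₂)

/-- The pair `(x, y)`. -/
abbrev pt {d₁ d₂ : ℕ} (x : Vec d₁) (y : Vec d₂) : Pt d₁ d₂ := WithLp.toLp 2 (x, y)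

/-! ### The federated minimax problem -/

/-- A federated minimax problem with `M` clients over `X = ℝ^{d₁}`, `Y = ℝ^{d₂}`: client `i` has
a data distribution `𝒟 i` on the data space `Ξ` and a loss `loss i ξ (x, y)` for the data
point `ξ`. -/
structure Problem (M d₁ d₂ : ℕ) (Ξ : Type*) [MeasurableSpace Ξ] where
  loss : Fin M → Ξ → Pt d₁ d₂ → ℝ
  𝒟 : Fin M → ProbabilityMeasure Ξ

namespace Problem

variable {M d₁ d₂ : ℕ} {Ξ : Type*} [MeasurableSpace Ξ]

/-- The local objective `f_i(x, y) = 𝔼_{ξ ∼ 𝒟_i} [loss of client i at (x, y) on ξ]`. -/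
def localObj (P : Problem M d₁ d₂ Ξ) (i : Fin M) (w : Pt d₁ d₂) : ℝ :=
  ∫ ξ, P.loss i ξ w ∂(P.𝒟 i : Measure Ξ)

/-- The global objective `f = (1/M) ∑ᵢ f_i`. -/
def obj (P : Problem M d₁ d₂ Ξ) (w : Pt d₁ d₂) : ℝ :=
  (1 / (M : ℝ)) * ∑ i, P.localObj i w

/-- The stochastic gradient `∇ f_i(x, y; ξ)`. -/
def stochGrad (P : Problem M d₁ d₂ Ξ) (i : Fin M) (ξ : Ξ) (w : Pt d₁ d₂) : Pt d₁ d₂ :=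
  ∇ (P.loss i ξ) w

end Problem

/-- `w` is a saddle point of `f`, minimizing in `x` and maximizing in `y`. -/
def IsSaddle {d₁ d₂ : ℕ} (f : Pt d₁ d₂ → ℝ) (w : Pt d₁ d₂) : Prop :=
  (∀ y, f (pt w.fst y) ≤ f w) ∧ (∀ x, f w ≤ f (pt x w.snd))

/-- The set of saddle points of `f`. -/
def saddleSet {d₁ d₂ : ℕ} (f : Pt d₁ d₂ → ℝ) : Set (Pt d₁ d₂) := {w | IsSaddle f w}

/-- The two-sided PL condition with constants `μ₁` (in `x`) and `μ₂` (in `y`). The minima and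
maxima are attained, so the `⨅` and `⨆` below are genuine minima and maxima. -/
structure TwoSidedPL {d₁ d₂ : ℕ} (f : Pt d₁ d₂ → ℝ) (μ₁ μ₂ : ℝ) : Prop where
  min_attained : ∀ y, ∃ x, ∀ x', f (pt x y) ≤ f (pt x' y)
  max_attained : ∀ x, ∃ y, ∀ y', f (pt x y') ≤ f (pt x y)
  pl_x : ∀ x y, 2 * μ₁ * (f (pt x y) - ⨅ x', f (pt x' y)) ≤ ‖(∇ f (pt x y)).fst‖ ^ 2
  pl_y : ∀ x y, 2 * μ₂ * ((⨆ y', f (pt x y')) - f (pt x y)) ≤ ‖(∇ f (pt x y)).snd‖ ^ 2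

/-- The standing assumptions on the problem. -/
structure Problem.Assumptions {M d₁ d₂ : ℕ} {Ξ : Type*} [MeasurableSpace Ξ]
    (P : Problem M d₁ d₂ Ξ) (l σ σG μ₁ μ₂ : ℝ) : Prop where
  /-- The local objectives and stochastic gradients are well defined. -/
  loss_integrable : ∀ i w, Integrable (fun ξ => P.loss i ξ w) (P.𝒟 i : Measure Ξ)
  loss_differentiable : ∀ i ξ, Differentiable ℝ (P.loss i ξ)
  stochGrad_measurable : ∀ i, Measurable fun q : Ξ × Pt d₁ d₂ => P.stochGrad i q.1 q.2
  /-- Lipschitz smoothness of every local objective. -/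
  differentiable : ∀ i, Differentiable ℝ (P.localObj i)
  smooth : ∀ i w₁ w₂, ‖∇ (P.localObj i) w₁ - ∇ (P.localObj i) w₂‖ ≤
    l * (‖w₁.fst - w₂.fst‖ + ‖w₁.snd - w₂.snd‖)
  /-- Unbiased stochastic gradients with variance at most `σ²`. -/
  grad_integrable : ∀ i w, Integrable (fun ξ => P.stochGrad i ξ w) (P.𝒟 i : Measure Ξ)
  unbiased : ∀ i w, ∫ ξ, P.stochGrad i ξ w ∂(P.𝒟 i : Measure Ξ) = ∇ (P.localObj i) w
  var_integrable : ∀ i w,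
    Integrable (fun ξ => ‖P.stochGrad i ξ w - ∇ (P.localObj i) w‖ ^ 2) (P.𝒟 i : Measure Ξ)
  variance_le : ∀ i w,
    ∫ ξ, ‖P.stochGrad i ξ w - ∇ (P.localObj i) w‖ ^ 2 ∂(P.𝒟 i : Measure Ξ) ≤ σ ^ 2
  /-- Bounded heterogeneity. -/
  heterogeneity : ∀ i w, ‖∇ (P.localObj i) w - ∇ P.obj w‖ ^ 2 ≤ σG ^ 2
  /-- `Φ(x) = max_y f(x, y)` is bounded below. -/
  phi_bddBelow : BddBelow (Set.range fun x => ⨆ y, P.obj (pt x y))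
  /-- The two-sided PL condition for the global objective. -/
  pl : TwoSidedPL P.obj μ₁ μ₂
  /-- Existence of a saddle point. -/
  saddle : (saddleSet P.obj).Nonempty

/-! ### The algorithm FESS-GDA -/

/-- Parameters of FESS-GDA: local and global step sizes, smoothing parameters `β`, `p`, and the
number `K` of local updates per round. -/
structure Params where
  ηxl : ℝ
  ηyl : ℝ
  ηxg : ℝ
  ηyg : ℝ
  β : ℝ
  p : ℝ
  K : ℕ

/-- Positive step sizes, `β ∈ (0, 1)`, and at least one local update per round. -/
structure Params.Valid (prm : Params) : Prop where
  ηxl_pos : 0 < prm.ηxl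
  ηyl_pos : 0 < prm.ηyl
  ηxg_pos : 0 < prm.ηxg
  ηyg_pos : 0 < prm.ηyg
  β_pos : 0 < prm.β
  β_lt_one : prm.β < 1
  K_pos : 1 ≤ prm.K

/-- The randomness of one communication round: the set of participating clients and the
data points `ξ i k` that client `i` would draw for its `k`-th local update. -/
abbrev Round (M : ℕ) (Ξ : Type*) (K : ℕ) := Finset (Fin M) × (Fin M → Fin K → Ξ)

/-- The state `(x_t, y_t, z_t)` of the server. -/
structure State (d₁ d₂ : ℕ) where
  x : Vec d₁
  y : Vec d₂
  z : Vec d₁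

section Algorithm

variable {M d₁ d₂ : ℕ} {Ξ : Type*} [MeasurableSpace Ξ]

/-- One local update, a simultaneous stochastic descent step in `x` and ascent step in `y`. The
feasible set in `y` is all of `ℝ^{d₂}`, so the projection onto it is the identity. -/
def localStep (P : Problem M d₁ d₂ Ξ) (prm : Params) (i : Fin M) (ξ : Ξ) (w : Pt d₁ d₂) :
    Pt d₁ d₂ :=
  pt (w.fst - prm.ηxl • (P.stochGrad i ξ w).fst) (w.snd + prm.ηyl • (P.stochGrad i ξ w).snd)

/-- The local model `(x^{K+1}_{t,i}, y^{K+1}_{t,i})` after `K` local updates started at `w`. -/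
def localModel (P : Problem M d₁ d₂ Ξ) (prm : Params) (i : Fin M) (ξ : Fin prm.K → Ξ)
    (w : Pt d₁ d₂) : Pt d₁ d₂ :=
  Fin.foldl prm.K (fun v k => localStep P prm i (ξ k) v) w

/-- One communication round of FESS-GDA with `m` participating clients. -/
def roundStep (P : Problem M d₁ d₂ Ξ) (prm : Params) (m : ℕ) (r : Round M Ξ prm.K)
    (s : State d₁ d₂) : State d₁ d₂ :=
  let loc : Fin M → Pt d₁ d₂ := fun i => localModel P prm i (r.2 i) (pt s.x s.y)
  let x' := s.x + prm.ηxg • ((1 / (m : ℝ)) • (∑ i ∈ r.1, (loc i).fst) - s.x)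
    - (prm.ηxl * prm.ηxg * prm.K * prm.p) • (s.x - s.z)
  let y' := s.y + prm.ηyg • ((1 / (m : ℝ)) • (∑ i ∈ r.1, (loc i).snd) - s.y)
  { x := x', y := y', z := s.z + prm.β • (x' - s.z) }

/-- The state after `t` rounds, as a function of the randomness of the rounds. -/
def run (P : Problem M d₁ d₂ Ξ) (prm : Params) (m : ℕ) (s₀ : State d₁ d₂)
    (ω : ℕ → Round M Ξ prm.K) : ℕ → State d₁ d₂
  | 0 => s₀
  | t + 1 => roundStep P prm m (ω t) (run P prm m s₀ ω t)

/-- The law of one round: a uniformly random set of `m` clients, and independently of it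
independent data points `ξ i k ∼ 𝒟 i`. -/
def roundLaw (P : Problem M d₁ d₂ Ξ) (m K : ℕ) : Measure (Round M Ξ K) :=
  (uniformOn {S : Finset (Fin M) | S.card = m}).prod
    (Measure.pi fun i => Measure.pi fun _ => (P.𝒟 i : Measure Ξ))

/-- For `m ≤ M` the law of a round is a probability measure. -/
theorem isProbabilityMeasure_roundLaw (P : Problem M d₁ d₂ Ξ) {m : ℕ} (K : ℕ) (hm : m ≤ M) :
    IsProbabilityMeasure (roundLaw P m K) := by
  have h : IsProbabilityMeasure (uniformOn {S : Finset (Fin M) | S.card = m}) := by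
    refine isProbabilityMeasure_uniformOn (Set.toFinite _) ?_
    obtain ⟨S, -, hS⟩ := Finset.exists_subset_card_eq (s := (Finset.univ : Finset (Fin M)))
      (n := m) (by simpa using hm)
    exact ⟨S, hS⟩
  unfold roundLaw
  infer_instance

/-- The law of the whole run: the rounds are independent (for `m ≤ M` this is the product
probability measure of countably many copies of the law of a round). -/
def runLaw (P : Problem M d₁ d₂ Ξ) (m K : ℕ) : Measure (ℕ → Round M Ξ K) :=
  Measure.infinitePi fun _ => roundLaw P m K

/-- The squared distance `min (‖x_t - x*‖² + ‖y_t - y*‖²)` of the `t`-th iterate to the set of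
saddle points `(x*, y*)` of the global objective. -/
def sqError (P : Problem M d₁ d₂ Ξ) (prm : Params) (m : ℕ) (s₀ : State d₁ d₂) (t : ℕ)
    (ω : ℕ → Round M Ξ prm.K) : ℝ :=
  Metric.infDist (pt (run P prm m s₀ ω t).x (run P prm m s₀ ω t).y) (saddleSet P.obj) ^ 2

end Algorithm

/-- `κ' = max {l/μ₁, l/μ₂}`. -/
def kappaMax (l μ₁ μ₂ : ℝ) : ℝ := max (l / μ₁) (l / μ₂)

/-- `κ'' = min {l/μ₁, l/μ₂}`. -/
def kappaMin (l μ₁ μ₂ : ℝ) : ℝ := min (l / μ₁) (l / μ₂)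

/-- `κ' κ''² log (κ' / ε)`. -/
def commBound (κ₁ κ₂ ε : ℝ) : ℝ := κ₁ * κ₂ ^ 2 * Real.log (κ₁ / ε)

/-- `m⁻¹ κ'³ κ''⁴ ε⁻² log (κ' / ε)`. -/
def sampleBound (m : ℕ) (κ₁ κ₂ ε : ℝ) : ℝ :=
  (m : ℝ)⁻¹ * κ₁ ^ 3 * κ₂ ^ 4 * (ε ^ 2)⁻¹ * Real.log (κ₁ / ε)

end FessGda

end

/-! Let `Φ(x) = max_y f(x, y)`, let `v` be the common value of all saddle points, and suppose `μ₁ ≤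
μ₂`. The proof tracks `V = (Φ(x) - v) + (Φ(x) - f(x, y)) / 2`. Two-sided PL makes `Φ` smooth with
constant of order `l² / μ₂`, with gradient `∇ₓ f` at any maximizer (`gx_eq_of_max`,
`primal_add_le`), and the saddle point makes `Φ` itself a `μ₁`-PL function (`pl_primal`). If `x`
moves slower than `y` by a factor of order `(μ₂ / l)²`, the error of using `∇ₓ f(x, y)` instead of
`∇Φ(x)` is paid for by the ascent in `y`. Then `V` contracts at a rate of order `1 / (κ' κ''²)` per
round. If `μ₂ ≤ μ₁`, the same argument is applied to `-f` with the two variables exchanged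
(`MinimaxPL.swap`), so that the variable with the smaller PL constant is always the slow one.

A round is a perturbed step of this kind (`exists_round_decomposition`). The noise is centred, with
second moment at most `σ² / (mK)` plus a sampling error `σG² / m`, which vanishes for `m = M`. The
drift is caused by the clients leaving the common point. Its bound grows like `4 ^ K`, but the local
step size is chosen after `K` and as small as needed, while the global step sizes restore the
effective step. So drift costs nothing in the rates.

The squared distance to the saddle set is bounded by gap terms and `‖∇ₓ f‖² / (μ₁ μ₂)`
(`exists_saddle_near`). Bounding the last term by `V` would lose powers of `κ''`. Instead the
one-step estimate retains a negative multiple of the whole distance bound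
(`integral_lyapunov_step_le`). If the expected squared distance exceeded `ε²` at all times up to
`T`, the expectation of `V` would become negative (`exists_time_integral_le`). Hence some time up to
`T` is good, and it may depend on the problem and the initial point.

What remains is to beat the noise (`exists_averaging`). With full participation or homogeneous data,
the effective step stays maximal and `K` grows. Otherwise `K = 1` and the effective step shrinks.
Both cost the same number of samples. -/

namespace FessGda

/-! ### Polyak-Lojasiewicz functions: minimizers and quadratic growth -/

section PolyakLojasiewicz

variable {E : Type*} [NormedAddCommGroup E] [InnerProductSpace ℝ E] [CompleteSpace E]

/-- Quadratic growth: a function with a quadratic upper model that satisfies the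
Polyak-Lojasiewicz inequality attains its infimum, at a distance controlled by the
suboptimality. -/
theorem exists_minimizer_of_pl {φ : E → ℝ} {G : E → E} {L μ φmin : ℝ} (hL : 0 < L) (hμ : 0 < μ)
    (hub : ∀ x u, φ (x + u) ≤ φ x + inner ℝ (G x) u + L * ‖u‖ ^ 2)
    (hmin : ∀ x, φmin ≤ φ x) (hPL : ∀ x, 2 * μ * (φ x - φmin) ≤ ‖G x‖ ^ 2) (x : E) :
    ∃ z, φ z = φmin ∧ μ * ‖x - z‖ ^ 2 ≤ 8 * (φ x - φmin) := by
  -- Gradient descent with the step that minimizes the quadratic upper model. Each step gains `‖G‖²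
  -- / (4L)`.
  let X : ℕ → E := fun k => Nat.rec x (fun _ v => v + (-(1 / (2 * L))) • G v) k
  have hX : ∀ k, X (k + 1) = X k + (-(1 / (2 * L))) • G (X k) := fun k => rfl
  have hX0 : X 0 = x := rfl
  -- By PL, the decrease of the square root of the gap dominates the length of the step. The sum
  -- telescopes, so the path has finite length.
  set s : ℕ → ℝ := fun k => √(φ (X k) - φmin) with hs
  set c : ℝ := √(2 * μ) / 4 with hc
  have hcpos : 0 < c := by positivity
  have hdist : ∀ k, dist (X k) (X (k + 1)) = ‖G (X k)‖ / (2 * L) := by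
    intro k
    rw [hX, dist_eq_norm, sub_add_cancel_left, norm_neg, norm_smul, norm_neg, Real.norm_of_nonneg
      (by positivity)]
    ring
  have hdesc : ∀ k, φ (X (k + 1)) ≤ φ (X k) - ‖G (X k)‖ ^ 2 / (4 * L) := by
    intro k
    have h := hub (X k) ((-(1 / (2 * L))) • G (X k))
    rw [← hX, inner_smul_right, real_inner_self_eq_norm_sq, norm_smul, norm_neg,
      Real.norm_of_nonneg (by positivity)] at h
    refine h.trans (le_of_eq ?_)
    field_simp
    ring
  have hstep : ∀ k, c * dist (X k) (X (k + 1)) ≤ s k - s (k + 1) := by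
    intro k
    have h1 := hdesc k
    have h2 := hmin (X k)
    have h3 := hmin (X (k + 1))
    have hsk : s k ^ 2 = φ (X k) - φmin := Real.sq_sqrt (by linarith)
    have hsk' : s (k + 1) ^ 2 = φ (X (k + 1)) - φmin := Real.sq_sqrt (by linarith)
    have hs0 : 0 ≤ s k := Real.sqrt_nonneg _
    have hs0' : 0 ≤ s (k + 1) := Real.sqrt_nonneg _
    have hG : √(2 * μ) * s k ≤ ‖G (X k)‖ := by
      rw [← Real.sqrt_mul (by positivity)]
      exact Real.sqrt_le_iff.2 ⟨norm_nonneg _, hPL (X k)⟩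
    have hdec : s (k + 1) ^ 2 ≤ s k ^ 2 - ‖G (X k)‖ ^ 2 / (4 * L) := by
      rw [hsk, hsk']; linarith
    have hGn : 0 ≤ ‖G (X k)‖ ^ 2 / (4 * L) := by positivity
    have hle : s (k + 1) ≤ s k := by
      apply (pow_le_pow_iff_left₀ hs0' hs0 two_ne_zero).1; linarith
    rw [hdist]
    rcases hs0.eq_or_lt with h0 | h0
    · have : ‖G (X k)‖ ^ 2 / (4 * L) ≤ 0 := by
        rw [← h0] at hdec; nlinarith
      have hz : ‖G (X k)‖ ^ 2 / (4 * L) = 0 := le_antisymm this hGn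
      have : ‖G (X k)‖ = 0 := by
        rcases div_eq_zero_iff.1 hz with h | h
        · exact pow_eq_zero_iff two_ne_zero |>.1 h
        · linarith
      rw [this]; simpa using hle
    · have h4 : ‖G (X k)‖ * (√(2 * μ) * s k) / (4 * L) ≤ ‖G (X k)‖ ^ 2 / (4 * L) := by
        rw [sq]; gcongr
      have h5 : (s k - s (k + 1)) * (s k + s (k + 1)) ≤ (s k - s (k + 1)) * (2 * s k) :=
        mul_le_mul_of_nonneg_left (by linarith) (by linarith)
      have h6 : ‖G (X k)‖ * (√(2 * μ) * s k) / (4 * L) = c * (‖G (X k)‖ / (2 * L)) * (2 * s k) := by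
        rw [hc]; field_simp
      have h7 : c * (‖G (X k)‖ / (2 * L)) * (2 * s k) ≤ (s k - s (k + 1)) * (2 * s k) := by
        rw [← h6]; nlinarith
      exact le_of_mul_le_mul_right h7 (by linarith)
  have hsum : ∀ n, ∑ k ∈ Finset.range n, dist (X k) (X (k + 1)) ≤ s 0 / c := by
    intro n
    rw [le_div_iff₀ hcpos, Finset.sum_mul]
    calc ∑ k ∈ Finset.range n, dist (X k) (X (k + 1)) * c
        ≤ ∑ k ∈ Finset.range n, (s k - s (k + 1)) :=
          Finset.sum_le_sum fun k _ => by rw [mul_comm]; exact hstep k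
      _ = s 0 - s n := Finset.sum_range_sub' s n
      _ ≤ s 0 := by linarith [Real.sqrt_nonneg (φ (X n) - φmin)]
  have hsummable : Summable fun k => dist (X k) (X (k + 1)) :=
    summable_of_sum_range_le (fun _ => dist_nonneg) hsum
  obtain ⟨z, hz⟩ := cauchySeq_tendsto_of_complete (cauchySeq_of_summable_dist hsummable)
  have hGz : Filter.Tendsto (fun k => G (X k)) Filter.atTop (nhds 0) := by
    rw [tendsto_zero_iff_norm_tendsto_zero]
    have h := hsummable.tendsto_atTop_zero.const_mul (2 * L)
    simp only [mul_zero] at h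
    refine h.congr fun k => ?_
    rw [hdist]; field_simp
  -- Neither `φ` nor `G` is assumed continuous. The upper model based at `X k` and evaluated at `z`
  -- suffices, because `G (X k)` tends to zero.
  have hle : φ z ≤ φmin := by
    have hsub : Filter.Tendsto (fun k => z - X k) Filter.atTop (nhds 0) := by
      simpa using hz.const_sub z
    have hlim : Filter.Tendsto (fun k => φmin + ‖G (X k)‖ ^ 2 / (2 * μ) +
        inner ℝ (G (X k)) (z - X k) + L * ‖z - X k‖ ^ 2) Filter.atTop
        (nhds (φmin + ‖(0 : E)‖ ^ 2 / (2 * μ) + inner ℝ (0 : E) 0 + L * ‖(0 : E)‖ ^ 2)) :=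
      (((hGz.norm.pow 2).div_const _).const_add _ |>.add (hGz.inner hsub)).add
        ((hsub.norm.pow 2).const_mul L)
    simp only [norm_zero, inner_zero_left, ne_eq, OfNat.ofNat_ne_zero, not_false_eq_true, zero_pow,
      zero_div, mul_zero, add_zero] at hlim
    refine ge_of_tendsto' hlim fun k => ?_
    have h1 := hub (X k) (z - X k)
    rw [add_sub_cancel] at h1
    have h2 : φ (X k) - φmin ≤ ‖G (X k)‖ ^ 2 / (2 * μ) := by
      rw [le_div_iff₀ (by positivity)]; linarith [hPL (X k)]
    linarith
  refine ⟨z, le_antisymm hle (hmin z), ?_⟩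
  have hd : dist x z ≤ s 0 / c :=
    (dist_le_tsum_dist_of_tendsto₀ hsummable hz).trans
      (Real.tsum_le_of_sum_range_le (fun _ => dist_nonneg) hsum)
  rw [dist_eq_norm] at hd
  have h0 : s 0 ^ 2 = φ x - φmin := Real.sq_sqrt (sub_nonneg.2 (hmin x))
  have hc2 : c ^ 2 = μ / 8 := by
    rw [hc, div_pow, Real.sq_sqrt (by positivity)]; ring
  have : ‖x - z‖ ^ 2 ≤ (s 0 / c) ^ 2 := by gcongr
  rw [div_pow, h0, hc2, le_div_iff₀ (by positivity)] at this
  linarith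

end PolyakLojasiewicz

/-! ### The primal function of a two-sided PL problem -/

section Minimax

variable {E F : Type*} [NormedAddCommGroup E] [InnerProductSpace ℝ E]
  [NormedAddCommGroup F] [InnerProductSpace ℝ F]

/-- A smooth function `f` of two variables with partial gradients `gx` and `gy` that satisfies the
two-sided Polyak-Lojasiewicz condition. -/
structure MinimaxPL (f : E → F → ℝ) (gx : E → F → E) (gy : E → F → F) (l μ₁ μ₂ : ℝ) : Prop where
  l_pos : 0 < l
  μ₁_pos : 0 < μ₁
  μ₂_pos : 0 < μ₂
  μ₁_le : μ₁ ≤ l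
  μ₂_le : μ₂ ≤ l
  taylor : ∀ x y u v, |f (x + u) (y + v) - f x y - inner ℝ (gx x y) u - inner ℝ (gy x y) v| ≤
    2 * l * (‖u‖ ^ 2 + ‖v‖ ^ 2)
  lip_x : ∀ x y y', ‖gx x y - gx x y'‖ ≤ l * ‖y - y'‖
  lip_y : ∀ x x' y, ‖gy x y - gy x' y‖ ≤ l * ‖x - x'‖
  pl_x : ∀ x x' y, 2 * μ₁ * (f x y - f x' y) ≤ ‖gx x y‖ ^ 2
  pl_y : ∀ x y y', 2 * μ₂ * (f x y' - f x y) ≤ ‖gy x y‖ ^ 2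
  exists_min : ∀ y, ∃ x, ∀ x', f x y ≤ f x' y
  exists_max : ∀ x, ∃ y, ∀ y', f x y' ≤ f x y

/-- The primal function `x ↦ max_y f x y`. -/
noncomputable def primal (f : E → F → ℝ) (x : E) : ℝ := ⨆ y, f x y

namespace MinimaxPL

variable {f : E → F → ℝ} {gx : E → F → E} {gy : E → F → F} {l μ₁ μ₂ : ℝ}

/-- The symmetry between the players. It gives the dual half of each statement, and the case in
which `y` is the slow variable. -/
theorem swap (h : MinimaxPL f gx gy l μ₁ μ₂) :
    MinimaxPL (fun y x => -f x y) (fun y x => -gy x y) (fun y x => -gx x y) l μ₂ μ₁ where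
  l_pos := h.l_pos
  μ₁_pos := h.μ₂_pos
  μ₂_pos := h.μ₁_pos
  μ₁_le := h.μ₂_le
  μ₂_le := h.μ₁_le
  taylor := fun y x v u => by
    rw [add_comm (‖v‖ ^ 2), ← abs_neg]
    refine le_trans (le_of_eq ?_) (h.taylor x y u v)
    congr 1
    simp only [inner_neg_left]
    ring
  lip_x := fun y x x' => by
    rw [neg_sub_neg, norm_sub_rev]; exact h.lip_y x x' y
  lip_y := fun y y' x => by
    rw [neg_sub_neg, norm_sub_rev]; exact h.lip_x x y y'
  pl_x := fun y y' x => by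
    rw [norm_neg]; refine le_trans (le_of_eq ?_) (h.pl_y x y y'); ring
  pl_y := fun y x x' => by
    rw [norm_neg]; refine le_trans (le_of_eq ?_) (h.pl_x x x' y); ring
  exists_min := fun x => by
    obtain ⟨y, hy⟩ := h.exists_max x
    exact ⟨y, fun y' => neg_le_neg (hy y')⟩
  exists_max := fun y => by
    obtain ⟨x, hx⟩ := h.exists_min y
    exact ⟨x, fun x' => neg_le_neg (hx x')⟩

variable (h : MinimaxPL f gx gy l μ₁ μ₂)
include h

theorem bddAbove (x : E) : BddAbove (Set.range (f x)) := by
  obtain ⟨y, hy⟩ := h.exists_max x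
  exact ⟨f x y, by rintro _ ⟨y', rfl⟩; exact hy y'⟩

theorem le_primal (x : E) (y : F) : f x y ≤ primal f x := le_ciSup (h.bddAbove x) y

theorem exists_eq_primal (x : E) : ∃ y, f x y = primal f x := by
  obtain ⟨y, hy⟩ := h.exists_max x
  have : Nonempty F := ⟨y⟩
  exact ⟨y, le_antisymm (h.le_primal x y) (ciSup_le hy)⟩

theorem pl_primal_sub (x : E) (y : F) : 2 * μ₂ * (primal f x - f x y) ≤ ‖gy x y‖ ^ 2 := by
  obtain ⟨y', hy'⟩ := h.exists_eq_primal x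
  rw [← hy']; exact h.pl_y x y y'

/-- An ascent step of size `1 / (4l)` would gain `‖gy‖² / (8l)`, which is impossible at a maximizer.
-/
theorem gy_eq_zero {x : E} {y : F} (hy : f x y = primal f x) : gy x y = 0 := by
  have h1 := abs_le.1 (h.taylor x y 0 ((1 / (4 * l)) • gy x y))
  have h2 := h.le_primal x (y + (1 / (4 * l)) • gy x y)
  have hl := h.l_pos
  simp only [add_zero, inner_zero_right, norm_zero, sub_zero, inner_smul_right,
    real_inner_self_eq_norm_sq, norm_smul, Real.norm_of_nonneg (by positivity : 0 ≤ 1 / (4 * l))]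
    at h1
  have h3 : 1 / (4 * l) * ‖gy x y‖ ^ 2 - 2 * l * (0 ^ 2 + (1 / (4 * l) * ‖gy x y‖) ^ 2) ≤ 0 := by
    linarith [h1.1]
  have h4 : 1 / (4 * l) * ‖gy x y‖ ^ 2 - 2 * l * (0 ^ 2 + (1 / (4 * l) * ‖gy x y‖) ^ 2) =
      1 / (8 * l) * ‖gy x y‖ ^ 2 := by field_simp; ring
  rw [h4] at h3
  have h5 : 0 < 1 / (8 * l) := by positivity
  have h6 : ‖gy x y‖ ^ 2 = 0 := le_antisymm (nonpos_of_mul_nonpos_right h3 h5) (by positivity)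
  simpa using h6

/-- Keeping the old maximizer at the new point can only underestimate `primal f`. -/
theorem le_primal_add {x : E} {y : F} (hy : f x y = primal f x) (u : E) :
    primal f x + inner ℝ (gx x y) u - 2 * l * ‖u‖ ^ 2 ≤ primal f (x + u) := by
  have h3 := (abs_le.1 (h.taylor x y u 0)).1
  simp only [add_zero, inner_zero_right, norm_zero, sub_zero] at h3
  have h7 := h.le_primal (x + u) y
  nlinarith

variable [CompleteSpace F]

/-- A maximizer in `y` near a given point. -/
theorem exists_near_maximizer (x : E) (y : F) :
    ∃ y', f x y' = primal f x ∧ μ₂ * ‖y - y'‖ ≤ 2 * ‖gy x y‖ := by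
  obtain ⟨z, hz, hd⟩ := exists_minimizer_of_pl (φ := fun y => -f x y) (G := fun y => -gy x y)
    (L := 2 * l) (μ := μ₂) (φmin := -primal f x) (by linarith [h.l_pos]) h.μ₂_pos
    (fun y u => by
      have := abs_le.1 (h.taylor x y 0 u)
      simp only [add_zero, inner_zero_right, norm_zero, sub_zero, inner_neg_left] at this ⊢
      nlinarith [this.1])
    (fun y => neg_le_neg (h.le_primal x y))
    (fun y => by
      rw [norm_neg]; refine le_trans (le_of_eq ?_) (h.pl_primal_sub x y); ring) y
  refine ⟨z, neg_injective hz, ?_⟩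
  have h1 := h.pl_primal_sub x y
  have hμ := h.μ₂_pos
  refine (pow_le_pow_iff_left₀ (by positivity) (by positivity) two_ne_zero).1 ?_
  nlinarith

/-- After moving `x` by `u`, the old maximizer has `y`-gradient at most `l‖u‖`, so by quadratic
growth some new maximizer lies within `2l‖u‖ / μ₂`. Thus the slope changes by `O(l²‖u‖ / μ₂)`.
Together with `le_primal_add` this is the substitute for Danskin's theorem. -/
theorem primal_add_le {x : E} {y : F} (hy : f x y = primal f x) (u : E) :
    primal f (x + u) ≤ primal f x + inner ℝ (gx x y) u + 4 * (l ^ 2 / μ₂) * ‖u‖ ^ 2 := by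
  obtain ⟨z, hz, hd⟩ := h.exists_near_maximizer (x + u) y
  have hμ := h.μ₂_pos
  have hl := h.l_pos
  have h1 : ‖gy (x + u) y‖ ≤ l * ‖u‖ := by
    have := h.lip_y (x + u) x y
    rwa [h.gy_eq_zero hy, sub_zero, add_sub_cancel_left] at this
  have h2 : ‖z - y‖ ≤ 2 * l / μ₂ * ‖u‖ := by
    rw [div_mul_eq_mul_div, le_div_iff₀ hμ, norm_sub_rev]
    nlinarith
  have h3 := (abs_le.1 (h.taylor x z u 0)).2
  simp only [add_zero, inner_zero_right, norm_zero, sub_zero] at h3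
  have h4 : inner ℝ (gx x z) u ≤ inner ℝ (gx x y) u + l * (2 * l / μ₂ * ‖u‖) * ‖u‖ := by
    rw [← sub_le_iff_le_add', ← inner_sub_left]
    refine (real_inner_le_norm _ _).trans ?_
    gcongr
    exact (h.lip_x x z y).trans (by gcongr)
  have h5 : l ≤ l ^ 2 / μ₂ := by
    rw [le_div_iff₀ hμ, sq]; exact mul_le_mul_of_nonneg_left h.μ₂_le hl.le
  have h6 : l * (2 * l / μ₂ * ‖u‖) * ‖u‖ = 2 * (l ^ 2 / μ₂) * ‖u‖ ^ 2 := by ring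
  have h7 := h.le_primal x z
  rw [← hz]
  nlinarith [mul_le_mul_of_nonneg_right h5 (sq_nonneg ‖u‖)]

/-- The partial gradient in `x` does not depend on the maximizer. -/
theorem gx_eq_of_max {x : E} {y y' : F} (hy : f x y = primal f x) (hy' : f x y' = primal f x) :
    gx x y = gx x y' := by
  -- The lower model built on `y` lies below the upper model built on `y'`. Both touch `primal f` at
  -- `x`, so their slopes agree. `A` is the sum of the two curvatures.
  set A : ℝ := 4 * (l ^ 2 / μ₂) + 2 * l with hA
  have hμ := h.μ₂_pos
  have hl := h.l_pos
  have hApos : 0 < A := by positivity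
  have h1 := h.primal_add_le hy' ((1 / (2 * A)) • (gx x y - gx x y'))
  have h2 := h.le_primal_add hy ((1 / (2 * A)) • (gx x y - gx x y'))
  have h3 : inner ℝ (gx x y - gx x y') ((1 / (2 * A)) • (gx x y - gx x y')) ≤
      A * ‖(1 / (2 * A)) • (gx x y - gx x y')‖ ^ 2 := by
    rw [inner_sub_left, hA]; linarith
  rw [inner_smul_right, real_inner_self_eq_norm_sq, norm_smul,
    Real.norm_of_nonneg (by positivity : 0 ≤ 1 / (2 * A))] at h3
  have h4 : A * (1 / (2 * A) * ‖gx x y - gx x y'‖) ^ 2 =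
      1 / (4 * A) * ‖gx x y - gx x y'‖ ^ 2 := by field_simp; ring
  have h5 : 1 / (2 * A) = 1 / (4 * A) + 1 / (4 * A) := by field_simp; ring
  rw [h4, h5, add_mul] at h3
  have h6 : ‖gx x y - gx x y'‖ ^ 2 = 0 :=
    le_antisymm (nonpos_of_mul_nonpos_right (by linarith : 1 / (4 * A) * _ ≤ 0) (by positivity))
      (by positivity)
  rw [sq_eq_zero_iff, norm_eq_zero, sub_eq_zero] at h6
  exact h6

theorem continuous_primal : Continuous (primal f) := by
  rw [continuous_iff_continuousAt]
  intro x
  obtain ⟨y, hy⟩ := h.exists_eq_primal x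
  have h0 : Filter.Tendsto (fun z : E => z - x) (nhds x) (nhds 0) := by
    simpa using (continuous_id.sub continuous_const).tendsto (f := fun z : E => z - x) x
  have hlim : ∀ a : ℝ, Filter.Tendsto (fun z : E => primal f x + inner ℝ (gx x y) (z - x) +
      a * ‖z - x‖ ^ 2) (nhds x) (nhds (primal f x)) := by
    intro a
    have := ((tendsto_const_nhds (x := gx x y)).inner (𝕜 := ℝ) h0).const_add (primal f x) |>.add
      ((h0.norm.pow 2).const_mul a)
    simpa using this
  refine tendsto_of_tendsto_of_tendsto_of_le_of_le (hlim (-(2 * l))) (hlim (4 * (l ^ 2 / μ₂)))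
    (fun z => ?_) (fun z => ?_)
  · have := h.le_primal_add hy (z - x)
    rw [add_sub_cancel] at this
    simp only; linarith
  · have := h.primal_add_le hy (z - x)
    rw [add_sub_cancel] at this
    simp only; linarith

end MinimaxPL

end Minimax

/-! ### The Lyapunov function and the distance to the saddle points -/

section Lyapunov

variable {E F : Type*} [NormedAddCommGroup E] [InnerProductSpace ℝ E]
  [NormedAddCommGroup F] [InnerProductSpace ℝ F]

/-- The Lyapunov function `(max_y f x y - v) + (max_y f x y - f x y) / 2`, where `v` is the value
of the saddle points. -/
noncomputable def lyapunov (f : E → F → ℝ) (v : ℝ) (x : E) (y : F) : ℝ :=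
  (primal f x - v) + (primal f x - f x y) / 2

/-- `v` is the value of `f` at a saddle point. -/
def IsSaddleValue (f : E → F → ℝ) (v : ℝ) : Prop :=
  ∃ x y, f x y = v ∧ (∀ y', f x y' ≤ v) ∧ ∀ x', v ≤ f x' y

omit [NormedAddCommGroup E] [InnerProductSpace ℝ E] [NormedAddCommGroup F] [InnerProductSpace ℝ F] in
theorem IsSaddleValue.swap {f : E → F → ℝ} {v : ℝ} (hv : IsSaddleValue f v) :
    IsSaddleValue (fun y x => -f x y) (-v) := by
  obtain ⟨x, y, h1, h2, h3⟩ := hv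
  exact ⟨y, x, by simp [h1], fun x' => neg_le_neg (h3 x'), fun y' => neg_le_neg (h2 y')⟩

namespace MinimaxPL

variable {f : E → F → ℝ} {gx : E → F → E} {gy : E → F → F} {l μ₁ μ₂ v : ℝ}
  (h : MinimaxPL f gx gy l μ₁ μ₂) (hv : IsSaddleValue f v)
include h

omit h in
theorem saddleValue_le_primal (h : MinimaxPL f gx gy l μ₁ μ₂) (hv : IsSaddleValue f v) (x : E) :
    v ≤ primal f x := by
  obtain ⟨xs, ys, -, -, h3⟩ := hv
  exact (h3 x).trans (h.le_primal x ys)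

theorem lyapunov_nonneg (hv : IsSaddleValue f v) (x : E) (y : F) : 0 ≤ lyapunov f v x y := by
  have h1 := h.saddleValue_le_primal hv x
  have h2 := h.le_primal x y
  unfold lyapunov; linarith

/-- PL in `x` is compared with the saddle abscissa `xs`: `f xs y ≤ v` for every `y`, in particular
for the maximizer at `x`. -/
theorem pl_primal (hv : IsSaddleValue f v) {x : E} {y : F} (hy : f x y = primal f x) :
    2 * μ₁ * (primal f x - v) ≤ ‖gx x y‖ ^ 2 := by
  obtain ⟨xs, ys, -, h2, -⟩ := hv
  refine le_trans ?_ (h.pl_x x xs y)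
  rw [hy]
  have := h.μ₁_pos
  gcongr
  exact h2 y

variable [CompleteSpace F]

theorem exists_primal_minimizer [CompleteSpace E] (hv : IsSaddleValue f v) (x : E) :
    ∃ x', primal f x' = v ∧ μ₁ * ‖x - x'‖ ^ 2 ≤ 8 * (primal f x - v) := by
  have hμ := h.μ₂_pos
  have hl := h.l_pos
  choose ym hym using h.exists_eq_primal
  exact exists_minimizer_of_pl (G := fun x => gx x (ym x)) (L := 4 * (l ^ 2 / μ₂)) (by positivity)
    h.μ₁_pos (fun x u => h.primal_add_le (hym x) u) (h.saddleValue_le_primal hv)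
    (fun x => h.pl_primal hv (hym x)) x

/-- The distance to the set of saddle points. -/
theorem exists_saddle_near [CompleteSpace E] (hv : IsSaddleValue f v) (x : E) (y : F) :
    ∃ x' y', f x' y' = v ∧ (∀ y'', f x' y'' ≤ v) ∧ (∀ x'', v ≤ f x'' y') ∧
      ‖x - x'‖ ^ 2 + ‖y - y'‖ ^ 2 ≤ 8 / μ₁ * (primal f x - v) + 8 / μ₂ * (primal f x - f x y) +
        4 / (μ₁ * μ₂) * ‖gx x y‖ ^ 2 := by
  -- A minimizer of the primal and a maximizer of the dual function can be chosen independently.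
  -- Both attain the value `v`, so every such pair is a saddle point.
  obtain ⟨x', hx', hdx⟩ := h.exists_primal_minimizer hv x
  obtain ⟨y', hy', hdy⟩ := h.swap.exists_primal_minimizer hv.swap y
  have h1 : ∀ y'', f x' y'' ≤ v := fun y'' => hx' ▸ h.le_primal x' y''
  have h2 : ∀ x'', v ≤ f x'' y' := fun x'' =>
    neg_le_neg_iff.1 (hy' ▸ h.swap.le_primal y' x'')
  have hμ₁ := h.μ₁_pos
  have hμ₂ := h.μ₂_pos
  refine ⟨x', y', le_antisymm (h1 y') (h2 x'), h1, h2, ?_⟩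
  have h3 := h.swap.pl_primal_sub y x
  rw [norm_neg] at h3
  have h4 := h.saddleValue_le_primal hv x
  set D := primal (fun y x => -f x y) y with hD
  have h5 : ‖x - x'‖ ^ 2 ≤ 8 / μ₁ * (primal f x - v) := by
    rw [div_mul_eq_mul_div, le_div_iff₀ hμ₁]; linarith
  have h6 : ‖y - y'‖ ^ 2 ≤ 8 / μ₂ * (D - -v) := by
    rw [div_mul_eq_mul_div, le_div_iff₀ hμ₂]; linarith
  -- The dual gap `v - min_x f` splits at `f x y`. One part is at most the primal gap in `y`, the
  -- other is bounded by PL in `x`.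
  have h7 : D - -v ≤ (primal f x - f x y) + 1 / (2 * μ₁) * ‖gx x y‖ ^ 2 := by
    have : D - -f x y ≤ 1 / (2 * μ₁) * ‖gx x y‖ ^ 2 := by
      rw [one_div, inv_mul_eq_div, le_div_iff₀ (by positivity)]; linarith
    linarith
  have h8 : 8 / μ₂ * (D - -v) ≤
      8 / μ₂ * ((primal f x - f x y) + 1 / (2 * μ₁) * ‖gx x y‖ ^ 2) := by gcongr
  have h9 : 8 / μ₂ * ((primal f x - f x y) + 1 / (2 * μ₁) * ‖gx x y‖ ^ 2) =
      8 / μ₂ * (primal f x - f x y) + 4 / (μ₁ * μ₂) * ‖gx x y‖ ^ 2 := by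
    field_simp; ring
  linarith

/-- The given maximizer may be far from `y`, but `gx` takes the same value at all maximizers, so one
near `y` can be used. -/
theorem norm_gx_sub_le {x : E} {y y₀ : F} (hy : f x y₀ = primal f x) :
    ‖gx x y₀ - gx x y‖ ≤ 2 * (l / μ₂) * ‖gy x y‖ := by
  obtain ⟨z, hz, hd⟩ := h.exists_near_maximizer x y
  have hμ := h.μ₂_pos
  rw [h.gx_eq_of_max hy hz]
  refine (h.lip_x x z y).trans ?_
  rw [norm_sub_rev]
  have : ‖y - z‖ ≤ 2 / μ₂ * ‖gy x y‖ := by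
    rw [div_mul_eq_mul_div, le_div_iff₀ hμ]; linarith
  calc l * ‖y - z‖ ≤ l * (2 / μ₂ * ‖gy x y‖) := mul_le_mul_of_nonneg_left this h.l_pos.le
    _ = _ := by ring

/-- This is 3/2 times the upper model of `primal f` minus 1/2 times the lower model of `f`. The
curvature in `x` is `6 l² / μ₂ + l`, at most `7 l² / μ₂`. -/
theorem lyapunov_add_le {x : E} {y y₀ : F} (hy : f x y₀ = primal f x) (a : E) (b : F) :
    lyapunov f v (x + a) (y + b) ≤ lyapunov f v x y +
      inner ℝ ((3 / 2 : ℝ) • gx x y₀ - (1 / 2 : ℝ) • gx x y) a - 1 / 2 * inner ℝ (gy x y) b +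
      7 * (l ^ 2 / μ₂) * ‖a‖ ^ 2 + l * ‖b‖ ^ 2 := by
  have h1 := h.primal_add_le hy a
  have h2 := (_root_.abs_le.1 (h.taylor x y a b)).1
  have hμ := h.μ₂_pos
  have h5 : l ≤ l ^ 2 / μ₂ := by
    rw [le_div_iff₀ hμ, sq]; exact mul_le_mul_of_nonneg_left h.μ₂_le h.l_pos.le
  have h6 := mul_le_mul_of_nonneg_right h5 (sq_nonneg ‖a‖)
  rw [inner_sub_left, real_inner_smul_left, real_inner_smul_left]
  unfold lyapunov
  linarith

/-- The Lyapunov function at distance `R` from a saddle point. -/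
theorem lyapunov_le_of_near {xs : E} {ys : F} (hs : f xs ys = v) (hmax : ∀ y, f xs y ≤ v)
    (hmin : ∀ x, v ≤ f x ys) {x : E} {y : F} :
    lyapunov f v x y ≤ 7 * (l ^ 2 / μ₂) * ‖x - xs‖ ^ 2 + l * ‖y - ys‖ ^ 2 := by
  have : Nonempty F := ⟨ys⟩
  have hp : f xs ys = primal f xs :=
    le_antisymm (h.le_primal xs ys) (hs ▸ ciSup_le hmax)
  have hgy := h.gy_eq_zero hp
  have hgx : gx xs ys = 0 := by
    have : f xs ys = -primal (fun y x => -f x y) ys := by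
      have : Nonempty E := ⟨xs⟩
      rw [eq_comm, neg_eq_iff_eq_neg]
      refine le_antisymm (ciSup_le fun x => neg_le_neg (hs ▸ hmin x)) (h.swap.le_primal ys xs)
    have := h.swap.gy_eq_zero (x := ys) (y := xs) (by rw [this, neg_neg])
    simpa using this
  have := h.lyapunov_add_le (v := v) (y := ys) hp (x - xs) (y - ys)
  simp only [add_sub_cancel, hgx, hgy, smul_zero, sub_zero, inner_zero_left, mul_zero,
    add_zero] at this
  have h0 : lyapunov f v xs ys = 0 := by simp [lyapunov, ← hp, hs]
  linarith

theorem continuous_lyapunov (hf : Continuous fun w : E × F => f w.1 w.2) :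
    Continuous fun w : E × F => lyapunov f v w.1 w.2 := by
  unfold lyapunov
  have := h.continuous_primal
  fun_prop

end MinimaxPL

end Lyapunov

/-! ### Expected decrease in one perturbed descent-ascent step -/

section ExpectedStep

variable {E F : Type*} [NormedAddCommGroup E] [InnerProductSpace ℝ E]
  [NormedAddCommGroup F] [InnerProductSpace ℝ F]

omit [InnerProductSpace ℝ E] in
theorem norm_add_three_sq_le (a b c : E) :
    ‖a + b + c‖ ^ 2 ≤ 3 * (‖a‖ ^ 2 + ‖b‖ ^ 2 + ‖c‖ ^ 2) := by
  have h : ‖a + b + c‖ ≤ ‖a‖ + ‖b‖ + ‖c‖ := norm_add₃_le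
  have h2 : ‖a + b + c‖ ^ 2 ≤ (‖a‖ + ‖b‖ + ‖c‖) ^ 2 := by gcongr
  nlinarith [sq_nonneg (‖a‖ - ‖b‖), sq_nonneg (‖a‖ - ‖c‖), sq_nonneg (‖b‖ - ‖c‖)]

/-- The contraction estimate, with all moments replaced by real numbers: `p`, `u`, `w` are the
squared norms of the gradient of the primal function and of the partial gradients, `n` and `r`
the second moments of noise and drift. -/
theorem lyapunov_arith {l μ₁ μ₂ γ ν n r p u w a b V : ℝ} (hl : 0 < l) (hμ₁ : 0 < μ₁)
    (hμ : μ₁ ≤ μ₂) (hμ₂ : μ₂ ≤ l) (hγ : 0 < γ) (hγl : 48 * l * γ ≤ 1) (hn : 0 ≤ n) (hr0 : 0 ≤ r)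
    (hu : 0 ≤ u) (hw : 0 ≤ w) (ha0 : 0 ≤ a) (hb0 : 0 ≤ b)
    (hr : r ≤ μ₂ ^ 2 / (768 * l ^ 2) * (u + w) + ν)
    (ha : 2 * μ₁ * a ≤ p) (hb : 2 * μ₂ * b ≤ w) (hV : V = a + b / 2) :
    V + γ * μ₂ ^ 2 / (48 * l ^ 2) *
        (-(1 / 2) * p - (3 / 16) * u + (3 / 4) * (4 * (l / μ₂) ^ 2 * w) + 13 / 4 * r) -
      γ * (3 / 8 * w) + γ / 2 * r +
      7 * (l ^ 2 / μ₂) * (γ * μ₂ ^ 2 / (48 * l ^ 2)) ^ 2 * (3 * (u + n + r)) +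
      l * γ ^ 2 * (3 * (w + n + r)) ≤
    (1 - γ * μ₂ ^ 2 / (48 * l ^ 2) * μ₁ / 2) * V - γ * μ₂ ^ 2 / (48 * l ^ 2) * μ₁ ^ 2 / 64 *
      (8 / μ₁ * a + 8 / μ₂ * b + 4 / (μ₁ * μ₂) * u) + 4 * l * γ ^ 2 * n + γ * ν := by
  have hμ₂p : 0 < μ₂ := hμ₁.trans_le hμ
  set g := γ * μ₂ ^ 2 / (48 * l ^ 2) with hg
  have hgpos : 0 < g := by positivity
  have hk : μ₂ / l ≤ 1 := by rw [div_le_one hl]; exact hμ₂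
  have hkpos : 0 < μ₂ / l := by positivity
  have hgγ : g = γ / 48 * (μ₂ / l) ^ 2 := by rw [hg]; field_simp
  have hg48 : g ≤ γ / 48 := by
    rw [hgγ]; exact mul_le_of_le_one_right (by positivity) (pow_le_one₀ hkpos.le hk)
  -- The reason for the ratio `μ₂² / (48 l²)` of the two steps: the gradient error in `x` costs only
  -- `γ w / 16`, well below the `3γ w / 8` gained in `y`.
  have e1 : g * ((3 / 4) * (4 * (l / μ₂) ^ 2 * w)) = γ * w / 16 := by
    rw [hg]; field_simp; ring
  have e2 : 7 * (l ^ 2 / μ₂) * g ^ 2 = g * (7 * l * γ / 48 * (μ₂ / l)) := by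
    rw [hg]; field_simp
  have e3 : g * (7 * l * γ / 48 * (μ₂ / l)) ≤ g * (1 / 48) := by
    gcongr
    calc 7 * l * γ / 48 * (μ₂ / l) ≤ 7 * l * γ / 48 * 1 := by gcongr
      _ ≤ 1 / 48 := by nlinarith [mul_pos hl hγ]
  have e3' : g * (7 * l * γ / 48 * (μ₂ / l)) ≤ l * γ ^ 2 / 300 := by
    calc g * (7 * l * γ / 48 * (μ₂ / l)) ≤ γ / 48 * (7 * l * γ / 48 * 1) := by gcongr
      _ ≤ l * γ ^ 2 / 300 := by nlinarith [mul_pos hl (sq_pos_of_pos hγ)]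
  -- Since `768 = 16 * 48`, the part of the drift proportional to the squared gradients is small
  -- even on the slow scale `g`.
  have e4 : γ * (μ₂ ^ 2 / (768 * l ^ 2)) = g / 16 := by rw [hg]; field_simp; norm_num
  have hr' : γ * r ≤ g / 16 * (u + w) + γ * ν := by
    rw [← e4]; nlinarith
  have e5 : l * γ ^ 2 ≤ γ / 48 := by nlinarith
  have q1 : g * μ₁ ^ 2 / 64 * (8 / μ₁ * a) = g * (μ₁ * a) / 8 := by field_simp; ring
  have q2 : g * μ₁ ^ 2 / 64 * (8 / μ₂ * b) ≤ γ / 48 * (μ₂ * b) / 8 := by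
    have : g * μ₁ ^ 2 / 64 * (8 / μ₂ * b) = g * (μ₁ * (μ₁ / μ₂) * b) / 8 := by field_simp; ring
    rw [this]
    have h1 : μ₁ / μ₂ ≤ 1 := by rw [div_le_one hμ₂p]; exact hμ
    have h2 : μ₁ * (μ₁ / μ₂) ≤ μ₂ * 1 := by gcongr
    have h3 : 0 ≤ μ₁ * (μ₁ / μ₂) := by positivity
    rw [mul_one] at h2
    gcongr
  -- The retained gradient term is affordable because `μ₁ ≤ μ₂`. The remaining `-(3 / 16) g u` of
  -- the descent pays for it.
  have q3 : g * μ₁ ^ 2 / 64 * (4 / (μ₁ * μ₂) * u) ≤ g * u / 16 := by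
    have : g * μ₁ ^ 2 / 64 * (4 / (μ₁ * μ₂) * u) = g * ((μ₁ / μ₂) * u) / 16 := by
      field_simp; ring
    rw [this]
    have h1 : μ₁ / μ₂ ≤ 1 := by rw [div_le_one hμ₂p]; exact hμ
    gcongr
    exact mul_le_of_le_one_left hu h1
  have q4 : g * μ₁ / 2 * (b / 2) ≤ γ / 48 * (μ₂ * b) / 4 := by
    have : g * μ₁ / 2 * (b / 2) = g * (μ₁ * b) / 4 := by ring
    rw [this]; gcongr
  have m1 : g * (2 * (μ₁ * a)) ≤ g * p := by gcongr; linarith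
  have m2 : γ * (2 * (μ₂ * b)) ≤ γ * w := by gcongr; linarith
  have m3 : g * w ≤ γ / 48 * w := by gcongr
  have m4 : g * r ≤ γ / 48 * r := by gcongr
  have m5 : 0 ≤ γ * r := by positivity
  have m6 : 0 ≤ g * (μ₁ * a) := by positivity
  have m7 : 0 ≤ γ * (μ₂ * b) := by positivity
  have m8 : 0 ≤ γ * w := by positivity
  have t1 : 7 * (l ^ 2 / μ₂) * g ^ 2 * (3 * (u + n + r)) ≤
      g * (1 / 48) * (3 * (u + r)) + l * γ ^ 2 / 300 * (3 * n) := by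
    rw [e2]
    have s1 := mul_le_mul_of_nonneg_right e3 (by positivity : 0 ≤ 3 * (u + r))
    have s2 := mul_le_mul_of_nonneg_right e3' (by positivity : 0 ≤ 3 * n)
    linarith
  have t2 : l * γ ^ 2 * (3 * (w + n + r)) ≤ γ / 48 * (3 * (w + r)) + l * γ ^ 2 * (3 * n) := by
    have s1 := mul_le_mul_of_nonneg_right e5 (by positivity : 0 ≤ 3 * (w + r))
    linarith
  have m9 : 0 ≤ l * γ ^ 2 * n := by positivity
  have m10 : 0 ≤ g * u := by positivity
  have m11 : 0 ≤ g * w := by positivity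
  rw [hV]
  linarith

theorem integrable_affine_combination {Ω : Type*} [MeasurableSpace Ω] {P : Measure Ω}
    [IsProbabilityMeasure P] (c k₁ k₂ k₃ k₄ k₅ k₆ : ℝ) {a₁ a₂ a₃ a₄ a₅ a₆ : Ω → ℝ}
    (i₁ : Integrable a₁ P) (i₂ : Integrable a₂ P) (i₃ : Integrable a₃ P) (i₄ : Integrable a₄ P)
    (i₅ : Integrable a₅ P) (i₆ : Integrable a₆ P) :
    Integrable (fun ω => c + k₁ * a₁ ω + k₂ * a₂ ω + k₃ * a₃ ω + k₄ * a₄ ω + k₅ * a₅ ω +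
      k₆ * a₆ ω) P ∧
    ∫ ω, (c + k₁ * a₁ ω + k₂ * a₂ ω + k₃ * a₃ ω + k₄ * a₄ ω + k₅ * a₅ ω + k₆ * a₆ ω) ∂P =
      c + k₁ * ∫ ω, a₁ ω ∂P + k₂ * ∫ ω, a₂ ω ∂P + k₃ * ∫ ω, a₃ ω ∂P + k₄ * ∫ ω, a₄ ω ∂P +
        k₅ * ∫ ω, a₅ ω ∂P + k₆ * ∫ ω, a₆ ω ∂P := by
  have j1 := (integrable_const (μ := P) c).add (i₁.const_mul k₁)
  have j2 := j1.add (i₂.const_mul k₂)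
  have j3 := j2.add (i₃.const_mul k₃)
  have j4 := j3.add (i₄.const_mul k₄)
  have j5 := j4.add (i₅.const_mul k₅)
  refine ⟨j5.add (i₆.const_mul k₆), ?_⟩
  rw [integral_add (by exact j5) (i₆.const_mul _), integral_add (by exact j4) (i₅.const_mul _),
    integral_add (by exact j3) (i₄.const_mul _), integral_add (by exact j2) (i₃.const_mul _),
    integral_add (by exact j1) (i₂.const_mul _),
    integral_add (integrable_const c) (i₁.const_mul _)]
  simp only [integral_const_mul]
  simp

variable [CompleteSpace F] {f : E → F → ℝ} {gx : E → F → E} {gy : E → F → F} {l μ₁ μ₂ v : ℝ}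

set_option maxHeartbeats 800000 in
/-- The expected decrease of the Lyapunov function in a step along `-(gx + Nx + Rx)` and
`gy + Ny + Ry`, where `N` is centred noise and `R` is a small drift. -/
theorem MinimaxPL.integral_lyapunov_step_le [CompleteSpace E] (h : MinimaxPL f gx gy l μ₁ μ₂)
    (hv : IsSaddleValue f v) (hμ : μ₁ ≤ μ₂) (hf : Continuous fun w : E × F => f w.1 w.2)
    {Ω : Type*} [MeasurableSpace Ω] {P : Measure Ω} [IsProbabilityMeasure P]
    {Nx Rx : Ω → E} {Ny Ry : Ω → F} {γ n ν : ℝ} (hγ : 0 < γ) (hγl : 48 * l * γ ≤ 1) (x : E) (y : F)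
    (hNx : MemLp Nx 2 P) (hRx : MemLp Rx 2 P) (hNy : MemLp Ny 2 P) (hRy : MemLp Ry 2 P)
    (hNx0 : ∫ ω, Nx ω ∂P = 0) (hNy0 : ∫ ω, Ny ω ∂P = 0)
    (hn : ∫ ω, ‖Nx ω‖ ^ 2 ∂P + ∫ ω, ‖Ny ω‖ ^ 2 ∂P ≤ n)
    (hr : ∫ ω, ‖Rx ω‖ ^ 2 ∂P + ∫ ω, ‖Ry ω‖ ^ 2 ∂P ≤
      μ₂ ^ 2 / (768 * l ^ 2) * (‖gx x y‖ ^ 2 + ‖gy x y‖ ^ 2) + ν) :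
    Integrable (fun ω => lyapunov f v
      (x - (γ * μ₂ ^ 2 / (48 * l ^ 2)) • (gx x y + Nx ω + Rx ω))
      (y + γ • (gy x y + Ny ω + Ry ω))) P ∧
    ∫ ω, lyapunov f v
      (x - (γ * μ₂ ^ 2 / (48 * l ^ 2)) • (gx x y + Nx ω + Rx ω))
      (y + γ • (gy x y + Ny ω + Ry ω)) ∂P ≤
      (1 - γ * μ₂ ^ 2 / (48 * l ^ 2) * μ₁ / 2) * lyapunov f v x y -
        γ * μ₂ ^ 2 / (48 * l ^ 2) * μ₁ ^ 2 / 64 * (8 / μ₁ * (primal f x - v) +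
          8 / μ₂ * (primal f x - f x y) + 4 / (μ₁ * μ₂) * ‖gx x y‖ ^ 2) +
        4 * l * γ ^ 2 * n + γ * ν := by
  have hl := h.l_pos
  have hμ₁p := h.μ₁_pos
  have hμ₂p := h.μ₂_pos
  obtain ⟨y₀, hy₀⟩ := h.exists_eq_primal x
  set g := γ * μ₂ ^ 2 / (48 * l ^ 2) with hg
  have hgpos : 0 < g := by positivity
  set D := (3 / 2 : ℝ) • gx x y₀ - (1 / 2 : ℝ) • gx x y with hD
  set A := 7 * (l ^ 2 / μ₂) with hA
  have hApos : 0 < A := by positivity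
  set c : ℝ := lyapunov f v x y - g * inner ℝ D (gx x y) +
    g * (‖gx x y₀‖ ^ 2 / 4 + ‖gx x y‖ ^ 2 / 16) - γ / 2 * ‖gy x y‖ ^ 2 + γ * (‖gy x y‖ ^ 2 / 8) +
    A * g ^ 2 * (3 * ‖gx x y‖ ^ 2) + l * γ ^ 2 * (3 * ‖gy x y‖ ^ 2) with hc
  let U : Ω → ℝ := fun ω => c + (-g) * inner ℝ D (Nx ω) + (-(γ / 2)) * inner ℝ (gy x y) (Ny ω) +
    (3 * A * g ^ 2) * ‖Nx ω‖ ^ 2 + (3 * l * γ ^ 2) * ‖Ny ω‖ ^ 2 +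
    (3 * A * g ^ 2 + 13 / 4 * g) * ‖Rx ω‖ ^ 2 + (3 * l * γ ^ 2 + γ / 2) * ‖Ry ω‖ ^ 2
  have hle : ∀ ω, lyapunov f v (x - g • (gx x y + Nx ω + Rx ω))
      (y + γ • (gy x y + Ny ω + Ry ω)) ≤ U ω := by
    intro ω
    have h1 := h.lyapunov_add_le (v := v) (y := y) hy₀ (-(g • (gx x y + Nx ω + Rx ω)))
      (γ • (gy x y + Ny ω + Ry ω))
    rw [← sub_eq_add_neg, ← hD, ← hA, inner_neg_right, inner_smul_right, inner_smul_right,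
      norm_neg, norm_smul, norm_smul, Real.norm_of_nonneg hγ.le, Real.norm_of_nonneg hgpos.le,
      mul_pow, mul_pow] at h1
    have h2 := mul_le_mul_of_nonneg_left (norm_add_three_sq_le (gx x y) (Nx ω) (Rx ω))
      (by positivity : 0 ≤ A * g ^ 2)
    have h3 := mul_le_mul_of_nonneg_left (norm_add_three_sq_le (gy x y) (Ny ω) (Ry ω))
      (by positivity : 0 ≤ l * γ ^ 2)
    -- The drift is not centred, so its inner products are absorbed by Young's inequality. Those
    -- with the noise are kept, since they integrate to zero.
    have h4 : -inner ℝ D (Rx ω) ≤ ‖gx x y₀‖ ^ 2 / 4 + ‖gx x y‖ ^ 2 / 16 + 13 / 4 * ‖Rx ω‖ ^ 2 := by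
      have a1 := (abs_le.1 (abs_real_inner_le_norm (gx x y₀) (Rx ω))).1
      have a2 := (abs_le.1 (abs_real_inner_le_norm (gx x y) (Rx ω))).2
      rw [hD, inner_sub_left, real_inner_smul_left, real_inner_smul_left]
      nlinarith [sq_nonneg (‖gx x y₀‖ / 2 - 3 / 2 * ‖Rx ω‖), sq_nonneg (‖gx x y‖ / 4 - ‖Rx ω‖)]
    have h5 : -inner ℝ (gy x y) (Ry ω) ≤ ‖gy x y‖ ^ 2 / 4 + ‖Ry ω‖ ^ 2 := by
      have a1 := (abs_le.1 (abs_real_inner_le_norm (gy x y) (Ry ω))).1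
      nlinarith [sq_nonneg (‖gy x y‖ / 2 - ‖Ry ω‖)]
    have h6 := mul_le_mul_of_nonneg_left h4 hgpos.le
    have h7 := mul_le_mul_of_nonneg_left h5 hγ.le
    rw [inner_add_right, inner_add_right, inner_add_right, inner_add_right,
      real_inner_self_eq_norm_sq] at h1
    simp only [U, hc]
    linarith
  have i1 : Integrable (fun ω => inner ℝ D (Nx ω)) P :=
    (hNx.integrable (by norm_num)).const_inner D
  have i2 : Integrable (fun ω => inner ℝ (gy x y) (Ny ω)) P :=
    (hNy.integrable (by norm_num)).const_inner _
  have i3 := hNx.integrable_norm_pow two_ne_zero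
  have i4 := hNy.integrable_norm_pow two_ne_zero
  have i5 := hRx.integrable_norm_pow two_ne_zero
  have i6 := hRy.integrable_norm_pow two_ne_zero
  have hU := integrable_affine_combination c (-g) (-(γ / 2)) (3 * A * g ^ 2) (3 * l * γ ^ 2)
    (3 * A * g ^ 2 + 13 / 4 * g) (3 * l * γ ^ 2 + γ / 2) i1 i2 i3 i4 i5 i6
  rw [integral_inner (hNx.integrable (by norm_num)), integral_inner (hNy.integrable
    (by norm_num)), hNx0, hNy0, inner_zero_right, inner_zero_right, mul_zero, mul_zero, add_zero,
    add_zero] at hU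
  have hmeas : AEStronglyMeasurable (fun ω => lyapunov f v (x - g • (gx x y + Nx ω + Rx ω))
      (y + γ • (gy x y + Ny ω + Ry ω))) P := by
    have a1 : AEStronglyMeasurable (fun ω => x - g • (gx x y + Nx ω + Rx ω)) P :=
      aestronglyMeasurable_const.sub (((aestronglyMeasurable_const.add hNx.1).add
        hRx.1).const_smul g)
    have a2 : AEStronglyMeasurable (fun ω => y + γ • (gy x y + Ny ω + Ry ω)) P :=
      aestronglyMeasurable_const.add (((aestronglyMeasurable_const.add hNy.1).add
        hRy.1).const_smul γ)
    exact (h.continuous_lyapunov (v := v) hf).comp_aestronglyMeasurable (a1.prodMk a2)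
  -- Nonnegativity of the Lyapunov function turns the pointwise upper bound into domination.
  have hint : Integrable (fun ω => lyapunov f v (x - g • (gx x y + Nx ω + Rx ω))
      (y + γ • (gy x y + Ny ω + Ry ω))) P := by
    refine hU.1.mono' hmeas (Filter.Eventually.of_forall fun ω => ?_)
    rw [Real.norm_of_nonneg (h.lyapunov_nonneg hv _ _)]
    exact hle ω
  refine ⟨hint, (integral_mono hint hU.1 hle).trans ?_⟩
  rw [hU.2]
  have n1 : 0 ≤ ∫ ω, ‖Nx ω‖ ^ 2 ∂P := integral_nonneg fun ω => by positivity
  have n2 : 0 ≤ ∫ ω, ‖Ny ω‖ ^ 2 ∂P := integral_nonneg fun ω => by positivity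
  have n3 : 0 ≤ ∫ ω, ‖Rx ω‖ ^ 2 ∂P := integral_nonneg fun ω => by positivity
  have n4 : 0 ≤ ∫ ω, ‖Ry ω‖ ^ 2 ∂P := integral_nonneg fun ω => by positivity
  generalize ∫ ω, ‖Nx ω‖ ^ 2 ∂P = nx at *
  generalize ∫ ω, ‖Ny ω‖ ^ 2 ∂P = ny at *
  generalize ∫ ω, ‖Rx ω‖ ^ 2 ∂P = rx at *
  generalize ∫ ω, ‖Ry ω‖ ^ 2 ∂P = ry at *
  have hPL := h.pl_primal hv hy₀
  have key := lyapunov_arith (V := lyapunov f v x y) (p := ‖gx x y₀‖ ^ 2) (n := n) (r := rx + ry)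
    (ν := ν) hl hμ₁p hμ h.μ₂_le hγ hγl (by linarith) (by linarith)
    (sq_nonneg ‖gx x y‖) (sq_nonneg ‖gy x y‖) (sub_nonneg.2 (h.saddleValue_le_primal hv x))
    (sub_nonneg.2 (h.le_primal x y)) hr hPL (h.pl_primal_sub x y) rfl
  rw [← hg, ← hA] at key
  refine le_trans ?_ key
  have he : ‖gx x y₀ - gx x y‖ ^ 2 ≤ 4 * (l / μ₂) ^ 2 * ‖gy x y‖ ^ 2 := by
    calc ‖gx x y₀ - gx x y‖ ^ 2 ≤ (2 * (l / μ₂) * ‖gy x y‖) ^ 2 := by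
          gcongr; exact h.norm_gx_sub_le hy₀
      _ = _ := by ring
  -- Polarization yields decrease in both `‖∇Φ‖²` and `‖gx‖²`. The second is what later controls the
  -- distance to the saddle set.
  have hin : -inner ℝ D (gx x y) = -(3 / 4) * ‖gx x y₀‖ ^ 2 - 1 / 4 * ‖gx x y‖ ^ 2 +
      3 / 4 * ‖gx x y₀ - gx x y‖ ^ 2 := by
    rw [hD, inner_sub_left, real_inner_smul_left, real_inner_smul_left, real_inner_self_eq_norm_sq,
      norm_sub_sq_real]
    ring
  have hin2 : g * (-inner ℝ D (gx x y)) ≤ g * (-(3 / 4) * ‖gx x y₀‖ ^ 2 - 1 / 4 * ‖gx x y‖ ^ 2 +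
      3 / 4 * (4 * (l / μ₂) ^ 2 * ‖gy x y‖ ^ 2)) := by
    rw [hin]; gcongr
  have s1 : A * g ^ 2 * nx + A * g ^ 2 * ny ≤ A * g ^ 2 * n := by
    rw [← mul_add]; gcongr
  have s2 : l * γ ^ 2 * nx + l * γ ^ 2 * ny ≤ l * γ ^ 2 * n := by
    rw [← mul_add]; gcongr
  have s3 : 0 ≤ A * g ^ 2 * ny := by positivity
  have s4 : 0 ≤ l * γ ^ 2 * nx := by positivity
  have s5 : 0 ≤ A * g ^ 2 * ry := by positivity
  have s6 : 0 ≤ l * γ ^ 2 * rx := by positivity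
  have s7 : 0 ≤ g * ry := by positivity
  have s8 : 0 ≤ γ * rx := by positivity
  rw [hc]
  linarith

end ExpectedStep

/-! ### Second moments of sums with conditionally centred terms -/

section CentredNoise

variable {A B H : Type*} [MeasurableSpace A] [MeasurableSpace B] [NormedAddCommGroup H]
  [InnerProductSpace ℝ H] {μ : Measure A} {ν : Measure B}
  [IsProbabilityMeasure μ] [IsProbabilityMeasure ν]

omit [IsProbabilityMeasure μ] [IsProbabilityMeasure ν] in
theorem _root_.MeasureTheory.MeasurePreserving.integral_comp_aesm {K : Type*}
    [NormedAddCommGroup K] [NormedSpace ℝ K] {φ : A → B} (h : MeasurePreserving φ μ ν) {g : B → K}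
    (hg : AEStronglyMeasurable g ν) : ∫ a, g (φ a) ∂μ = ∫ b, g b ∂ν := by
  rw [← h.map_eq, integral_map h.measurable.aemeasurable (by rwa [h.map_eq])]

omit [IsProbabilityMeasure μ] [IsProbabilityMeasure ν] [InnerProductSpace ℝ H] in
theorem _root_.MeasureTheory.MeasurePreserving.integral_norm_sq_comp {φ : A → B}
    (h : MeasurePreserving φ μ ν) {g : B → H} (hg : AEStronglyMeasurable g ν) :
    ∫ a, ‖g (φ a)‖ ^ 2 ∂μ = ∫ b, ‖g b‖ ^ 2 ∂ν :=
  h.integral_comp_aesm (g := fun b => ‖g b‖ ^ 2) (hg.norm.pow 2)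

omit [InnerProductSpace ℝ H] in
theorem memLp_two_prod {n : A × B → H} {s : ℝ} (hn : AEStronglyMeasurable n (μ.prod ν))
    (hLp : ∀ᵐ a ∂μ, MemLp (fun b => n (a, b)) 2 ν)
    (hs : ∀ᵐ a ∂μ, ∫ b, ‖n (a, b)‖ ^ 2 ∂ν ≤ s) :
    MemLp n 2 (μ.prod ν) ∧ ∫ z, ‖n z‖ ^ 2 ∂(μ.prod ν) ≤ s := by
  have hsq : AEStronglyMeasurable (fun z => ‖n z‖ ^ 2) (μ.prod ν) := hn.norm.pow 2
  have hint : Integrable (fun z => ‖n z‖ ^ 2) (μ.prod ν) := by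
    rw [integrable_prod_iff hsq]
    refine ⟨hLp.mono fun a ha => ha.integrable_norm_pow two_ne_zero, ?_⟩
    refine Integrable.mono' (integrable_const s) hsq.norm.integral_prod_right' ?_
    filter_upwards [hs] with a ha
    simp only [norm_pow, norm_norm]
    rwa [Real.norm_of_nonneg (integral_nonneg fun b => by positivity)]
  refine ⟨(memLp_two_iff_integrable_sq_norm hn).2 hint, ?_⟩
  rw [integral_prod _ hint]
  calc ∫ a, ∫ b, ‖n (a, b)‖ ^ 2 ∂ν ∂μ ≤ ∫ _, s ∂μ :=
        integral_mono_ae hint.integral_prod_left (integrable_const s) hs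
    _ = s := by simp

omit [IsProbabilityMeasure μ] in
theorem integrable_inner_of_memLp {X Y : A → H} (hX : MemLp X 2 μ) (hY : MemLp Y 2 μ) :
    Integrable (fun a => inner ℝ (X a) (Y a)) μ := by
  refine ((hX.integrable_norm_pow two_ne_zero).add (hY.integrable_norm_pow two_ne_zero)).mono'
    (hX.1.inner hY.1) (Filter.Eventually.of_forall fun a => ?_)
  refine (norm_inner_le_norm _ _).trans ?_
  simp only [Pi.add_apply]
  nlinarith [sq_nonneg (‖X a‖ - ‖Y a‖), sq_nonneg ‖X a‖, sq_nonneg ‖Y a‖]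

/-- Adding conditionally centred noise `n` to `X` keeps the mean and adds its second moment. -/
theorem add_centred_noise [CompleteSpace H] {X : A → H} {n : A × B → H} {s : ℝ}
    (hX : MemLp X 2 μ)
    (hn : AEStronglyMeasurable n (μ.prod ν)) (hLp : ∀ᵐ a ∂μ, MemLp (fun b => n (a, b)) 2 ν)
    (h0 : ∀ᵐ a ∂μ, ∫ b, n (a, b) ∂ν = 0) (hs : ∀ᵐ a ∂μ, ∫ b, ‖n (a, b)‖ ^ 2 ∂ν ≤ s) :
    MemLp (fun z => X z.1 + n z) 2 (μ.prod ν) ∧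
    ∫ z, (X z.1 + n z) ∂(μ.prod ν) = ∫ a, X a ∂μ ∧
    ∫ z, ‖X z.1 + n z‖ ^ 2 ∂(μ.prod ν) ≤ ∫ a, ‖X a‖ ^ 2 ∂μ + s := by
  obtain ⟨hnLp, hns⟩ := memLp_two_prod hn hLp hs
  have hX' : MemLp (fun z : A × B => X z.1) 2 (μ.prod ν) :=
    hX.comp_measurePreserving measurePreserving_fst
  have hni := hnLp.integrable (by norm_num)
  have hin : Integrable (fun z : A × B => inner ℝ (X z.1) (n z)) (μ.prod ν) :=
    integrable_inner_of_memLp hX' hnLp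
  have hf : MeasurePreserving Prod.fst (μ.prod ν) μ := measurePreserving_fst
  refine ⟨hX'.add hnLp, ?_, ?_⟩
  · rw [integral_add (hX'.integrable (by norm_num)) hni, hf.integral_comp_aesm hX.1, integral_prod _ hni,
      integral_eq_zero_of_ae (f := fun a => ∫ b, n (a, b) ∂ν) h0, add_zero]
  -- Integrating first over the fresh variable leaves the inner product of `X a` with a zero mean.
  · have hcross : ∫ z, inner ℝ (X z.1) (n z) ∂(μ.prod ν) = 0 := by
      rw [integral_prod _ hin]
      refine integral_eq_zero_of_ae ?_
      filter_upwards [hLp, h0] with a ha ha0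
      simp only [Pi.zero_apply]
      rw [integral_inner (ha.integrable (by norm_num)), ha0, inner_zero_right]
    have i1 := hX'.integrable_norm_pow two_ne_zero
    have i2 := hnLp.integrable_norm_pow two_ne_zero
    simp only [norm_add_sq_real]
    rw [integral_add (by exact i1.add (hin.const_mul 2)) i2, integral_add i1 (hin.const_mul 2),
      integral_const_mul, hcross, hf.integral_norm_sq_comp hX.1]
    linarith

/-- Separates the last sample from the earlier ones, so that inductions over the samples can treat
it as fresh. -/
theorem measurePreserving_init_last {n : ℕ} (ν : Fin (n + 1) → Measure B)
    [∀ i, IsProbabilityMeasure (ν i)] :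
    MeasurePreserving (fun ξ : Fin (n + 1) → B => ((fun j => ξ j.castSucc : Fin n → B),
      ξ (Fin.last n))) (Measure.pi ν)
      ((Measure.pi fun j => ν j.castSucc).prod (ν (Fin.last n))) := by
  have h := (Measure.measurePreserving_swap (μ := ν (Fin.last n))
    (ν := Measure.pi fun j => ν ((Fin.last n).succAbove j))).comp
    (measurePreserving_piFinSuccAbove ν (Fin.last n))
  simp only [Fin.succAbove_last] at h
  convert h using 1
  ext ξ
  · simp [MeasurableEquiv.piFinSuccAbove, Fin.init]
  · simp [MeasurableEquiv.piFinSuccAbove]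

/-- Sums of independent centred random vectors. -/
theorem sum_independent_centred [CompleteSpace H] {n : ℕ} (ν : Fin n → Measure B)
    [∀ i, IsProbabilityMeasure (ν i)] {Y : Fin n → B → H} {s : Fin n → ℝ}
    (hY : ∀ i, MemLp (Y i) 2 (ν i)) (h0 : ∀ i, ∫ b, Y i b ∂(ν i) = 0)
    (hs : ∀ i, ∫ b, ‖Y i b‖ ^ 2 ∂(ν i) ≤ s i) :
    MemLp (fun ξ : Fin n → B => ∑ i, Y i (ξ i)) 2 (Measure.pi ν) ∧
    ∫ ξ, ∑ i, Y i (ξ i) ∂(Measure.pi ν) = 0 ∧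
    ∫ ξ, ‖∑ i, Y i (ξ i)‖ ^ 2 ∂(Measure.pi ν) ≤ ∑ i, s i := by
  induction n with
  | zero => simp
  | succ n ih =>
    obtain ⟨h1, h2, h3⟩ := ih (fun j => ν j.castSucc) (fun j => hY j.castSucc)
      (fun j => h0 j.castSucc) (fun j => hs j.castSucc)
    have hm : MemLp (fun z : (Fin n → B) × B => Y (Fin.last n) z.2) 2
        ((Measure.pi fun j => ν j.castSucc).prod (ν (Fin.last n))) :=
      (hY _).comp_measurePreserving measurePreserving_snd
    obtain ⟨k1, k2, k3⟩ := add_centred_noise (n := fun z => Y (Fin.last n) z.2) h1 hm.1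
      (Filter.Eventually.of_forall fun _ => hY _) (Filter.Eventually.of_forall fun _ => h0 _)
      (Filter.Eventually.of_forall fun _ => hs _)
    have hp := measurePreserving_init_last ν
    have e : (fun ξ : Fin (n + 1) → B => ∑ i, Y i (ξ i)) =
        (fun z : (Fin n → B) × B => ∑ i : Fin n, Y i.castSucc (z.1 i) + Y (Fin.last n) z.2) ∘
          fun ξ => ((fun j => ξ j.castSucc : Fin n → B), ξ (Fin.last n)) := by
      ext1 ξ; simp [Fin.sum_univ_castSucc]
    refine ⟨?_, ?_, ?_⟩
    · rw [e]; exact k1.comp_measurePreserving hp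
    · rw [e, ← h2, ← k2]
      exact hp.integral_comp_aesm k1.1
    · have h4 := hp.integral_norm_sq_comp k1.1
      simp only [Fin.sum_univ_castSucc]
      rw [h4]
      linarith

end CentredNoise

theorem continuous_of_norm_sub_le {H : Type*} [NormedAddCommGroup H] {Λ : ℝ} {g : H → H}
    (h : ∀ v w, ‖g v - g w‖ ≤ Λ * ‖v - w‖) : Continuous g := by
  refine (LipschitzWith.of_dist_le_mul (K := Λ.toNNReal) fun v w => ?_).continuous
  rw [dist_eq_norm, dist_eq_norm]
  exact (h v w).trans (mul_le_mul_of_nonneg_right (Real.le_coe_toNNReal Λ) (norm_nonneg _))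

/-! ### Local steps of one client: noise and drift -/

section Trajectory

variable {B H : Type*} [MeasurableSpace B] [NormedAddCommGroup H] [InnerProductSpace ℝ H]
  [CompleteSpace H] [MeasurableSpace H] [BorelSpace H] [SecondCountableTopology H]

/-- Stochastic gradients `G b w` at the data point `b`, with mean `g w` and variance at most `σ²`
under `ν`, where `g` is `Λ`-Lipschitz. -/
structure GradientOracle (G : B → H → H) (g : H → H) (ν : Measure B) (Λ σ : ℝ) : Prop where
  measurable : Measurable fun q : B × H => G q.1 q.2
  lipschitz : ∀ v w, ‖g v - g w‖ ≤ Λ * ‖v - w‖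
  memLp : ∀ w, MemLp (fun b => G b w - g w) 2 ν
  mean : ∀ w, ∫ b, (G b w - g w) ∂ν = 0
  variance : ∀ w, ∫ b, ‖G b w - g w‖ ^ 2 ∂ν ≤ σ ^ 2

/-- The point reached by `K` local steps of size `η` along the directions `J (G b w)`. -/
def trajectory (η : ℝ) (J : H →ₗᵢ[ℝ] H) (G : B → H → H) (w : H) : (K : ℕ) → (Fin K → B) → H
  | 0, _ => w
  | K + 1, ξ => trajectory η J G w K (fun j => ξ j.castSucc) -
      η • J (G (ξ (Fin.last K)) (trajectory η J G w K fun j => ξ j.castSucc))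

/-- The accumulated gradient noise along the local steps. -/
def noiseSum (η : ℝ) (J : H →ₗᵢ[ℝ] H) (G : B → H → H) (g : H → H) (w : H) :
    (K : ℕ) → (Fin K → B) → H
  | 0, _ => 0
  | K + 1, ξ => noiseSum η J G g w K (fun j => ξ j.castSucc) +
      (G (ξ (Fin.last K)) (trajectory η J G w K fun j => ξ j.castSucc) -
        g (trajectory η J G w K fun j => ξ j.castSucc))

/-- The accumulated difference of the mean gradients to the one at the starting point. -/
def driftSum (η : ℝ) (J : H →ₗᵢ[ℝ] H) (G : B → H → H) (g : H → H) (w : H) :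
    (K : ℕ) → (Fin K → B) → H
  | 0, _ => 0
  | K + 1, ξ => driftSum η J G g w K (fun j => ξ j.castSucc) +
      (g (trajectory η J G w K fun j => ξ j.castSucc) - g w)

variable {η : ℝ} {J : H →ₗᵢ[ℝ] H} {G : B → H → H} {g : H → H} {ν : Measure B} {Λ σ : ℝ}

omit [CompleteSpace H] [MeasurableSpace B] [MeasurableSpace H] [BorelSpace H]
  [SecondCountableTopology H] in
theorem trajectory_eq_foldl (w : H) (K : ℕ) (ξ : Fin K → B) :
    trajectory η J G w K ξ = Fin.foldl K (fun v k => v - η • J (G (ξ k) v)) w := by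
  induction K with
  | zero => simp [trajectory]
  | succ K ih => rw [Fin.foldl_succ_last, trajectory, ih]

omit [CompleteSpace H] [MeasurableSpace B] [MeasurableSpace H] [BorelSpace H]
  [SecondCountableTopology H] in
-- An exact identity. Since `J` is linear and the same at every step, the increments add up inside
-- it.
theorem trajectory_eq (w : H) (K : ℕ) (ξ : Fin K → B) :
    trajectory η J G w K ξ = w - η • J ((K : ℝ) • g w + noiseSum η J G g w K ξ +
      driftSum η J G g w K ξ) := by
  induction K with
  | zero => simp [trajectory, noiseSum, driftSum]
  | succ K ih =>
    rw [trajectory, noiseSum, driftSum]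
    set v := trajectory η J G w K fun j => ξ j.castSucc with hv
    rw [show v - η • J (G (ξ (Fin.last K)) v) = (w - η • J ((K : ℝ) • g w +
      noiseSum η J G g w K (fun j => ξ j.castSucc) + driftSum η J G g w K fun j => ξ j.castSucc))
      - η • J (G (ξ (Fin.last K)) v) by rw [← ih], sub_sub, ← smul_add, ← map_add]
    congr 3
    push_cast
    module

namespace GradientOracle

variable (h : GradientOracle G g ν Λ σ)
include h

omit [CompleteSpace H] [SecondCountableTopology H] in
theorem measurable_mean : Measurable g := (continuous_of_norm_sub_le h.lipschitz).measurable

omit [CompleteSpace H] in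
theorem measurable_trajectory (K : ℕ) :
    Measurable fun q : H × (Fin K → B) => trajectory η J G q.1 K q.2 := by
  induction K with
  | zero => exact measurable_fst
  | succ K ih =>
    have h1 : Measurable fun q : H × (Fin (K + 1) → B) =>
        trajectory η J G q.1 K fun j => q.2 j.castSucc := by
      refine ih.comp (measurable_fst.prodMk (measurable_pi_lambda _ fun j => ?_))
      exact (measurable_pi_apply _).comp measurable_snd
    have h2 : Measurable fun q : H × (Fin (K + 1) → B) => q.2 (Fin.last K) :=
      (measurable_pi_apply _).comp measurable_snd
    have h3 := h.measurable.comp (h2.prodMk h1)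
    exact h1.sub ((J.continuous.measurable.comp h3).const_smul η)

variable [IsProbabilityMeasure ν]

/-- A step is a deterministic update plus centred noise. The update stretches `‖v - w‖` by at most
5/4, so the second moment grows at most fourfold, up to an additive term. This bound is crude, but
`η` is chosen after `K`. -/
theorem trajectory_moments (hη : 0 ≤ η) (hηΛ : η * Λ ≤ 1 / 4) (w : H) (K : ℕ) :
    MemLp (fun ξ => trajectory η J G w K ξ - w) 2 (Measure.pi fun _ : Fin K => ν) ∧
    ∫ ξ, ‖trajectory η J G w K ξ - w‖ ^ 2 ∂(Measure.pi fun _ : Fin K => ν) ≤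
      (4 ^ K - 1) * (η ^ 2 * (2 * ‖g w‖ ^ 2 + σ ^ 2)) := by
  induction K with
  | zero => simp [trajectory]
  | succ K ih =>
    obtain ⟨h1, h2⟩ := ih
    have hp := measurePreserving_init_last (fun _ : Fin (K + 1) => ν)
    set μ := Measure.pi fun _ : Fin K => ν with hμ
    have hT : Measurable fun ξ : Fin K → B => trajectory η J G w K ξ :=
      (h.measurable_trajectory K).comp (measurable_const.prodMk measurable_id)
    let X : (Fin K → B) → H := fun ξ => trajectory η J G w K ξ - w -
      η • J (g (trajectory η J G w K ξ))
    have hXle : ∀ ξ, ‖X ξ‖ ^ 2 ≤ 4 * ‖trajectory η J G w K ξ - w‖ ^ 2 + 2 * (η ^ 2 * ‖g w‖ ^ 2) := by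
      intro ξ
      set v := trajectory η J G w K ξ
      have a1 : ‖X ξ‖ ≤ ‖v - w‖ + η * ‖g v‖ := by
        refine (norm_sub_le _ _).trans ?_
        rw [norm_smul, LinearIsometry.norm_map, Real.norm_of_nonneg hη]
      have a2 : ‖g v‖ ≤ ‖g w‖ + Λ * ‖v - w‖ := by
        have := norm_le_norm_add_norm_sub' (g v) (g w)
        linarith [h.lipschitz v w]
      have a3 : ‖X ξ‖ ≤ 5 / 4 * ‖v - w‖ + η * ‖g w‖ := by
        have := mul_le_mul_of_nonneg_left a2 hη
        have := mul_le_mul_of_nonneg_right hηΛ (norm_nonneg (v - w))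
        linarith
      have a4 : ‖X ξ‖ ^ 2 ≤ (5 / 4 * ‖v - w‖ + η * ‖g w‖) ^ 2 := by gcongr
      nlinarith [sq_nonneg (5 / 4 * ‖v - w‖ - η * ‖g w‖), sq_nonneg ‖v - w‖]
    have hXm : AEStronglyMeasurable X μ :=
      ((hT.sub_const w).sub ((J.continuous.measurable.comp
        (h.measurable_mean.comp hT)).const_smul η)).aestronglyMeasurable
    have i1 := (h1.integrable_norm_pow two_ne_zero).const_mul 4
    have i2 : Integrable (fun _ : Fin K → B => 2 * (η ^ 2 * ‖g w‖ ^ 2)) μ := integrable_const _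
    have hXsq : Integrable (fun ξ => ‖X ξ‖ ^ 2) μ := by
      refine (i1.add i2).mono' (hXm.norm.pow 2) (Filter.Eventually.of_forall fun ξ => ?_)
      rw [Real.norm_of_nonneg (by positivity)]
      exact hXle ξ
    have hX : MemLp X 2 μ := (memLp_two_iff_integrable_sq_norm hXm).2 hXsq
    have hX2 : ∫ ξ, ‖X ξ‖ ^ 2 ∂μ ≤ 4 * ((4 ^ K - 1) * (η ^ 2 * (2 * ‖g w‖ ^ 2 + σ ^ 2))) +
        2 * (η ^ 2 * ‖g w‖ ^ 2) := by
      refine (integral_mono hXsq (i1.add i2) hXle).trans ?_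
      rw [integral_add' i1 i2, integral_const_mul]
      simp only [integral_const, probReal_univ, one_smul]
      linarith
    let N : (Fin K → B) × B → H := fun z => -(η • J (G z.2 (trajectory η J G w K z.1) -
      g (trajectory η J G w K z.1)))
    have hTz : Measurable fun z : (Fin K → B) × B => trajectory η J G w K z.1 :=
      hT.comp measurable_fst
    have hN : AEStronglyMeasurable N (μ.prod ν) :=
      ((J.continuous.measurable.comp ((h.measurable.comp (measurable_snd.prodMk hTz)).sub
        (h.measurable_mean.comp hTz))).const_smul η).neg.aestronglyMeasurable
    obtain ⟨k1, -, k3⟩ := add_centred_noise (s := η ^ 2 * σ ^ 2) hX hN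
      (Filter.Eventually.of_forall fun ξ =>
        ((J.toContinuousLinearMap.comp_memLp'
          (h.memLp (trajectory η J G w K ξ))).const_smul η).neg)
      (Filter.Eventually.of_forall fun ξ => by
        simp only [N]
        rw [integral_neg, integral_smul]
        have := J.toContinuousLinearMap.integral_comp_comm
          ((h.memLp (trajectory η J G w K ξ)).integrable (by norm_num))
        simp only [LinearIsometry.coe_toContinuousLinearMap] at this
        rw [this, h.mean, map_zero, smul_zero, neg_zero])
      (Filter.Eventually.of_forall fun ξ => by
        simp only [N, norm_neg, norm_smul, LinearIsometry.norm_map, mul_pow, integral_const_mul,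
          Real.norm_of_nonneg hη]
        exact mul_le_mul_of_nonneg_left (h.variance _) (by positivity))
    have e : (fun ξ : Fin (K + 1) → B => trajectory η J G w (K + 1) ξ - w) =
        (fun z : (Fin K → B) × B => X z.1 + N z) ∘
          fun ξ => ((fun j => ξ j.castSucc : Fin K → B), ξ (Fin.last K)) := by
      ext1 ξ
      simp only [Function.comp, X, N, trajectory, map_sub]
      module
    refine ⟨?_, ?_⟩
    · rw [e]; exact k1.comp_measurePreserving hp
    · have h4 := hp.integral_norm_sq_comp k1.1
      have e' := fun ξ => congrFun e ξ
      simp only [Function.comp] at e'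
      simp only [e']
      rw [h4]
      refine k3.trans ?_
      rw [pow_succ (4 : ℝ) K]
      nlinarith

/-- The increments are martingale differences, so their variances add: the bound is linear in `K`
although the points of evaluation are dependent. This is where averaging over local steps gains. -/
theorem noiseSum_moments (w : H) (K : ℕ) :
    MemLp (noiseSum η J G g w K) 2 (Measure.pi fun _ : Fin K => ν) ∧
    ∫ ξ, noiseSum η J G g w K ξ ∂(Measure.pi fun _ : Fin K => ν) = 0 ∧
    ∫ ξ, ‖noiseSum η J G g w K ξ‖ ^ 2 ∂(Measure.pi fun _ : Fin K => ν) ≤ K * σ ^ 2 := by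
  induction K with
  | zero => simp [noiseSum]
  | succ K ih =>
    obtain ⟨h1, h2, h3⟩ := ih
    have hp := measurePreserving_init_last (fun _ : Fin (K + 1) => ν)
    set μ := Measure.pi fun _ : Fin K => ν with hμ
    have hT : Measurable fun ξ : Fin K → B => trajectory η J G w K ξ :=
      (h.measurable_trajectory K).comp (measurable_const.prodMk measurable_id)
    let N : (Fin K → B) × B → H := fun z => G z.2 (trajectory η J G w K z.1) -
      g (trajectory η J G w K z.1)
    have hTz : Measurable fun z : (Fin K → B) × B => trajectory η J G w K z.1 :=
      hT.comp measurable_fst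
    have hN : AEStronglyMeasurable N (μ.prod ν) :=
      ((h.measurable.comp (measurable_snd.prodMk hTz)).sub
        (h.measurable_mean.comp hTz)).aestronglyMeasurable
    obtain ⟨k1, k2, k3⟩ := add_centred_noise (s := σ ^ 2) h1 hN
      (Filter.Eventually.of_forall fun ξ => h.memLp (trajectory η J G w K ξ))
      (Filter.Eventually.of_forall fun ξ => h.mean (trajectory η J G w K ξ))
      (Filter.Eventually.of_forall fun ξ => h.variance (trajectory η J G w K ξ))
    have e : noiseSum η J G g w (K + 1) =
        (fun z : (Fin K → B) × B => noiseSum η J G g w K z.1 + N z) ∘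
          fun ξ => ((fun j => ξ j.castSucc : Fin K → B), ξ (Fin.last K)) := rfl
    refine ⟨?_, ?_, ?_⟩
    · rw [e]; exact k1.comp_measurePreserving hp
    · rw [e, ← h2, ← k2]
      exact hp.integral_comp_aesm k1.1
    · have h4 := hp.integral_norm_sq_comp k1.1
      have e' := fun ξ => congrFun e ξ
      simp only [Function.comp] at e'
      simp only [e']
      rw [h4]
      push_cast
      linarith

/-- No centring is available here. What matters is the factor `η²`, which makes the drift as small
as desired for fixed `K`. -/
theorem driftSum_moments (hη : 0 ≤ η) (hηΛ : η * Λ ≤ 1 / 4) (w : H) (K : ℕ) :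
    MemLp (driftSum η J G g w K) 2 (Measure.pi fun _ : Fin K => ν) ∧
    ∫ ξ, ‖driftSum η J G g w K ξ‖ ^ 2 ∂(Measure.pi fun _ : Fin K => ν) ≤
      4 ^ K * (Λ ^ 2 * (η ^ 2 * (2 * ‖g w‖ ^ 2 + σ ^ 2))) := by
  induction K with
  | zero => simp [driftSum]; positivity
  | succ K ih =>
    obtain ⟨h1, h2⟩ := ih
    obtain ⟨t1, t2⟩ := h.trajectory_moments hη hηΛ w K (J := J)
    have hp := measurePreserving_init_last (fun _ : Fin (K + 1) => ν)
    have hp1 : MeasurePreserving (fun ξ : Fin (K + 1) → B => (fun j => ξ j.castSucc : Fin K → B))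
        (Measure.pi fun _ => ν) (Measure.pi fun _ => ν) := measurePreserving_fst.comp hp
    set μ := Measure.pi fun _ : Fin K => ν with hμ
    have hT : Measurable fun ξ : Fin K → B => trajectory η J G w K ξ :=
      (h.measurable_trajectory K).comp (measurable_const.prodMk measurable_id)
    let Y : (Fin K → B) → H := fun ξ => driftSum η J G g w K ξ +
      (g (trajectory η J G w K ξ) - g w)
    have hYm : AEStronglyMeasurable Y μ :=
      h1.1.add ((h.measurable_mean.comp hT).sub_const _).aestronglyMeasurable
    have hYle : ∀ ξ, ‖Y ξ‖ ^ 2 ≤ 2 * ‖driftSum η J G g w K ξ‖ ^ 2 +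
        2 * Λ ^ 2 * ‖trajectory η J G w K ξ - w‖ ^ 2 := by
      intro ξ
      have a1 : ‖Y ξ‖ ≤ ‖driftSum η J G g w K ξ‖ + Λ * ‖trajectory η J G w K ξ - w‖ :=
        (norm_add_le _ _).trans (by gcongr; exact h.lipschitz _ _)
      have a4 : ‖Y ξ‖ ^ 2 ≤ (‖driftSum η J G g w K ξ‖ + Λ * ‖trajectory η J G w K ξ - w‖) ^ 2 := by
        gcongr
      nlinarith [sq_nonneg (‖driftSum η J G g w K ξ‖ - Λ * ‖trajectory η J G w K ξ - w‖)]
    have i1 := (h1.integrable_norm_pow two_ne_zero).const_mul 2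
    have i2 := (t1.integrable_norm_pow two_ne_zero).const_mul (2 * Λ ^ 2)
    have hYsq : Integrable (fun ξ => ‖Y ξ‖ ^ 2) μ := by
      refine (i1.add i2).mono' (hYm.norm.pow 2) (Filter.Eventually.of_forall fun ξ => ?_)
      rw [Real.norm_of_nonneg (by positivity)]
      exact hYle ξ
    have hY : MemLp Y 2 μ := (memLp_two_iff_integrable_sq_norm hYm).2 hYsq
    refine ⟨hY.comp_measurePreserving hp1, ?_⟩
    refine (hp1.integral_norm_sq_comp hY.1).le.trans ?_
    refine (integral_mono hYsq (i1.add i2) hYle).trans ?_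
    rw [integral_add' i1 i2, integral_const_mul, integral_const_mul, pow_succ (4 : ℝ) K]
    have t3 := mul_le_mul_of_nonneg_left t2 (by positivity : 0 ≤ 2 * Λ ^ 2)
    have t4 : 0 ≤ Λ ^ 2 * (η ^ 2 * (2 * ‖g w‖ ^ 2 + σ ^ 2)) := by positivity
    nlinarith

end GradientOracle

end Trajectory

/-! ### Sampling clients without replacement -/

section Sampling

variable {M m : ℕ}

/-- The transposition of `i` and `i'` fixes `A` and exchanges the two families. Empty `A` gives
equal inclusion frequencies of clients, a singleton those of pairs. -/
theorem card_powersetCard_filter_swap (i i' : Fin M) (A : Finset (Fin M))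
    (hi : i ∉ A) (hi' : i' ∉ A) :
    ((Finset.univ.powersetCard m).filter fun S => A ⊆ S ∧ i ∈ S).card =
      ((Finset.univ.powersetCard m).filter fun S => A ⊆ S ∧ i' ∈ S).card := by
  have key : ∀ S : Finset (Fin M), (S.map (Equiv.swap i i').toEmbedding).map
      (Equiv.swap i i').toEmbedding = S := fun S => by
    ext j; simp
  have hA : ∀ S : Finset (Fin M), A ⊆ S → A ⊆ S.map (Equiv.swap i i').toEmbedding := by
    intro S hS j hj
    have h1 : j ≠ i := fun h => hi (h ▸ hj)
    have h2 : j ≠ i' := fun h => hi' (h ▸ hj)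
    exact Finset.mem_map.2 ⟨j, hS hj, Equiv.swap_apply_of_ne_of_ne h1 h2⟩
  refine Finset.card_bij' (fun S _ => S.map (Equiv.swap i i').toEmbedding)
    (fun S _ => S.map (Equiv.swap i i').toEmbedding) ?_ ?_ (fun S _ => key S) (fun S _ => key S)
  · intro S hS
    simp only [Finset.mem_filter, Finset.mem_powersetCard_univ, Finset.card_map] at hS ⊢
    exact ⟨hS.1, hA S hS.2.1, Finset.mem_map.2 ⟨i, hS.2.2, by simp⟩⟩
  · intro S hS
    simp only [Finset.mem_filter, Finset.mem_powersetCard_univ, Finset.card_map] at hS ⊢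
    exact ⟨hS.1, hA S hS.2.1, Finset.mem_map.2 ⟨i', hS.2.2, by simp⟩⟩

theorem card_powersetCard_filter_mem (i : Fin M) :
    (M : ℝ) * ((Finset.univ.powersetCard m).filter fun S : Finset (Fin M) => i ∈ S).card =
      m * (Finset.univ.powersetCard m : Finset (Finset (Fin M))).card := by
  have h1 : ∀ i', ((Finset.univ.powersetCard m).filter fun S : Finset (Fin M) => i' ∈ S).card =
      ((Finset.univ.powersetCard m).filter fun S : Finset (Fin M) => i ∈ S).card := by
    intro i'
    simpa using card_powersetCard_filter_swap (m := m) i' i ∅ (by simp) (by simp)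
  have h2 : ∑ i', ((Finset.univ.powersetCard m).filter fun S : Finset (Fin M) => i' ∈ S).card =
      ∑ S ∈ (Finset.univ.powersetCard m : Finset (Finset (Fin M))), S.card := by
    simp only [Finset.card_filter]
    rw [Finset.sum_comm]
    refine Finset.sum_congr rfl fun S _ => ?_
    simp
  simp only [h1, Finset.sum_const, Finset.card_univ, Fintype.card_fin, smul_eq_mul] at h2
  rw [Finset.sum_congr rfl fun S hS => (Finset.mem_powersetCard.1 hS).2, Finset.sum_const,
    smul_eq_mul, mul_comm _ m] at h2
  exact_mod_cast h2

variable {H : Type*} [NormedAddCommGroup H] [InnerProductSpace ℝ H]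

theorem sum_powersetCard_sum_eq_zero (hM : 0 < M) {v : Fin M → H} (hv : ∑ i, v i = 0) :
    ∑ S ∈ (Finset.univ.powersetCard m : Finset (Finset (Fin M))), ∑ i ∈ S, v i = 0 := by
  have h1 : ∀ S ∈ (Finset.univ.powersetCard m : Finset (Finset (Fin M))), ∑ i ∈ S, v i =
      ∑ i, if i ∈ S then v i else 0 := fun S _ => by simp
  rw [Finset.sum_congr rfl h1, Finset.sum_comm]
  have h2 : ∀ i, (∑ S ∈ (Finset.univ.powersetCard m : Finset (Finset (Fin M))),
      if i ∈ S then v i else 0) =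
      ((m : ℝ) * (Finset.univ.powersetCard m : Finset (Finset (Fin M))).card / M) • v i := by
    intro i
    rw [← card_powersetCard_filter_mem i, mul_div_cancel_left₀ _ (by positivity),
      ← Finset.sum_filter, Finset.sum_const, Nat.cast_smul_eq_nsmul]
  rw [Finset.sum_congr rfl fun i _ => h2 i, ← Finset.smul_sum, hv, smul_zero]

/-- Sampling without replacement: the second moment of the sum of a sample of a centred
population. -/
theorem sum_powersetCard_norm_sq_le (hM : 0 < M) {v : Fin M → H} (hv : ∑ i, v i = 0) {s : ℝ}
    (hs : ∀ i, ‖v i‖ ^ 2 ≤ s) :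
    ∑ S ∈ (Finset.univ.powersetCard m : Finset (Finset (Fin M))), ‖∑ i ∈ S, v i‖ ^ 2 ≤
      (Finset.univ.powersetCard m : Finset (Finset (Fin M))).card * (m * s) := by
  set T := (Finset.univ.powersetCard m : Finset (Finset (Fin M))) with hT
  have h1 : ∀ S ∈ T, ‖∑ i ∈ S, v i‖ ^ 2 =
      ∑ i, ∑ j, if i ∈ S ∧ j ∈ S then inner ℝ (v i) (v j) else 0 := by
    intro S _
    rw [← real_inner_self_eq_norm_sq, sum_inner]
    simp only [inner_sum, ite_and, Finset.sum_ite_irrel, Finset.sum_const_zero]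
    simp
  rw [Finset.sum_congr rfl h1, Finset.sum_comm]
  have h2 : ∀ i, (∑ S ∈ T, ∑ j, if i ∈ S ∧ j ∈ S then inner ℝ (v i) (v j) else 0) ≤
      (T.filter fun S => i ∈ S).card * ‖v i‖ ^ 2 := by
    intro i
    rw [Finset.sum_comm]
    have h3 : ∀ j, (∑ S ∈ T, if i ∈ S ∧ j ∈ S then inner ℝ (v i) (v j) else 0) =
        (T.filter fun S => i ∈ S ∧ j ∈ S).card * inner ℝ (v i) (v j) := by
      intro j
      rw [← Finset.sum_filter, Finset.sum_const, nsmul_eq_mul]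
    rw [Finset.sum_congr rfl fun j _ => h3 j]
    -- All pairs containing `i` are equally frequent, and a centred population has `∑_{j ≠ i} ⟨v i,
    -- v j⟩ = -‖v i‖²`. So the off-diagonal part is nonpositive, and sampling without replacement
    -- does no worse than independent sampling.
    obtain ⟨b, hb0, hb⟩ : ∃ b : ℝ, 0 ≤ b ∧ ∀ j, j ≠ i →
        ((T.filter fun S => i ∈ S ∧ j ∈ S).card : ℝ) = b := by
      by_cases hex : ∃ j, j ≠ i
      · obtain ⟨j, hj⟩ := hex
        refine ⟨(T.filter fun S => i ∈ S ∧ j ∈ S).card, by positivity, fun j' hj' => ?_⟩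
        have := card_powersetCard_filter_swap (m := m) j' j {i} (by simpa using hj')
          (by simpa using hj)
        simp only [Finset.singleton_subset_iff] at this
        exact_mod_cast this
      · push Not at hex
        exact ⟨0, le_rfl, fun j hj => absurd (hex j) hj⟩
    have h4 : ∑ j ∈ Finset.univ.erase i, inner ℝ (v i) (v j) = -‖v i‖ ^ 2 := by
      have : ∑ j, inner ℝ (v i) (v j) = 0 := by rw [← inner_sum, hv, inner_zero_right]
      rw [← Finset.add_sum_erase _ _ (Finset.mem_univ i), real_inner_self_eq_norm_sq] at this
      linarith
    rw [← Finset.add_sum_erase _ _ (Finset.mem_univ i),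
      Finset.sum_congr rfl fun j hj => by rw [hb j (Finset.ne_of_mem_erase hj)],
      ← Finset.mul_sum, h4, real_inner_self_eq_norm_sq]
    simp only [and_self]
    nlinarith [mul_nonneg hb0 (sq_nonneg ‖v i‖)]
  refine (Finset.sum_le_sum fun i _ => h2 i).trans ?_
  have h5 : ∀ i, ((T.filter fun S => i ∈ S).card : ℝ) * ‖v i‖ ^ 2 ≤ m * T.card / M * s := by
    intro i
    rw [← card_powersetCard_filter_mem i, mul_div_cancel_left₀ _ (by positivity)]
    exact mul_le_mul_of_nonneg_left (hs i) (by positivity)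
  refine (Finset.sum_le_sum fun i _ => h5 i).trans ?_
  simp only [Finset.sum_const, Finset.card_univ, Fintype.card_fin, nsmul_eq_mul]
  have : (M : ℝ) ≠ 0 := by positivity
  apply le_of_eq
  field_simp

/-- The law of the set of participating clients. -/
noncomputable abbrev sampleLaw (M m : ℕ) : Measure (Finset (Fin M)) := uniformOn {S : Finset (Fin M) | S.card = m}

theorem isProbabilityMeasure_sampleLaw (hm : m ≤ M) : IsProbabilityMeasure (sampleLaw M m) := by
  refine isProbabilityMeasure_uniformOn (Set.toFinite _) ?_
  obtain ⟨S, -, hS⟩ := Finset.exists_subset_card_eq (s := (Finset.univ : Finset (Fin M)))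
    (n := m) (by simpa using hm)
  exact ⟨S, hS⟩

theorem ae_sampleLaw_card (M m : ℕ) : ∀ᵐ S ∂(sampleLaw M m), S.card = m :=
  ae_cond_mem (Set.toFinite _).measurableSet

theorem integral_sampleLaw [CompleteSpace H] (g : Finset (Fin M) → H) :
    ∫ S, g S ∂(sampleLaw M m) =
      ((Finset.univ.powersetCard m : Finset (Finset (Fin M))).card : ℝ)⁻¹ •
        ∑ S ∈ Finset.univ.powersetCard m, g S := by
  have hs : {S : Finset (Fin M) | S.card = m} =
      ((Finset.univ.powersetCard m : Finset (Finset (Fin M))) : Set (Finset (Fin M))) := by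
    ext S; simp
  rw [sampleLaw, uniformOn, ProbabilityTheory.cond, integral_smul_measure, hs, Measure.count_apply_finset]
  rw [setIntegral_finset _ Integrable.of_finite.integrableOn]
  simp [measureReal_def]

/-- The case `m = M` is separate because the general bound does not vanish there, whereas the full
sum of a centred population does. -/
theorem sample_moments [CompleteSpace H] (hm : 1 ≤ m) (hmM : m ≤ M) {v : Fin M → H}
    (hv : ∑ i, v i = 0) {s : ℝ} (hs : ∀ i, ‖v i‖ ^ 2 ≤ s) :
    ∫ S, (1 / (m : ℝ)) • ∑ i ∈ S, v i ∂(sampleLaw M m) = 0 ∧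
    ∫ S, ‖(1 / (m : ℝ)) • ∑ i ∈ S, v i‖ ^ 2 ∂(sampleLaw M m) ≤ if m = M then 0 else s / m := by
  have hM : 0 < M := by omega
  have hm0 : (m : ℝ) ≠ 0 := by positivity
  refine ⟨?_, ?_⟩
  · rw [integral_smul, integral_sampleLaw, sum_powersetCard_sum_eq_zero hM hv, smul_zero,
      smul_zero]
  · split_ifs with h
    · apply le_of_eq
      refine integral_eq_zero_of_ae ?_
      filter_upwards [ae_sampleLaw_card M m] with S hS
      have : S = Finset.univ := by rw [← Finset.card_eq_iff_eq_univ, hS, h]; simp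
      simp [this, hv]
    · rw [integral_sampleLaw]
      have hc : 0 < ((Finset.univ.powersetCard m : Finset (Finset (Fin M))).card : ℝ) := by
        rw [Finset.card_powersetCard]; simpa using Nat.choose_pos hmM
      rw [smul_eq_mul, inv_mul_le_iff₀ hc]
      simp only [norm_smul, mul_pow, ← Finset.mul_sum]
      have := mul_le_mul_of_nonneg_left (sum_powersetCard_norm_sq_le (m := m) hM hv hs)
        (by positivity : 0 ≤ ‖1 / (m : ℝ)‖ ^ 2)
      refine this.trans (le_of_eq ?_)
      simp
      field_simp

end Sampling

/-! ### Independent sums over a random set of clients -/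

section SampledSum

variable {D H : Type*} [MeasurableSpace D] [NormedAddCommGroup H] [InnerProductSpace ℝ H]
  {M m : ℕ} {μ : Fin M → Measure D} [∀ i, IsProbabilityMeasure (μ i)] {a : Fin M → D → H}

theorem sum_mem_eq_sum_smul (S : Finset (Fin M)) (b : Fin M → H) :
    ∑ i ∈ S, b i = ∑ i, (if i ∈ S then (1 : ℝ) else 0) • b i := by
  simp [ite_smul]

theorem aestronglyMeasurable_sampled_sum {ρ : Measure (Finset (Fin M))} [IsProbabilityMeasure ρ]
    (ha : ∀ i, AEStronglyMeasurable (a i) (μ i)) :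
    AEStronglyMeasurable (fun r : Finset (Fin M) × (Fin M → D) => ∑ i ∈ r.1, a i (r.2 i))
      (ρ.prod (Measure.pi μ)) := by
  rw [funext fun r : Finset (Fin M) × (Fin M → D) => sum_mem_eq_sum_smul r.1 fun i => a i (r.2 i)]
  refine Finset.aestronglyMeasurable_fun_sum _ fun i _ => ?_
  have hev : MeasurePreserving (fun r : Finset (Fin M) × (Fin M → D) => r.2 i)
      (ρ.prod (Measure.pi μ)) (μ i) := (measurePreserving_eval μ i).comp measurePreserving_snd
  refine AEStronglyMeasurable.smul ?_ ((ha i).comp_measurePreserving hev)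
  have : Measurable fun S : Finset (Fin M) => if i ∈ S then (1 : ℝ) else 0 :=
    measurable_of_countable _
  exact (this.comp measurable_fst).aestronglyMeasurable

omit [InnerProductSpace ℝ H] in
theorem memLp_sum_eval (ha : ∀ i, MemLp (a i) 2 (μ i)) (S : Finset (Fin M)) :
    MemLp (fun ξ : Fin M → D => ∑ i ∈ S, a i (ξ i)) 2 (Measure.pi μ) :=
  memLp_finsetSum _ fun i _ => (ha i).comp_measurePreserving (measurePreserving_eval μ i)

theorem sum_eval_centred_moments [CompleteSpace H] (ha : ∀ i, MemLp (a i) 2 (μ i))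
    (h0 : ∀ i, ∫ ξ, a i ξ ∂(μ i) = 0) {s : ℝ} (hs : ∀ i, ∫ ξ, ‖a i ξ‖ ^ 2 ∂(μ i) ≤ s)
    (S : Finset (Fin M)) :
    ∫ ξ, ∑ i ∈ S, a i (ξ i) ∂(Measure.pi μ) = 0 ∧
    ∫ ξ, ‖∑ i ∈ S, a i (ξ i)‖ ^ 2 ∂(Measure.pi μ) ≤ S.card * s := by
  have := sum_independent_centred μ (Y := fun i ξ => (if i ∈ S then (1 : ℝ) else 0) • a i ξ)
    (s := fun i => if i ∈ S then s else 0)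
    (fun i => (ha i).const_smul _) (fun i => by rw [integral_smul, h0, smul_zero])
    (fun i => by
      split_ifs
      · simpa using hs i
      · simp)
  simp only [← sum_mem_eq_sum_smul] at this
  refine ⟨this.2.1, this.2.2.trans (le_of_eq ?_)⟩
  simp

omit [InnerProductSpace ℝ H] in
-- For the drift, which is not centred: Cauchy-Schwarz costs a further factor `S.card`, which the
-- average over the sample removes.
theorem sum_eval_second_moment (ha : ∀ i, MemLp (a i) 2 (μ i)) {s : ℝ}
    (hs : ∀ i, ∫ ξ, ‖a i ξ‖ ^ 2 ∂(μ i) ≤ s) (S : Finset (Fin M)) :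
    ∫ ξ, ‖∑ i ∈ S, a i (ξ i)‖ ^ 2 ∂(Measure.pi μ) ≤ S.card * (S.card * s) := by
  have hi : ∀ i, Integrable (fun ξ : Fin M → D => ‖a i (ξ i)‖ ^ 2) (Measure.pi μ) :=
    fun i => ((ha i).comp_measurePreserving
      (measurePreserving_eval μ i)).integrable_norm_pow two_ne_zero
  have hb : ∀ ξ : Fin M → D, ‖∑ i ∈ S, a i (ξ i)‖ ^ 2 ≤ S.card * ∑ i ∈ S, ‖a i (ξ i)‖ ^ 2 := by
    intro ξ
    refine le_trans ?_ sq_sum_le_card_mul_sum_sq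
    gcongr
    exact norm_sum_le _ _
  have hI := (integrable_finsetSum S fun i _ => hi i).const_mul (S.card : ℝ)
  refine (integral_mono_of_nonneg (Filter.Eventually.of_forall fun ξ => by positivity) hI
    (Filter.Eventually.of_forall hb)).trans ?_
  rw [integral_const_mul, integral_finsetSum S fun i _ => hi i]
  gcongr
  rw [← nsmul_eq_mul]
  refine Finset.sum_le_card_nsmul _ _ _ fun i _ => ?_
  exact ((measurePreserving_eval μ i).integral_norm_sq_comp (ha i).1).le.trans (hs i)

end SampledSum

/-! ### Noise and drift of a communication round -/

section RoundMoments

variable {B H : Type*} [MeasurableSpace B] [NormedAddCommGroup H] [InnerProductSpace ℝ H]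
  [CompleteSpace H] [MeasurableSpace H] [BorelSpace H] [SecondCountableTopology H]
  {M m K : ℕ} {G : Fin M → B → H → H} {g : Fin M → H → H} {ν : Fin M → Measure B}
  [∀ i, IsProbabilityMeasure (ν i)] {Λ σ σG η : ℝ} {J : H →ₗᵢ[ℝ] H} {gb : H → H}

/-- The server step of one round is a step along `J (gb w + N + R)`, with centred noise `N` and
drift `R`. -/
theorem exists_round_decomposition (hG : ∀ i, GradientOracle (G i) (g i) (ν i) Λ σ)
    (hm : 1 ≤ m) (hmM : m ≤ M) (hK : 1 ≤ K) (hη : 0 ≤ η) (hηΛ : η * Λ ≤ 1 / 4) (w : H)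
    (hgb : ∑ i, (g i w - gb w) = 0) (hhet : ∀ i, ‖g i w - gb w‖ ^ 2 ≤ σG ^ 2) :
    ∃ N R : Finset (Fin M) × (Fin M → Fin K → B) → H,
      (∀ r, r.1.card = m → (1 / (m : ℝ)) • ∑ i ∈ r.1, trajectory η J (G i) w K (r.2 i) =
        w - (η * K) • J (gb w + N r + R r)) ∧
      MemLp N 2 ((sampleLaw M m).prod (Measure.pi fun i => Measure.pi fun _ : Fin K => ν i)) ∧
      MemLp R 2 ((sampleLaw M m).prod (Measure.pi fun i => Measure.pi fun _ : Fin K => ν i)) ∧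
      ∫ r, N r ∂((sampleLaw M m).prod (Measure.pi fun i => Measure.pi fun _ : Fin K => ν i)) = 0 ∧
      ∫ r, ‖N r‖ ^ 2 ∂((sampleLaw M m).prod
        (Measure.pi fun i => Measure.pi fun _ : Fin K => ν i)) ≤
        (if m = M then 0 else σG ^ 2 / m) + σ ^ 2 / (m * K) ∧
      ∫ r, ‖R r‖ ^ 2 ∂((sampleLaw M m).prod
        (Measure.pi fun i => Measure.pi fun _ : Fin K => ν i)) ≤
        4 ^ K * (Λ ^ 2 * (η ^ 2 * (4 * ‖gb w‖ ^ 2 + 4 * σG ^ 2 + σ ^ 2))) := by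
  have := isProbabilityMeasure_sampleLaw hmM
  set μ : Fin M → Measure (Fin K → B) := fun i => Measure.pi fun _ : Fin K => ν i with hμ
  have hm0 : (0 : ℝ) < m := by exact_mod_cast hm
  have hK0 : (0 : ℝ) < K := by exact_mod_cast hK
  set c : ℝ := 1 / (m * K) with hc
  have hcpos : 0 < c := by positivity
  let nz : Fin M → (Fin K → B) → H := fun i => noiseSum η J (G i) (g i) w K
  let dr : Fin M → (Fin K → B) → H := fun i => driftSum η J (G i) (g i) w K
  have hnz := fun i => (hG i).noiseSum_moments (η := η) (J := J) w K
  have hdr := fun i => (hG i).driftSum_moments hη hηΛ w K (J := J)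
  set Δ : ℝ := 4 ^ K * (Λ ^ 2 * (η ^ 2 * (4 * ‖gb w‖ ^ 2 + 4 * σG ^ 2 + σ ^ 2))) with hΔ
  have hΔ0 : 0 ≤ Δ := by positivity
  have hdrΔ : ∀ i, ∫ ξ, ‖dr i ξ‖ ^ 2 ∂(μ i) ≤ Δ := by
    intro i
    refine (hdr i).2.trans ?_
    rw [hΔ]
    have h1 : ‖g i w‖ ≤ ‖gb w‖ + ‖g i w - gb w‖ := norm_le_norm_add_norm_sub' _ _
    have h2 : ‖g i w‖ ^ 2 ≤ (‖gb w‖ + ‖g i w - gb w‖) ^ 2 := by gcongr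
    have h3 : 2 * ‖g i w‖ ^ 2 ≤ 4 * ‖gb w‖ ^ 2 + 4 * σG ^ 2 := by
      nlinarith [hhet i, sq_nonneg (‖gb w‖ - ‖g i w - gb w‖)]
    gcongr
  let n : Finset (Fin M) × (Fin M → Fin K → B) → H := fun r => c • ∑ i ∈ r.1, nz i (r.2 i)
  let R : Finset (Fin M) × (Fin M → Fin K → B) → H := fun r => c • ∑ i ∈ r.1, dr i (r.2 i)
  let X : Finset (Fin M) → H := fun S => (1 / (m : ℝ)) • ∑ i ∈ S, (g i w - gb w)
  obtain ⟨x1, x2⟩ := sample_moments hm hmM hgb hhet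
  have hns := sum_eval_centred_moments (fun i => (hnz i).1) (fun i => (hnz i).2.1)
    (fun i => (hnz i).2.2)
  have hds := sum_eval_second_moment (fun i => (hdr i).1) hdrΔ
  have hX : MemLp X 2 (sampleLaw M m) := by
    have hXm : AEStronglyMeasurable X (sampleLaw M m) :=
      (measurable_of_countable X).aestronglyMeasurable
    exact (memLp_two_iff_integrable_sq_norm hXm).2 Integrable.of_finite
  have hnm : AEStronglyMeasurable n ((sampleLaw M m).prod (Measure.pi μ)) :=
    (aestronglyMeasurable_sampled_sum fun i => (hnz i).1.1).const_smul c
  have hRm : AEStronglyMeasurable R ((sampleLaw M m).prod (Measure.pi μ)) :=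
    (aestronglyMeasurable_sampled_sum fun i => (hdr i).1.1).const_smul c
  have hn2 : ∀ᵐ S ∂(sampleLaw M m), ∫ ξ, ‖n (S, ξ)‖ ^ 2 ∂(Measure.pi μ) ≤
      σ ^ 2 / (m * K) := by
    filter_upwards [ae_sampleLaw_card M m] with S hS
    simp only [n, norm_smul, mul_pow, integral_const_mul, Real.norm_of_nonneg hcpos.le]
    refine (mul_le_mul_of_nonneg_left (hns S).2 (by positivity)).trans (le_of_eq ?_)
    rw [hS, hc]
    field_simp
  have hR2 : ∀ᵐ S ∂(sampleLaw M m), ∫ ξ, ‖R (S, ξ)‖ ^ 2 ∂(Measure.pi μ) ≤ Δ := by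
    filter_upwards [ae_sampleLaw_card M m] with S hS
    simp only [R, norm_smul, mul_pow, integral_const_mul, Real.norm_of_nonneg hcpos.le]
    refine (mul_le_mul_of_nonneg_left (hds S) (by positivity)).trans ?_
    have e : c ^ 2 * (S.card * (S.card * Δ)) = Δ / K ^ 2 := by rw [hc, hS]; field_simp
    rw [e]
    refine div_le_self hΔ0 ?_
    have : (1 : ℝ) ≤ K := by exact_mod_cast hK
    nlinarith
  -- Given the client set, the gradient noise is centred. Its second moment therefore adds to that
  -- of the sampling error `X`.
  obtain ⟨k1, k2, k3⟩ := add_centred_noise (X := X) (n := n) hX hnm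
    (Filter.Eventually.of_forall fun S => (memLp_sum_eval (fun i => (hnz i).1) S).const_smul c)
    (Filter.Eventually.of_forall fun S => by
      simp only [n]; rw [integral_smul, (hns S).1, smul_zero]) hn2
  obtain ⟨r1, r2⟩ := memLp_two_prod (n := R) (s := Δ) hRm
    (Filter.Eventually.of_forall fun S => (memLp_sum_eval (fun i => (hdr i).1) S).const_smul c)
    hR2
  refine ⟨fun r => X r.1 + n r, R, ?_, k1, r1, k2.trans x1, k3.trans ?_, r2⟩
  · rintro ⟨S, ξ⟩ hS
    simp only at hS
    have e1 : ∑ i ∈ S, trajectory η J (G i) w K (ξ i) = (m : ℝ) • w - η • J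
        (∑ i ∈ S, ((K : ℝ) • g i w + nz i (ξ i) + dr i (ξ i))) := by
      rw [Finset.sum_congr rfl fun i _ => trajectory_eq w K (ξ i) (g := g i),
        Finset.sum_sub_distrib, Finset.sum_const, hS, ← Finset.smul_sum, map_sum,
        Nat.cast_smul_eq_nsmul]
    have e2 : ∑ i ∈ S, ((K : ℝ) • g i w + nz i (ξ i) + dr i (ξ i)) =
        ((m : ℝ) * K) • (gb w + (X S + n (S, ξ)) + R (S, ξ)) := by
      simp only [X, n, R, smul_add, smul_smul, Finset.sum_add_distrib,
        Finset.sum_sub_distrib, Finset.sum_const, hS, smul_sub, hc]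
      rw [mul_one_div_cancel (by positivity), one_smul, one_smul, ← Finset.smul_sum,
        show (m : ℝ) * K * (1 / m) = K by field_simp, ← Nat.cast_smul_eq_nsmul ℝ m, smul_smul,
        mul_comm (K : ℝ) m]
      abel
    rw [e1, e2, map_smul, smul_sub, smul_smul, smul_smul, smul_smul]
    congr 1
    · rw [one_div_mul_cancel hm0.ne', one_smul]
    · congr 1
      field_simp
  · gcongr

end RoundMoments

/-! ### The chain of server states and the choice of a good time -/

section MarkovChain

variable {R H : Type*} [MeasurableSpace R] [MeasurableSpace H]

/-- The chain `w_{t+1} = step (ω t) w_t`. -/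
def chain (step : R → H → H) (w₀ : H) (ω : ℕ → R) : ℕ → H
  | 0 => w₀
  | t + 1 => step (ω t) (chain step w₀ ω t)

variable {step : R → H → H}

/-- Factoring the state through the earlier rounds is what turns independence of the coordinates
into independence of the state and the next round. -/
theorem exists_chain_eq (hstep : Measurable fun q : R × H => step q.1 q.2) (w₀ : H) (t : ℕ) :
    ∃ φ : (Finset.range t → R) → H, Measurable φ ∧
      ∀ ω : ℕ → R, chain step w₀ ω t = φ fun i => ω i := by
  induction t with
  | zero => exact ⟨fun _ => w₀, measurable_const, fun _ => rfl⟩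
  | succ t ih =>
    obtain ⟨φ, hφ, he⟩ := ih
    refine ⟨fun u => step (u ⟨t, Finset.self_mem_range_succ t⟩)
      (φ fun i => u ⟨i, Finset.range_subset_range.2 t.le_succ i.2⟩), ?_, fun ω => ?_⟩
    · have h1 : Measurable fun (u : Finset.range (t + 1) → R) (i : Finset.range t) =>
          u ⟨i, Finset.range_subset_range.2 t.le_succ i.2⟩ :=
        measurable_pi_lambda _ fun i => measurable_pi_apply _
      have h2 : Measurable fun u : Finset.range (t + 1) → R =>
          u ⟨t, Finset.self_mem_range_succ t⟩ := measurable_pi_apply _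
      exact hstep.comp (h2.prodMk (hφ.comp h1))
    · rw [chain, he]

theorem measurable_chain (hstep : Measurable fun q : R × H => step q.1 q.2) (w₀ : H) (t : ℕ) :
    Measurable fun ω : ℕ → R => chain step w₀ ω t := by
  obtain ⟨φ, hφ, he⟩ := exists_chain_eq hstep w₀ t
  simp only [he]
  exact hφ.comp (measurable_pi_lambda _ fun i => measurable_pi_apply _)

variable {ρ : Measure R} [IsProbabilityMeasure ρ]

/-- The state before round `t` is independent of the randomness of round `t`. -/
theorem measurePreserving_chain_prod (hstep : Measurable fun q : R × H => step q.1 q.2) (w₀ : H)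
    (t : ℕ) :
    MeasurePreserving (fun ω : ℕ → R => (chain step w₀ ω t, ω t))
      (Measure.infinitePi fun _ => ρ)
      (((Measure.infinitePi fun _ => ρ).map fun ω : ℕ → R => chain step w₀ ω t).prod ρ) := by
  obtain ⟨φ, hφ, he⟩ := exists_chain_eq hstep w₀ t
  have hind : iIndepFun (fun (i : ℕ) (ω : ℕ → R) => ω i) (Measure.infinitePi fun _ => ρ) :=
    iIndepFun_infinitePi (P := fun _ : ℕ => ρ) (X := fun _ r => r) fun _ => measurable_id
  have h1 := hind.indepFun_finset (Finset.range t) {t} (by simp) fun i => measurable_pi_apply i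
  have h2 := h1.comp hφ (measurable_pi_apply (⟨t, Finset.mem_singleton_self t⟩ : ({t} : Finset ℕ)))
  have hm := measurable_chain hstep w₀ t
  refine ⟨hm.prodMk (measurable_pi_apply t), ?_⟩
  have h3 : IndepFun (fun ω : ℕ → R => chain step w₀ ω t) (fun ω => ω t)
      (Measure.infinitePi fun _ => ρ) := by
    simp only [he]; exact h2
  rw [(indepFun_iff_map_prod_eq_prod_map_map hm.aemeasurable
    (measurable_pi_apply t).aemeasurable).1 h3, Measure.infinitePi_map_eval]

variable {V q : H → ℝ} {a c n : ℝ}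

theorem integrable_chain (hstep : Measurable fun q : R × H => step q.1 q.2) (hV : Measurable V)
    (hV0 : ∀ w, 0 ≤ V w) (hint : ∀ w, Integrable (fun r => V (step r w)) ρ)
    (hle : ∀ w, ∫ r, V (step r w) ∂ρ ≤ a * V w - c * q w + n) (hq : Measurable q)
    (hq0 : ∀ w, 0 ≤ q w) (hc : 0 < c) (w₀ : H) (t : ℕ) :
    Integrable (fun ω : ℕ → R => V (chain step w₀ ω t)) (Measure.infinitePi fun _ => ρ) ∧
    Integrable (fun ω : ℕ → R => q (chain step w₀ ω t)) (Measure.infinitePi fun _ => ρ) ∧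
    ∫ ω : ℕ → R, V (chain step w₀ ω (t + 1)) ∂(Measure.infinitePi fun _ => ρ) ≤
      a * ∫ ω : ℕ → R, V (chain step w₀ ω t) ∂(Measure.infinitePi fun _ => ρ) -
      c * ∫ ω : ℕ → R, q (chain step w₀ ω t) ∂(Measure.infinitePi fun _ => ρ) + n ∧
    Integrable (fun ω : ℕ → R => V (chain step w₀ ω (t + 1))) (Measure.infinitePi fun _ => ρ) := by
  have key : ∀ t, Integrable (fun ω : ℕ → R => V (chain step w₀ ω t))
      (Measure.infinitePi fun _ => ρ) →
      Integrable (fun ω : ℕ → R => q (chain step w₀ ω t)) (Measure.infinitePi fun _ => ρ) ∧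
      ∫ ω : ℕ → R, V (chain step w₀ ω (t + 1)) ∂(Measure.infinitePi fun _ => ρ) ≤
        a * ∫ ω : ℕ → R, V (chain step w₀ ω t) ∂(Measure.infinitePi fun _ => ρ) -
        c * ∫ ω : ℕ → R, q (chain step w₀ ω t) ∂(Measure.infinitePi fun _ => ρ) + n ∧
      Integrable (fun ω : ℕ → R => V (chain step w₀ ω (t + 1)))
        (Measure.infinitePi fun _ => ρ) := by
    intro t ht
    set Pr : Measure (ℕ → R) := Measure.infinitePi fun _ => ρ with hPr
    have hm := measurable_chain hstep w₀ t
    have hp := measurePreserving_chain_prod (ρ := ρ) hstep w₀ t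
    rw [← hPr] at hp
    set L := Pr.map fun ω : ℕ → R => chain step w₀ ω t with hL
    have : IsProbabilityMeasure L := Measure.isProbabilityMeasure_map hm.aemeasurable
    have hpL : MeasurePreserving (fun ω : ℕ → R => chain step w₀ ω t) Pr L := ⟨hm, rfl⟩
    have hVL : Integrable V L := (hpL.integrable_comp hV.aestronglyMeasurable).1 ht
    -- Integrability of `q` needs no separate assumption: the left side of the contraction
    -- inequality is nonnegative.
    have hqle : ∀ w, q w ≤ c⁻¹ * (a * V w + n) := by
      intro w
      rw [le_inv_mul_iff₀ hc]
      have := hle w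
      have h0 : 0 ≤ ∫ r, V (step r w) ∂ρ := integral_nonneg fun r => hV0 _
      linarith
    have hqL : Integrable q L := by
      refine (((hVL.const_mul a).add (integrable_const n)).const_mul c⁻¹).mono'
        hq.aestronglyMeasurable (Filter.Eventually.of_forall fun w => ?_)
      rw [Real.norm_of_nonneg (hq0 w)]
      exact hqle w
    have hF : Measurable fun z : H × R => V (step z.2 z.1) :=
      hV.comp (hstep.comp measurable_swap)
    have hbound : Integrable (fun w => a * V w - c * q w + n) L :=
      ((hVL.const_mul a).sub (hqL.const_mul c)).add (integrable_const n)
    have hFi : Integrable (fun z : H × R => V (step z.2 z.1)) (L.prod ρ) := by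
      rw [integrable_prod_iff hF.aestronglyMeasurable]
      refine ⟨Filter.Eventually.of_forall hint, ?_⟩
      refine hbound.mono' hF.aestronglyMeasurable.norm.integral_prod_right'
        (Filter.Eventually.of_forall fun w => ?_)
      simp only [Real.norm_of_nonneg (hV0 _)]
      rw [Real.norm_of_nonneg (integral_nonneg fun r => hV0 _)]
      exact hle w
    refine ⟨(hpL.integrable_comp hq.aestronglyMeasurable).2 hqL, ?_,
      (hp.integrable_comp hF.aestronglyMeasurable).2 hFi⟩
    have e1 := hp.integral_comp_aesm hF.aestronglyMeasurable
    have e2 := hpL.integral_comp_aesm hV.aestronglyMeasurable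
    have e3 := hpL.integral_comp_aesm hq.aestronglyMeasurable
    simp only [chain]
    rw [e1, e2, e3, integral_prod _ hFi]
    refine (integral_mono hFi.integral_prod_left hbound hle).trans (le_of_eq ?_)
    rw [integral_add (by exact (hVL.const_mul a).sub (hqL.const_mul c)) (integrable_const n),
      integral_sub (hVL.const_mul a) (hqL.const_mul c), integral_const_mul, integral_const_mul]
    simp
  have hVt : ∀ t, Integrable (fun ω : ℕ → R => V (chain step w₀ ω t))
      (Measure.infinitePi fun _ => ρ) := by
    intro t
    induction t with
    | zero => exact integrable_const (V w₀)
    | succ t ih => exact (key t ih).2.2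
  exact ⟨hVt t, key t (hVt t)⟩

/-- If the expected Lyapunov function contracts with a gain proportional to `q`, then `q` is small
in expectation at one of the first `T + 1` times. -/
theorem exists_time_integral_le (hstep : Measurable fun q : R × H => step q.1 q.2)
    (hV : Measurable V) (hV0 : ∀ w, 0 ≤ V w) (hint : ∀ w, Integrable (fun r => V (step r w)) ρ)
    (hle : ∀ w, ∫ r, V (step r w) ∂ρ ≤ a * V w - c * q w + n) (hq : Measurable q)
    (hq0 : ∀ w, 0 ≤ q w) (hc : 0 < c) (ha0 : 0 ≤ a) (ha1 : a ≤ 1) (w₀ : H) {δ : ℝ}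
    (hn : n ≤ c * δ / 2) (T : ℕ) (hT : a ^ T * V w₀ < c * δ / 2) :
    ∃ t ≤ T, Integrable (fun ω : ℕ → R => q (chain step w₀ ω t)) (Measure.infinitePi fun _ => ρ) ∧
      ∫ ω : ℕ → R, q (chain step w₀ ω t) ∂(Measure.infinitePi fun _ => ρ) ≤ δ := by
  have H := integrable_chain hstep hV hV0 hint hle hq hq0 hc w₀
  -- If `q` exceeds `δ` in mean throughout, each step loses more than `c δ`, of which the noise
  -- restores at most half. The initial value has decayed below `c δ / 2` by then, so the mean of
  -- `V` at time `T + 1` would be negative.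
  by_contra! hcon
  have hd : 0 ≤ c * δ / 2 := by
    have : 0 ≤ a ^ T * V w₀ := mul_nonneg (pow_nonneg ha0 _) (hV0 _)
    linarith
  have hrec : ∀ t ≤ T, ∫ ω : ℕ → R, V (chain step w₀ ω (t + 1)) ∂(Measure.infinitePi fun _ => ρ) ≤
      a ^ (t + 1) * V w₀ - c * δ / 2 := by
    intro t
    induction t with
    | zero =>
      intro h0
      have h1 := (H 0).2.2.1
      have h2 := hcon 0 h0 (H 0).2.1
      have h3 : ∫ ω : ℕ → R, V (chain step w₀ ω 0) ∂(Measure.infinitePi fun _ => ρ) = V w₀ := by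
        simp [chain]
      rw [h3] at h1
      have h4 := mul_lt_mul_of_pos_left h2 hc
      simp only [zero_add, pow_one] at h1 ⊢
      linarith
    | succ t ih =>
      intro ht
      have h0 := ih (by omega)
      have h1 := (H (t + 1)).2.2.1
      have h2 := hcon (t + 1) ht (H (t + 1)).2.1
      have h4 := mul_lt_mul_of_pos_left h2 hc
      have h5 := mul_le_mul_of_nonneg_left h0 ha0
      have h6 : a ^ (t + 1 + 1) * V w₀ = a * (a ^ (t + 1) * V w₀) := by ring
      rw [h6]
      have h7 : 0 ≤ a * (c * δ / 2) := mul_nonneg ha0 hd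
      linarith
  have h1 := hrec T le_rfl
  have h2 : 0 ≤ ∫ ω : ℕ → R, V (chain step w₀ ω (T + 1)) ∂(Measure.infinitePi fun _ => ρ) :=
    integral_nonneg fun ω => hV0 _
  have h3 : a ^ (T + 1) * V w₀ ≤ a ^ T * V w₀ :=
    mul_le_mul_of_nonneg_right (pow_le_pow_of_le_one ha0 ha1 (Nat.le_succ T)) (hV0 _)
  linarith

end MarkovChain

/-! ### From the federated problem to the abstract hypotheses -/

section ProblemFacts

variable {M d₁ d₂ : ℕ} {Ξ : Type*} [MeasurableSpace Ξ] {P : Problem M d₁ d₂ Ξ}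
  {l σ σG μ₁ μ₂ : ℝ}

theorem continuous_of_differentiable {H : Type*} [NormedAddCommGroup H] [NormedSpace ℝ H]
    {f : H → ℝ} (hf : Differentiable ℝ f) : Continuous f := hf.continuous

theorem Pt.ext {d₁ d₂ : ℕ} {v w : Pt d₁ d₂} (h₁ : v.fst = w.fst) (h₂ : v.snd = w.snd) : v = w :=
  WithLp.ofLp_injective 2 (Prod.ext h₁ h₂)

theorem abs_taylor_le {H : Type*} [NormedAddCommGroup H] [InnerProductSpace ℝ H] [CompleteSpace H]
    {f : H → ℝ} {Λ : ℝ} (hf : Differentiable ℝ f) (hΛ : 0 ≤ Λ)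
    (hlip : ∀ v w, ‖∇ f v - ∇ f w‖ ≤ Λ * ‖v - w‖) (w d : H) :
    |f (w + d) - f w - inner ℝ (∇ f w) d| ≤ Λ * ‖d‖ ^ 2 := by
  -- The mean value inequality on a ball of radius `‖d‖` gives the constant `Λ`. The sharper `Λ / 2`
  -- is not needed.
  have h := Convex.norm_image_sub_le_of_norm_hasFDerivWithin_le' (f := f)
    (f' := fderiv ℝ f) (φ := fderiv ℝ f w) (s := Metric.closedBall w ‖d‖) (x := w) (y := w + d)
    (C := Λ * ‖d‖) (fun x _ => (hf x).hasFDerivAt.hasFDerivWithinAt) (fun x hx => by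
      rw [← toDual_gradient, ← toDual_gradient, ← map_sub, LinearIsometryEquiv.norm_map]
      refine (hlip x w).trans ?_
      rw [mem_closedBall_iff_norm] at hx
      gcongr) (convex_closedBall w ‖d‖) (by simp) (by simp)
  rw [add_sub_cancel_left, Real.norm_eq_abs, ← inner_gradient_left] at h
  refine h.trans (le_of_eq ?_)
  ring

namespace Problem.Assumptions

variable (h : P.Assumptions l σ σG μ₁ μ₂)
include h

theorem differentiable_obj : Differentiable ℝ P.obj := by
  unfold Problem.obj
  exact (Differentiable.fun_sum fun i _ => h.differentiable i).const_mul _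

theorem gradient_obj (w : Pt d₁ d₂) :
    ∇ P.obj w = (1 / (M : ℝ)) • ∑ i, ∇ (P.localObj i) w := by
  have : HasGradientAt P.obj ((1 / (M : ℝ)) • ∑ i, ∇ (P.localObj i) w) w := by
    rw [hasGradientAt_iff_hasFDerivAt, map_smul, map_sum]
    have h1 := HasFDerivAt.fun_sum (u := Finset.univ) fun i _ =>
      ((h.differentiable i w).hasGradientAt).hasFDerivAt
    exact h1.const_mul (1 / (M : ℝ))
  exact this.gradient

theorem sum_gradient_sub (hM : 0 < M) (w : Pt d₁ d₂) :
    ∑ i, (∇ (P.localObj i) w - ∇ P.obj w) = 0 := by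
  rw [Finset.sum_sub_distrib, h.gradient_obj, Finset.sum_const, Finset.card_univ,
    Fintype.card_fin, ← Nat.cast_smul_eq_nsmul ℝ, smul_smul, mul_one_div_cancel (by positivity),
    one_smul, sub_self]

theorem obj_smooth (hM : 0 < M) (w₁ w₂ : Pt d₁ d₂) :
    ‖∇ P.obj w₁ - ∇ P.obj w₂‖ ≤ l * (‖w₁.fst - w₂.fst‖ + ‖w₁.snd - w₂.snd‖) := by
  rw [h.gradient_obj, h.gradient_obj, ← smul_sub, ← Finset.sum_sub_distrib, norm_smul,
    Real.norm_of_nonneg (by positivity), one_div, inv_mul_le_iff₀ (by positivity)]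
  refine (norm_sum_le _ _).trans ?_
  refine (Finset.sum_le_sum fun i _ => h.smooth i w₁ w₂).trans (le_of_eq ?_)
  simp

omit h in
theorem _root_.FessGda.norm_fst_add_norm_snd_le (w₁ w₂ : Pt d₁ d₂) :
    ‖w₁.fst - w₂.fst‖ + ‖w₁.snd - w₂.snd‖ ≤ 2 * ‖w₁ - w₂‖ := by
  have h1 := WithLp.norm_fst_le (Vec d₁) (w₁ - w₂)
  have h2 := WithLp.norm_snd_le (Vec d₁) (w₁ - w₂)
  rw [WithLp.sub_fst] at h1
  rw [WithLp.sub_snd] at h2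
  linarith

theorem gradientOracle (hl : 0 ≤ l) (i : Fin M) :
    GradientOracle (P.stochGrad i) (∇ (P.localObj i)) (P.𝒟 i : Measure Ξ) (2 * l) σ where
  measurable := h.stochGrad_measurable i
  lipschitz := fun v w => by
    refine (h.smooth i v w).trans ?_
    rw [mul_comm 2 l, mul_assoc]
    exact mul_le_mul_of_nonneg_left (norm_fst_add_norm_snd_le v w) hl
  memLp := fun w => by
    have : AEStronglyMeasurable (fun ξ => P.stochGrad i ξ w - ∇ (P.localObj i) w)
        (P.𝒟 i : Measure Ξ) := (h.grad_integrable i w).1.sub aestronglyMeasurable_const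
    exact (memLp_two_iff_integrable_sq_norm this).2 (h.var_integrable i w)
  mean := fun w => by
    rw [integral_sub (h.grad_integrable i w) (integrable_const _), h.unbiased]
    simp
  variance := h.variance_le i

theorem minimaxPL (hM : 0 < M) (hl : 0 < l) (hμ₁ : 0 < μ₁) (hμ₁l : μ₁ ≤ l) (hμ₂ : 0 < μ₂)
    (hμ₂l : μ₂ ≤ l) :
    MinimaxPL (fun x y => P.obj (pt x y)) (fun x y => (∇ P.obj (pt x y)).fst)
      (fun x y => (∇ P.obj (pt x y)).snd) l μ₁ μ₂ where
  l_pos := hl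
  μ₁_pos := hμ₁
  μ₂_pos := hμ₂
  μ₁_le := hμ₁l
  μ₂_le := hμ₂l
  taylor := fun x y u v => by
    have h1 := abs_taylor_le h.differentiable_obj (by positivity : 0 ≤ 2 * l) (fun v w => by
      refine (h.obj_smooth hM v w).trans ?_
      rw [mul_comm 2 l, mul_assoc]
      exact mul_le_mul_of_nonneg_left (norm_fst_add_norm_snd_le v w) hl.le) (pt x y) (pt u v)
    rw [WithLp.prod_norm_sq_eq_of_L2, WithLp.prod_inner_apply] at h1
    refine le_trans (le_of_eq ?_) h1
    rw [sub_sub]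
    rfl
  lip_x := fun x y y' => by
    have h1 := h.obj_smooth hM (pt x y) (pt x y')
    have h2 := WithLp.norm_fst_le (Vec d₁) (∇ P.obj (pt x y) - ∇ P.obj (pt x y'))
    simpa using h2.trans h1
  lip_y := fun x x' y => by
    have h1 := h.obj_smooth hM (pt x y) (pt x' y)
    have h2 := WithLp.norm_snd_le (Vec d₁) (∇ P.obj (pt x y) - ∇ P.obj (pt x' y))
    simpa using h2.trans h1
  pl_x := fun x x' y => by
    refine le_trans ?_ (h.pl.pl_x x y)
    obtain ⟨x₀, hx₀⟩ := h.pl.min_attained y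
    gcongr
    exact ciInf_le ⟨P.obj (pt x₀ y), by rintro _ ⟨x, rfl⟩; exact hx₀ x⟩ x'
  pl_y := fun x y y' => by
    refine le_trans ?_ (h.pl.pl_y x y)
    obtain ⟨y₀, hy₀⟩ := h.pl.max_attained x
    gcongr
    exact le_ciSup (f := fun y => P.obj (pt x y))
      ⟨P.obj (pt x y₀), by rintro _ ⟨y, rfl⟩; exact hy₀ y⟩ y'
  exists_min := h.pl.min_attained
  exists_max := h.pl.max_attained

theorem continuous_obj_pt : Continuous fun w : Vec d₁ × Vec d₂ => P.obj (pt w.1 w.2) :=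
  (continuous_of_differentiable h.differentiable_obj).comp (WithLp.prod_continuous_toLp 2 _ _)

end Problem.Assumptions

end ProblemFacts

/-! ### The server update as a map of `(x, y)` -/

section ServerStep

variable {M d₁ d₂ : ℕ} {Ξ : Type*} [MeasurableSpace Ξ] {P : Problem M d₁ d₂ Ξ}

/-- The round of FESS-GDA with `p = 0` as a map of the pair `(x, y)`. -/
noncomputable def serverStep (P : Problem M d₁ d₂ Ξ) (prm : Params) (m : ℕ) (r : Round M Ξ prm.K)
    (w : Pt d₁ d₂) : Pt d₁ d₂ :=
  pt (w.fst + prm.ηxg • ((1 / (m : ℝ)) • (∑ i ∈ r.1, (localModel P prm i (r.2 i) w).fst) - w.fst))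
    (w.snd + prm.ηyg • ((1 / (m : ℝ)) • (∑ i ∈ r.1, (localModel P prm i (r.2 i) w).snd) - w.snd))

theorem run_eq_chain {prm : Params} (hp : prm.p = 0) (m : ℕ) (s₀ : State d₁ d₂)
    (ω : ℕ → Round M Ξ prm.K) (t : ℕ) :
    pt (run P prm m s₀ ω t).x (run P prm m s₀ ω t).y =
      chain (serverStep P prm m) (pt s₀.x s₀.y) ω t := by
  induction t with
  | zero => rfl
  | succ t ih =>
    rw [chain, ← ih, run, roundStep, serverStep]
    simp [hp]

/-- The isometry `(x, y) ↦ (x, -y)`. -/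
noncomputable def reflect (d₁ d₂ : ℕ) : Pt d₁ d₂ →ₗᵢ[ℝ] Pt d₁ d₂ where
  toFun w := pt w.fst (-w.snd)
  map_add' v w := Pt.ext (by simp) (by simp [add_comm])
  map_smul' c w := Pt.ext (by simp) (by simp)
  norm_map' w := by
    have : ‖pt w.fst (-w.snd)‖ ^ 2 = ‖w‖ ^ 2 := by
      rw [WithLp.prod_norm_sq_eq_of_L2, WithLp.prod_norm_sq_eq_of_L2]; simp
    exact (pow_left_inj₀ (norm_nonneg _) (norm_nonneg _) two_ne_zero).1 this

theorem reflect_apply (w : Pt d₁ d₂) : reflect d₁ d₂ w = pt w.fst (-w.snd) := rfl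

/-- With equal local step sizes, descent-ascent is a single step along the reflected gradient. The
two time scales enter only through the global step sizes. -/
theorem localModel_eq_trajectory {prm : Params} (hη : prm.ηyl = prm.ηxl) (i : Fin M)
    (ξ : Fin prm.K → Ξ) (w : Pt d₁ d₂) :
    localModel P prm i ξ w = trajectory prm.ηxl (reflect d₁ d₂) (P.stochGrad i) w prm.K ξ := by
  rw [trajectory_eq_foldl, localModel]
  congr 1
  funext v k
  rw [localStep, hη, reflect_apply]
  exact Pt.ext (by simp) (by simp)

theorem fst_sum {ι : Type*} (s : Finset ι) (a : ι → Pt d₁ d₂) :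
    (∑ i ∈ s, a i).fst = ∑ i ∈ s, (a i).fst := map_sum (WithLp.fstₗ 2 ℝ (Vec d₁) (Vec d₂)) a s

theorem snd_sum {ι : Type*} (s : Finset ι) (a : ι → Pt d₁ d₂) :
    (∑ i ∈ s, a i).snd = ∑ i ∈ s, (a i).snd := map_sum (WithLp.sndₗ 2 ℝ (Vec d₁) (Vec d₂)) a s

/-- If the average of the local models is `w - c (Hx, -Hy)`, the server moves along `H`. -/
theorem serverStep_eq {prm : Params} (hη : prm.ηyl = prm.ηxl) {m : ℕ} {r : Round M Ξ prm.K}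
    {w v : Pt d₁ d₂} {c : ℝ}
    (h : (1 / (m : ℝ)) • ∑ i ∈ r.1, trajectory prm.ηxl (reflect d₁ d₂) (P.stochGrad i) w prm.K
      (r.2 i) = w - c • reflect d₁ d₂ v) :
    serverStep P prm m r w = pt (w.fst - (prm.ηxg * c) • v.fst) (w.snd + (prm.ηyg * c) • v.snd) := by
  have h1 := congrArg WithLp.fst h
  have h2 := congrArg WithLp.snd h
  rw [WithLp.smul_fst, fst_sum] at h1
  rw [WithLp.smul_snd, snd_sum] at h2
  unfold serverStep
  simp only [localModel_eq_trajectory hη]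
  rw [h1, h2, reflect_apply]
  simp only [WithLp.sub_fst, WithLp.sub_snd, WithLp.smul_fst, WithLp.smul_snd, pt,
    WithLp.toLp_fst, WithLp.toLp_snd]
  congr 2
  · module
  · module

theorem measurable_sum_mem {A H : Type*} [MeasurableSpace A] [NormedAddCommGroup H]
    [InnerProductSpace ℝ H] [MeasurableSpace H] [BorelSpace H] [SecondCountableTopology H]
    {S : A → Finset (Fin M)} (hS : Measurable S) {a : Fin M → A → H} (ha : ∀ i, Measurable (a i)) :
    Measurable fun z => ∑ i ∈ S z, a i z := by
  simp_rw [fun z => sum_mem_eq_sum_smul (S z) fun i => a i z]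
  refine Finset.measurable_fun_sum _ fun i _ => Measurable.smul ?_ (ha i)
  exact (measurable_of_countable fun T : Finset (Fin M) => if i ∈ T then (1 : ℝ) else 0).comp hS

theorem measurable_serverStep {l σ σG μ₁ μ₂ : ℝ} (h : P.Assumptions l σ σG μ₁ μ₂) (hl : 0 ≤ l)
    {prm : Params} (hη : prm.ηyl = prm.ηxl) (m : ℕ) :
    Measurable fun q : Round M Ξ prm.K × Pt d₁ d₂ => serverStep P prm m q.1 q.2 := by
  have hfst : Measurable (WithLp.fst : Pt d₁ d₂ → Vec d₁) := (WithLp.continuous_fst 2 _ _).measurable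
  have hsnd : Measurable (WithLp.snd : Pt d₁ d₂ → Vec d₂) := (WithLp.continuous_snd 2 _ _).measurable
  have hloc : ∀ i, Measurable fun q : Round M Ξ prm.K × Pt d₁ d₂ =>
      localModel P prm i (q.1.2 i) q.2 := by
    intro i
    simp only [localModel_eq_trajectory hη]
    have h1 : Measurable fun q : Round M Ξ prm.K × Pt d₁ d₂ => q.1.2 i :=
      (measurable_pi_apply i).comp (measurable_snd.comp measurable_fst)
    exact ((h.gradientOracle hl i).measurable_trajectory prm.K).comp (measurable_snd.prodMk h1)
  have hS : Measurable fun q : Round M Ξ prm.K × Pt d₁ d₂ => q.1.1 :=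
    measurable_fst.comp measurable_fst
  have hx := measurable_sum_mem hS fun i => hfst.comp (hloc i)
  have hy := measurable_sum_mem hS fun i => hsnd.comp (hloc i)
  have hwx : Measurable fun q : Round M Ξ prm.K × Pt d₁ d₂ => q.2.fst := hfst.comp measurable_snd
  have hwy : Measurable fun q : Round M Ξ prm.K × Pt d₁ d₂ => q.2.snd := hsnd.comp measurable_snd
  have h1 := hwx.add (((hx.const_smul (1 / (m : ℝ))).sub hwx).const_smul prm.ηxg)
  have h2 := hwy.add (((hy.const_smul (1 / (m : ℝ))).sub hwy).const_smul prm.ηyg)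
  exact (WithLp.prod_continuous_toLp 2 (Vec d₁) (Vec d₂)).measurable.comp (h1.prodMk h2)

end ServerStep

/-! ### Lyapunov functions for the rounds -/

section RoundContraction

variable {M d₁ d₂ : ℕ} {Ξ : Type*} [MeasurableSpace Ξ] {P : Problem M d₁ d₂ Ξ}
  {l σ σG μ₁ μ₂ : ℝ}

theorem mem_saddleSet_iff {f : Pt d₁ d₂ → ℝ} {x : Vec d₁} {y : Vec d₂} :
    pt x y ∈ saddleSet f ↔ (∀ y', f (pt x y') ≤ f (pt x y)) ∧ ∀ x', f (pt x y) ≤ f (pt x' y) :=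
  Iff.rfl

/-- Makes the Lyapunov function independent of the saddle point that defines its reference value. -/
theorem saddle_value_unique {f : Pt d₁ d₂ → ℝ} {v w : Pt d₁ d₂} (hv : v ∈ saddleSet f)
    (hw : w ∈ saddleSet f) : f v = f w :=
  le_antisymm ((hv.2 w.fst).trans (hw.1 v.snd)) ((hw.2 v.fst).trans (hv.1 w.snd))

theorem isSaddleValue_of_mem {f : Pt d₁ d₂ → ℝ} {w : Pt d₁ d₂} (hw : w ∈ saddleSet f) :
    IsSaddleValue (fun x y => f (pt x y)) (f w) :=
  ⟨w.fst, w.snd, rfl, hw.1, hw.2⟩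

theorem infDist_sq_le {f : Pt d₁ d₂ → ℝ} {w : Pt d₁ d₂} {x : Vec d₁} {y : Vec d₂}
    (h : pt x y ∈ saddleSet f) :
    Metric.infDist w (saddleSet f) ^ 2 ≤ ‖w.fst - x‖ ^ 2 + ‖w.snd - y‖ ^ 2 := by
  have h1 := Metric.infDist_le_dist_of_mem (x := w) h
  have h2 : Metric.infDist w (saddleSet f) ^ 2 ≤ dist w (pt x y) ^ 2 :=
    pow_le_pow_left₀ Metric.infDist_nonneg h1 2
  rwa [dist_eq_norm, WithLp.prod_norm_sq_eq_of_L2] at h2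

/-- The moments of the noise and the drift of one round, in components. -/
theorem exists_round_noise (h : P.Assumptions l σ σG μ₁ μ₂) (hl : 0 < l) {m : ℕ} (hm : 1 ≤ m)
    (hmM : m ≤ M) {prm : Params} (hη : prm.ηyl = prm.ηxl) (hη0 : 0 ≤ prm.ηxl)
    (hηl : 8 * l * prm.ηxl ≤ 1) (hK : 1 ≤ prm.K) {θ ν : ℝ}
    (hθ : 4 ^ prm.K * (16 * l ^ 2 * prm.ηxl ^ 2) ≤ θ)
    (hν : 4 ^ prm.K * (4 * l ^ 2 * prm.ηxl ^ 2 * (4 * σG ^ 2 + σ ^ 2)) ≤ ν) (w : Pt d₁ d₂) :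
    ∃ N R : Round M Ξ prm.K → Pt d₁ d₂,
      (∀ᵐ r ∂(roundLaw P m prm.K), serverStep P prm m r w =
        pt (w.fst - (prm.ηxg * (prm.ηxl * prm.K)) •
            ((∇ P.obj w).fst + (N r).fst + (R r).fst))
          (w.snd + (prm.ηyg * (prm.ηxl * prm.K)) •
            ((∇ P.obj w).snd + (N r).snd + (R r).snd))) ∧
      MemLp (fun r => (N r).fst) 2 (roundLaw P m prm.K) ∧
      MemLp (fun r => (R r).fst) 2 (roundLaw P m prm.K) ∧
      MemLp (fun r => (N r).snd) 2 (roundLaw P m prm.K) ∧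
      MemLp (fun r => (R r).snd) 2 (roundLaw P m prm.K) ∧
      ∫ r, (N r).fst ∂(roundLaw P m prm.K) = 0 ∧ ∫ r, (N r).snd ∂(roundLaw P m prm.K) = 0 ∧
      ∫ r, ‖(N r).fst‖ ^ 2 ∂(roundLaw P m prm.K) + ∫ r, ‖(N r).snd‖ ^ 2 ∂(roundLaw P m prm.K) ≤
        (if m = M then 0 else σG ^ 2 / m) + σ ^ 2 / (m * prm.K) ∧
      ∫ r, ‖(R r).fst‖ ^ 2 ∂(roundLaw P m prm.K) + ∫ r, ‖(R r).snd‖ ^ 2 ∂(roundLaw P m prm.K) ≤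
        θ * (‖(∇ P.obj w).fst‖ ^ 2 + ‖(∇ P.obj w).snd‖ ^ 2) + ν := by
  obtain ⟨N, R, h1, hN, hR, hN0, hN2, hR2⟩ := exists_round_decomposition
    (J := reflect d₁ d₂) (K := prm.K) (η := prm.ηxl) (gb := ∇ P.obj)
    (fun i => h.gradientOracle hl.le i) hm hmM hK hη0 (by linarith) w
    (h.sum_gradient_sub (by omega) w) (fun i => h.heterogeneity i w)
  change MemLp N 2 (roundLaw P m prm.K) at hN
  change MemLp R 2 (roundLaw P m prm.K) at hR
  change ∫ r, N r ∂(roundLaw P m prm.K) = 0 at hN0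
  change ∫ r, ‖N r‖ ^ 2 ∂(roundLaw P m prm.K) ≤ _ at hN2
  change ∫ r, ‖R r‖ ^ 2 ∂(roundLaw P m prm.K) ≤ _ at hR2
  have hprob := isProbabilityMeasure_roundLaw P prm.K hmM
  have hNi := hN.integrable (by norm_num)
  have hfst : ∀ {A : Round M Ξ prm.K → Pt d₁ d₂}, MemLp A 2 (roundLaw P m prm.K) →
      MemLp (fun r => (A r).fst) 2 (roundLaw P m prm.K) := fun hA =>
    (WithLp.fstL 2 ℝ (Vec d₁) (Vec d₂)).comp_memLp' hA
  have hsnd : ∀ {A : Round M Ξ prm.K → Pt d₁ d₂}, MemLp A 2 (roundLaw P m prm.K) →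
      MemLp (fun r => (A r).snd) 2 (roundLaw P m prm.K) := fun hA =>
    (WithLp.sndL 2 ℝ (Vec d₁) (Vec d₂)).comp_memLp' hA
  have hsum : ∀ {A : Round M Ξ prm.K → Pt d₁ d₂}, MemLp A 2 (roundLaw P m prm.K) →
      ∫ r, ‖(A r).fst‖ ^ 2 ∂(roundLaw P m prm.K) + ∫ r, ‖(A r).snd‖ ^ 2 ∂(roundLaw P m prm.K) =
        ∫ r, ‖A r‖ ^ 2 ∂(roundLaw P m prm.K) := by
    intro A hA
    rw [← integral_add ((hfst hA).integrable_norm_pow two_ne_zero)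
      ((hsnd hA).integrable_norm_pow two_ne_zero)]
    simp only [← WithLp.prod_norm_sq_eq_of_L2]
  refine ⟨N, R, ?_, hfst hN, hfst hR, hsnd hN, hsnd hR, ?_, ?_, (hsum hN).le.trans hN2, ?_⟩
  · have hcard : ∀ᵐ r ∂(roundLaw P m prm.K), r.1.card = m :=
      Measure.quasiMeasurePreserving_fst.ae (ae_sampleLaw_card M m)
    filter_upwards [hcard] with r hr
    exact serverStep_eq hη (h1 r hr)
  · have := (WithLp.fstL 2 ℝ (Vec d₁) (Vec d₂)).integral_comp_comm hNi
    rw [hN0, map_zero] at this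
    exact this
  · have := (WithLp.sndL 2 ℝ (Vec d₁) (Vec d₂)).integral_comp_comm hNi
    rw [hN0, map_zero] at this
    exact this
  · rw [hsum hR, ← WithLp.prod_norm_sq_eq_of_L2]
    refine hR2.trans ?_
    have h3 := mul_le_mul_of_nonneg_right hθ (sq_nonneg ‖∇ P.obj w‖)
    refine le_trans (le_of_eq ?_) (add_le_add h3 hν)
    ring

/-- The requirements on a Lyapunov function of the chain of server states. -/
structure IsLyapunov (P : Problem M d₁ d₂ Ξ) (prm : Params) (m : ℕ) (A a c n : ℝ)
    (V : Pt d₁ d₂ → ℝ) : Prop where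
  measurable : Measurable V
  nonneg : ∀ w, 0 ≤ V w
  le_of_saddle : ∀ w, ∀ s ∈ saddleSet P.obj, V w ≤ A * ‖w - s‖ ^ 2
  integrable : ∀ w, Integrable (fun r => V (serverStep P prm m r w)) (roundLaw P m prm.K)
  contract : ∀ w, ∫ r, V (serverStep P prm m r w) ∂(roundLaw P m prm.K) ≤
    a * V w - c * Metric.infDist w (saddleSet P.obj) ^ 2 + n

theorem isLyapunov_of_le (h : P.Assumptions l σ σG μ₁ μ₂) (hl : 0 < l) (hμ₁ : 0 < μ₁)
    (hμ : μ₁ ≤ μ₂) (hμ₂ : μ₂ ≤ l) {m : ℕ} (hm : 1 ≤ m) (hmM : m ≤ M) {prm : Params}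
    (hη : prm.ηyl = prm.ηxl) (hη0 : 0 ≤ prm.ηxl) (hηl : 8 * l * prm.ηxl ≤ 1) (hK : 1 ≤ prm.K)
    {γ ν : ℝ} (hγ : 0 < γ) (hγl : 48 * l * γ ≤ 1)
    (hθ : 4 ^ prm.K * (16 * l ^ 2 * prm.ηxl ^ 2) ≤ μ₂ ^ 2 / (768 * l ^ 2))
    (hν : 4 ^ prm.K * (4 * l ^ 2 * prm.ηxl ^ 2 * (4 * σG ^ 2 + σ ^ 2)) ≤ ν)
    (hx : prm.ηxg * (prm.ηxl * prm.K) = γ * μ₂ ^ 2 / (48 * l ^ 2))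
    (hy : prm.ηyg * (prm.ηxl * prm.K) = γ) :
    ∃ V, IsLyapunov P prm m (7 * (l ^ 2 / μ₂)) (1 - γ * μ₂ ^ 2 / (48 * l ^ 2) * μ₁ / 2)
      (γ * μ₂ ^ 2 / (48 * l ^ 2) * μ₁ ^ 2 / 64)
      (4 * l * γ ^ 2 * ((if m = M then 0 else σG ^ 2 / m) + σ ^ 2 / (m * prm.K)) + γ * ν) V := by
  have hμ₂p := hμ₁.trans_le hμ
  have hPL := h.minimaxPL (by omega) hl hμ₁ (hμ.trans hμ₂) hμ₂p hμ₂
  obtain ⟨s₀, hs₀⟩ := h.saddle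
  have hv := isSaddleValue_of_mem hs₀
  have hprob := isProbabilityMeasure_roundLaw P prm.K hmM
  set v := P.obj s₀ with hvdef
  set f : Vec d₁ → Vec d₂ → ℝ := fun x y => P.obj (pt x y) with hf
  have key : ∀ w : Pt d₁ d₂,
      Integrable (fun r => lyapunov f v (serverStep P prm m r w).fst (serverStep P prm m r w).snd)
        (roundLaw P m prm.K) ∧
      ∫ r, lyapunov f v (serverStep P prm m r w).fst (serverStep P prm m r w).snd
        ∂(roundLaw P m prm.K) ≤ (1 - γ * μ₂ ^ 2 / (48 * l ^ 2) * μ₁ / 2) *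
          lyapunov f v w.fst w.snd - γ * μ₂ ^ 2 / (48 * l ^ 2) * μ₁ ^ 2 / 64 *
          Metric.infDist w (saddleSet P.obj) ^ 2 +
        (4 * l * γ ^ 2 * ((if m = M then 0 else σG ^ 2 / m) + σ ^ 2 / (m * prm.K)) + γ * ν) := by
    intro w
    obtain ⟨N, R, hae, hNx, hRx, hNy, hRy, hNx0, hNy0, hN2, hR2⟩ :=
      exists_round_noise h hl hm hmM hη hη0 hηl hK hθ hν w
    obtain ⟨k1, k2⟩ := hPL.integral_lyapunov_step_le hv hμ h.continuous_obj_pt hγ hγl w.fst w.snd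
      hNx hRx hNy hRy hNx0 hNy0 hN2 hR2
    obtain ⟨x', y', e1, e2, e3, e4⟩ := hPL.exists_saddle_near hv w.fst w.snd
    have hmem : pt x' y' ∈ saddleSet P.obj :=
      mem_saddleSet_iff.2 ⟨fun y => (e2 y).trans e1.ge, fun x => e1.le.trans (e3 x)⟩
    have hq := mul_le_mul_of_nonneg_left ((infDist_sq_le (w := w) hmem).trans e4)
      (by positivity : 0 ≤ γ * μ₂ ^ 2 / (48 * l ^ 2) * μ₁ ^ 2 / 64)
    rw [hx, hy] at hae
    have hcongr : (fun r => lyapunov f v (serverStep P prm m r w).fst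
        (serverStep P prm m r w).snd) =ᵐ[roundLaw P m prm.K] fun r => lyapunov f v
          (w.fst - (γ * μ₂ ^ 2 / (48 * l ^ 2)) • ((∇ P.obj w).fst + (N r).fst + (R r).fst))
          (w.snd + γ • ((∇ P.obj w).snd + (N r).snd + (R r).snd)) := by
      filter_upwards [hae] with r hr
      rw [hr]
      rfl
    refine ⟨k1.congr hcongr.symm, ?_⟩
    rw [integral_congr_ae hcongr]
    refine k2.trans ?_
    linarith
  refine ⟨fun w => lyapunov f v w.fst w.snd, ?_, fun w => hPL.lyapunov_nonneg hv _ _,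
    fun w s hs => ?_, fun w => (key w).1, fun w => (key w).2⟩
  · exact ((hPL.continuous_lyapunov (v := v) h.continuous_obj_pt).comp
      (WithLp.prod_continuous_ofLp 2 (Vec d₁) (Vec d₂))).measurable
  · have hsv : P.obj s = v := saddle_value_unique hs hs₀
    have h1 := hPL.lyapunov_le_of_near (v := v) (xs := s.fst) (ys := s.snd) hsv
      (fun y => (hs.1 y).trans hsv.le) (fun x => hsv.ge.trans (hs.2 x)) (x := w.fst) (y := w.snd)
    refine h1.trans ?_
    rw [WithLp.prod_norm_sq_eq_of_L2, mul_add, WithLp.sub_fst, WithLp.sub_snd]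
    gcongr
    have : l ≤ l ^ 2 / μ₂ := by
      rw [le_div_iff₀ hμ₂p, sq]; exact mul_le_mul_of_nonneg_left hμ₂ hl.le
    linarith [this, hl]

theorem isLyapunov_of_ge (h : P.Assumptions l σ σG μ₁ μ₂) (hl : 0 < l) (hμ₂ : 0 < μ₂)
    (hμ : μ₂ ≤ μ₁) (hμ₁ : μ₁ ≤ l) {m : ℕ} (hm : 1 ≤ m) (hmM : m ≤ M) {prm : Params}
    (hη : prm.ηyl = prm.ηxl) (hη0 : 0 ≤ prm.ηxl) (hηl : 8 * l * prm.ηxl ≤ 1) (hK : 1 ≤ prm.K)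
    {γ ν : ℝ} (hγ : 0 < γ) (hγl : 48 * l * γ ≤ 1)
    (hθ : 4 ^ prm.K * (16 * l ^ 2 * prm.ηxl ^ 2) ≤ μ₁ ^ 2 / (768 * l ^ 2))
    (hν : 4 ^ prm.K * (4 * l ^ 2 * prm.ηxl ^ 2 * (4 * σG ^ 2 + σ ^ 2)) ≤ ν)
    (hx : prm.ηxg * (prm.ηxl * prm.K) = γ)
    (hy : prm.ηyg * (prm.ηxl * prm.K) = γ * μ₁ ^ 2 / (48 * l ^ 2)) :
    ∃ V, IsLyapunov P prm m (7 * (l ^ 2 / μ₁)) (1 - γ * μ₁ ^ 2 / (48 * l ^ 2) * μ₂ / 2)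
      (γ * μ₁ ^ 2 / (48 * l ^ 2) * μ₂ ^ 2 / 64)
      (4 * l * γ ^ 2 * ((if m = M then 0 else σG ^ 2 / m) + σ ^ 2 / (m * prm.K)) + γ * ν) V := by
  have hμ₁p := hμ₂.trans_le hμ
  have hPL := (h.minimaxPL (by omega) hl hμ₁p hμ₁ hμ₂ (hμ.trans hμ₁)).swap
  obtain ⟨s₀, hs₀⟩ := h.saddle
  have hv := (isSaddleValue_of_mem hs₀).swap
  have hprob := isProbabilityMeasure_roundLaw P prm.K hmM
  have hcont : Continuous fun w : Vec d₂ × Vec d₁ => -P.obj (pt w.2 w.1) :=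
    (h.continuous_obj_pt.comp continuous_swap).neg
  set v := -P.obj s₀ with hvdef
  set f : Vec d₂ → Vec d₁ → ℝ := fun y x => -P.obj (pt x y) with hf
  have key : ∀ w : Pt d₁ d₂,
      Integrable (fun r => lyapunov f v (serverStep P prm m r w).snd (serverStep P prm m r w).fst)
        (roundLaw P m prm.K) ∧
      ∫ r, lyapunov f v (serverStep P prm m r w).snd (serverStep P prm m r w).fst
        ∂(roundLaw P m prm.K) ≤ (1 - γ * μ₁ ^ 2 / (48 * l ^ 2) * μ₂ / 2) *
          lyapunov f v w.snd w.fst - γ * μ₁ ^ 2 / (48 * l ^ 2) * μ₂ ^ 2 / 64 *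
          Metric.infDist w (saddleSet P.obj) ^ 2 +
        (4 * l * γ ^ 2 * ((if m = M then 0 else σG ^ 2 / m) + σ ^ 2 / (m * prm.K)) + γ * ν) := by
    intro w
    obtain ⟨N, R, hae, hNx, hRx, hNy, hRy, hNx0, hNy0, hN2, hR2⟩ :=
      exists_round_noise h hl hm hmM hη hη0 hηl hK hθ hν w
    -- For `-f` the gradients change sign, so noise and drift are negated as well as exchanged.
    obtain ⟨k1, k2⟩ := hPL.integral_lyapunov_step_le (Nx := fun r => -(N r).snd)
      (Rx := fun r => -(R r).snd) (Ny := fun r => -(N r).fst) (Ry := fun r => -(R r).fst)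
      (n := (if m = M then 0 else σG ^ 2 / m) + σ ^ 2 / (m * prm.K)) (ν := ν)
      hv hμ hcont hγ hγl w.snd w.fst hNy.neg hRy.neg hNx.neg hRx.neg
      (by rw [integral_neg, hNy0, neg_zero]) (by rw [integral_neg, hNx0, neg_zero])
      (by simp only [norm_neg]; rw [add_comm]; exact hN2)
      (by
        simp only [norm_neg]
        rw [add_comm, add_comm (‖(∇ P.obj (pt w.fst w.snd)).snd‖ ^ 2)]; exact hR2)
    obtain ⟨y', x', e1, e2, e3, e4⟩ := hPL.exists_saddle_near hv w.snd w.fst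
    have hmem : pt x' y' ∈ saddleSet P.obj :=
      mem_saddleSet_iff.2 ⟨fun y => neg_le_neg_iff.1 (e1.le.trans (e3 y)),
        fun x => neg_le_neg_iff.1 ((e2 x).trans e1.ge)⟩
    have hq := mul_le_mul_of_nonneg_left ((infDist_sq_le (w := w) hmem).trans
      ((add_comm _ _).le.trans e4))
      (by positivity : 0 ≤ γ * μ₁ ^ 2 / (48 * l ^ 2) * μ₂ ^ 2 / 64)
    rw [hx, hy] at hae
    have hcongr : (fun r => lyapunov f v (serverStep P prm m r w).snd
        (serverStep P prm m r w).fst) =ᵐ[roundLaw P m prm.K] fun r => lyapunov f v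
          (w.snd - (γ * μ₁ ^ 2 / (48 * l ^ 2)) •
            (-(∇ P.obj (pt w.fst w.snd)).snd + -(N r).snd + -(R r).snd))
          (w.fst + γ • (-(∇ P.obj (pt w.fst w.snd)).fst + -(N r).fst + -(R r).fst)) := by
      filter_upwards [hae] with r hr
      rw [hr, ← neg_add, ← neg_add, ← neg_add, ← neg_add, smul_neg, smul_neg, sub_neg_eq_add,
        ← sub_eq_add_neg]
      rfl
    refine ⟨k1.congr hcongr.symm, ?_⟩
    rw [integral_congr_ae hcongr]
    refine k2.trans ?_
    linarith
  refine ⟨fun w => lyapunov f v w.snd w.fst, ?_, fun w => hPL.lyapunov_nonneg hv _ _,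
    fun w s hs => ?_, fun w => (key w).1, fun w => (key w).2⟩
  · exact ((hPL.continuous_lyapunov (v := v) hcont).comp (continuous_swap.comp
      (WithLp.prod_continuous_ofLp 2 (Vec d₁) (Vec d₂)))).measurable
  · have hsv : -P.obj s = v := by rw [hvdef, saddle_value_unique hs hs₀]
    have h1 := hPL.lyapunov_le_of_near (v := v) (xs := s.snd) (ys := s.fst) hsv
      (fun x => (neg_le_neg (hs.2 x)).trans hsv.le) (fun y => hsv.ge.trans (neg_le_neg (hs.1 y)))
      (x := w.snd) (y := w.fst)
    refine h1.trans ?_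
    rw [WithLp.prod_norm_sq_eq_of_L2, mul_add, WithLp.sub_fst, WithLp.sub_snd, add_comm]
    gcongr
    have : l ≤ l ^ 2 / μ₁ := by
      rw [le_div_iff₀ hμ₁p, sq]; exact mul_le_mul_of_nonneg_left hμ₁ hl.le
    linarith [this, hl]

end RoundContraction

/-! ### Choice of step sizes, local steps and number of rounds -/

theorem exists_stepSize (K : ℕ) (l G : ℝ) {θ ν : ℝ} (hθ : 0 < θ) (hν : 0 < ν) :
    ∃ η : ℝ, 0 < η ∧ 8 * l * η ≤ 1 ∧ 4 ^ K * (16 * l ^ 2 * η ^ 2) ≤ θ ∧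
      4 ^ K * (4 * l ^ 2 * η ^ 2 * G) ≤ ν := by
  have lim : ∀ {g : ℝ → ℝ}, Continuous g → ∀ b, g 0 < b → ∀ᶠ η in nhdsWithin 0 (Set.Ioi 0), g η < b :=
    fun hg b hb => nhdsWithin_le_nhds (hg.continuousAt.eventually_lt_const hb)
  have h1 := lim (g := fun η => 8 * l * η) (by fun_prop) 1 (by simp)
  have h2 := lim (g := fun η => 4 ^ K * (16 * l ^ 2 * η ^ 2)) (by fun_prop) θ (by simpa)
  have h3 := lim (g := fun η => 4 ^ K * (4 * l ^ 2 * η ^ 2 * G)) (by fun_prop) ν (by simpa)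
  obtain ⟨η, e1, e2, e3, e4⟩ := (h1.and (h2.and (h3.and self_mem_nhdsWithin))).exists
  exact ⟨η, e4, e1.le, e2.le, e3.le⟩

/-- The number of rounds after which the Lyapunov function has contracted from `V` to `W`. -/
theorem exists_rounds {B κ₁ κ₂ ε τ V W : ℝ} (hB : 1 ≤ B) (hκ₂ : 1 ≤ κ₂) (hκ : κ₂ ≤ κ₁)
    (hε : 0 < ε) (hε' : ε ≤ 1 / 2) (hτ : 0 < τ) (hτ1 : τ ≤ 1) (hW : 0 < W)
    (hV : V ≤ W * (B * (κ₁ / ε) ^ 9)) :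
    ∃ T : ℕ, (1 - τ / (4608 * κ₁ * κ₂ ^ 2)) ^ T * V < W ∧
      T * τ ≤ 4608 * (2 * Real.log B + 12) * commBound κ₁ κ₂ ε := by
  have hκ₁ : 1 ≤ κ₁ := hκ₂.trans hκ
  set L := Real.log (κ₁ / ε) with hL
  have hx2 : 2 ≤ κ₁ / ε := by rw [le_div_iff₀ hε]; linarith
  have hx0 : 0 < κ₁ / ε := by linarith
  have hL2 : 1 / 2 ≤ L := by
    have := Real.log_le_log (by norm_num) hx2
    linarith [Real.log_two_gt_d9]
  have hlB : 0 ≤ Real.log B := Real.log_nonneg hB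
  set k := 4608 * κ₁ * κ₂ ^ 2 with hk
  have hκ₂s : 1 ≤ κ₂ ^ 2 := one_le_pow₀ hκ₂
  have hk1 : 1 ≤ k := by rw [hk]; nlinarith
  have hk0 : 0 < k := by linarith
  set ρ := τ / k with hρ
  have hρ0 : 0 < ρ := div_pos hτ hk0
  have hρ1 : ρ ≤ 1 := (div_le_one hk0).2 (hτ1.trans hk1)
  -- The exponent 10 exceeds the 9 of the hypothesis in order to make the final inequality strict.
  set S := (Real.log B + 10 * L) / ρ with hS
  refine ⟨⌈S⌉₊, ?_, ?_⟩
  · have h1 : S ≤ ⌈S⌉₊ := Nat.le_ceil _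
    have h2 : Real.log B + 10 * L ≤ ρ * ⌈S⌉₊ := by
      rw [hS, div_le_iff₀ hρ0] at h1; linarith
    have h3 : (1 - ρ) ^ ⌈S⌉₊ ≤ Real.exp (-(Real.log B + 10 * L)) := by
      calc (1 - ρ) ^ ⌈S⌉₊ ≤ Real.exp (-ρ) ^ ⌈S⌉₊ :=
            pow_le_pow_left₀ (by linarith) (by linarith [Real.add_one_le_exp (-ρ)]) _
        _ = Real.exp (⌈S⌉₊ * (-ρ)) := (Real.exp_nat_mul _ _).symm
        _ ≤ _ := Real.exp_le_exp.2 (by linarith)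
    have h4 : Real.exp (Real.log B + 10 * L) = B * (κ₁ / ε) ^ 10 := by
      rw [Real.exp_add, Real.exp_log (by linarith), mul_comm (10 : ℝ), Real.exp_mul,
        Real.exp_log hx0]
      norm_cast
    have hB0 : 0 < B := by linarith
    have h5 : V < W * (B * (κ₁ / ε) ^ 10) := by
      refine hV.trans_lt ?_
      gcongr 1
      gcongr 1
      exact pow_lt_pow_right₀ (by linarith) (by norm_num)
    rw [Real.exp_neg, h4] at h3
    have hE : 0 < B * (κ₁ / ε) ^ 10 := by positivity
    rcases le_or_gt V 0 with hV0 | hV0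
    · exact (mul_nonpos_of_nonneg_of_nonpos (pow_nonneg (by linarith) _) hV0).trans_lt hW
    · refine (mul_le_mul_of_nonneg_right h3 hV0.le).trans_lt ?_
      rw [inv_mul_lt_iff₀ hE]
      linarith
  · have hS0 : 0 ≤ S := by positivity
    have h1 := (Nat.ceil_lt_add_one hS0).le
    have h2 : S * τ = (Real.log B + 10 * L) * k := by rw [hS, hρ]; field_simp
    have h3 : commBound κ₁ κ₂ ε * 4608 = k * L := by rw [commBound, hk]; ring
    have h4 : (⌈S⌉₊ : ℝ) * τ ≤ (S + 1) * τ := mul_le_mul_of_nonneg_right h1 hτ.le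
    -- As `ε ≤ 1 / 2`, the logarithm is at least 1/2 and absorbs all constants, including the
    -- rounding.
    have h5 : Real.log B * k * 1 ≤ Real.log B * k * (2 * L) := by gcongr; linarith
    have h6 : 1 * 1 ≤ k * (2 * L) := mul_le_mul hk1 (by linarith) (by norm_num) hk0.le
    calc (⌈S⌉₊ : ℝ) * τ ≤ (S + 1) * τ := h4
      _ = (Real.log B + 10 * L) * k + τ := by rw [add_mul, h2, one_mul]
      _ ≤ (2 * Real.log B + 12) * (k * L) := by linarith
      _ = _ := by rw [← h3]; ring

/-- The amount of averaging over samples that brings the noise below the target accuracy. -/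
noncomputable def noiseRatio (A κ₁ κ₂ ε : ℝ) (m : ℕ) : ℝ := A * κ₁ ^ 2 * κ₂ ^ 2 / (m * ε ^ 2)

/-- The origin of the sample complexity: the averaging needed, times the number of rounds of the
noiseless method. -/
theorem noiseRatio_mul_commBound (A κ₁ κ₂ ε : ℝ) (m : ℕ) :
    noiseRatio A κ₁ κ₂ ε m * commBound κ₁ κ₂ ε = A * sampleBound m κ₁ κ₂ ε := by
  unfold noiseRatio commBound sampleBound
  rw [div_eq_mul_inv, mul_inv]
  ring

theorem exists_averaging {l σ σG : ℝ} (hl : 0 < l) {κ₁ κ₂ ε : ℝ} (hκ₂ : 1 ≤ κ₂) (hκ : κ₂ ≤ κ₁)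
    (hε : 0 < ε) (hε' : ε ≤ 1 / 2) {m M : ℕ} (hm : 1 ≤ m) {A : ℝ}
    (hA : A = 1024 * (σ ^ 2 + σG ^ 2) / l ^ 2) :
    ∃ (K : ℕ) (τ : ℝ), 1 ≤ K ∧ 0 < τ ∧ τ ≤ 1 ∧
      τ * ((if m = M then 0 else σG ^ 2 / m) + σ ^ 2 / (m * K)) ≤
        l ^ 2 * ε ^ 2 / (1024 * κ₁ ^ 2 * κ₂ ^ 2) ∧
      K ≤ (noiseRatio A κ₁ κ₂ ε m + 2) * τ ∧
      1 ≤ (A + 2) * (κ₁ / ε) ^ 2 * κ₂ ^ 2 * τ ∧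
      (m = M ∨ σG = 0 → τ = 1) := by
  have hκ₁ : 1 ≤ κ₁ := hκ₂.trans hκ
  have hκ₁0 : 0 < κ₁ := by linarith
  have hκ₂0 : 0 < κ₂ := by linarith
  have hm0 : (1 : ℝ) ≤ m := by exact_mod_cast hm
  have hmp : (0 : ℝ) < m := by linarith
  have hA0 : 0 ≤ A := by rw [hA]; positivity
  set Q := noiseRatio A κ₁ κ₂ ε m with hQ
  have hQ0 : 0 ≤ Q := by rw [hQ, noiseRatio]; positivity
  set R := l ^ 2 * ε ^ 2 / (1024 * κ₁ ^ 2 * κ₂ ^ 2) with hR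
  have hQR : Q * R = (σ ^ 2 + σG ^ 2) / m := by
    rw [hQ, noiseRatio, hR, hA]; field_simp
  have hR0 : 0 < R := by rw [hR]; positivity
  have hx : 1 ≤ (κ₁ / ε) ^ 2 * κ₂ ^ 2 := by
    have : 1 ≤ κ₁ / ε := by rw [le_div_iff₀ hε]; linarith
    exact one_le_mul_of_one_le_of_one_le (one_le_pow₀ this) (one_le_pow₀ hκ₂)
  by_cases hc : m = M ∨ σG = 0
  -- Only gradient noise is left, and it decays like `1 / K`. The step stays maximal.
  · refine ⟨⌈Q⌉₊ + 1, 1, by omega, one_pos, le_rfl, ?_, ?_, ?_, fun _ => rfl⟩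
    · have h0 : (if m = M then 0 else σG ^ 2 / (m : ℝ)) = 0 := by
        rcases hc with h | h
        · simp [h]
        · simp [h]
      rw [h0, zero_add, one_mul]
      have h1 : Q ≤ (⌈Q⌉₊ + 1 : ℕ) := (Nat.le_ceil Q).trans (by push_cast; linarith)
      have h2 : Q * R ≤ (⌈Q⌉₊ + 1 : ℕ) * R := mul_le_mul_of_nonneg_right h1 hR0.le
      rw [← div_div, div_le_iff₀ (by positivity), mul_comm R]
      refine le_trans ?_ h2
      rw [hQR]
      gcongr
      nlinarith [sq_nonneg σG]
    · push_cast
      linarith [(Nat.ceil_lt_add_one hQ0).le]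
    · rw [mul_one, mul_assoc]
      nlinarith
  -- The client sampling error does not decrease with `K`, so the step has to shrink instead.
  · refine ⟨1, 1 / (1 + Q), le_rfl, by positivity, ?_, ?_, ?_, ?_, fun h => absurd h hc⟩
    · rw [div_le_one (by positivity)]; linarith
    · rw [one_div, inv_mul_le_iff₀ (by positivity), add_mul, hQR, Nat.cast_one, mul_one]
      have h1 : (if m = M then 0 else σG ^ 2 / (m : ℝ)) ≤ σG ^ 2 / m := by
        split_ifs
        · positivity
        · exact le_rfl
      rw [add_div]
      linarith
    · rw [mul_one_div, Nat.cast_one, le_div_iff₀ (by positivity)]; linarith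
    · rw [mul_one_div, le_div_iff₀ (by positivity)]
      have h1 : Q ≤ A * ((κ₁ / ε) ^ 2 * κ₂ ^ 2) := by
        rw [hQ, noiseRatio, div_pow, div_mul_eq_mul_div, ← mul_div_assoc, ← mul_assoc]
        gcongr
        nlinarith [sq_nonneg ε]
      nlinarith

/-- The choice of the number of local steps, of the effective step size `τ / (48 l)`, and of the
number of rounds. -/
theorem exists_schedule (l σ σG D : ℝ) (hl : 0 < l) :
    ∃ C : ℝ, 0 < C ∧ ∀ κ₁ κ₂ ε : ℝ, 1 ≤ κ₂ → κ₂ ≤ κ₁ → 0 < ε → ε ≤ 1 / 2 → ∀ m M : ℕ, 1 ≤ m →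
      ∃ (K : ℕ) (τ : ℝ) (T : ℕ), 1 ≤ K ∧ 0 < τ ∧ τ ≤ 1 ∧
        τ * ((if m = M then 0 else σG ^ 2 / m) + σ ^ 2 / (m * K)) ≤
          l ^ 2 * ε ^ 2 / (1024 * κ₁ ^ 2 * κ₂ ^ 2) ∧
        (1 - τ / (4608 * κ₁ * κ₂ ^ 2)) ^ T * (7 * (l * κ₂) * (D + 1) ^ 2) <
          τ * l / (147456 * κ₁ ^ 2 * κ₂ ^ 2) * ε ^ 2 / 2 ∧
        (K : ℝ) * T ≤ C * max (sampleBound m κ₁ κ₂ ε) (commBound κ₁ κ₂ ε) ∧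
        (m = M ∨ σG = 0 → (T : ℝ) ≤ C * commBound κ₁ κ₂ ε) := by
  obtain ⟨A, hA⟩ : ∃ A, A = 1024 * (σ ^ 2 + σG ^ 2) / l ^ 2 := ⟨_, rfl⟩
  have hA0 : 0 ≤ A := by rw [hA]; positivity
  -- Here `2064384 = 14 * 147456`. The factor `A + 2` comes from the lower bound on `τ`, and the
  -- last summand ensures `1 ≤ B`.
  obtain ⟨B, hB⟩ : ∃ B, B = 2064384 * (D + 1) ^ 2 * (A + 2) + 1 := ⟨_, rfl⟩
  have hB1 : 1 ≤ B := by
    have : 0 ≤ 2064384 * (D + 1) ^ 2 * (A + 2) := by positivity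
    linarith
  have hlB : 0 ≤ Real.log B := Real.log_nonneg hB1
  obtain ⟨C₀, hC₀⟩ : ∃ C₀, C₀ = 4608 * (2 * Real.log B + 12) := ⟨_, rfl⟩
  have hC₀p : 0 < C₀ := by rw [hC₀]; positivity
  refine ⟨C₀ * (A + 2), by positivity, fun κ₁ κ₂ ε hκ₂ hκ hε hε' m M hm => ?_⟩
  obtain ⟨K, τ, hK, hτ, hτ1, hn, hKτ, hx, hc⟩ :=
    exists_averaging (σ := σ) (σG := σG) (M := M) hl hκ₂ hκ hε hε' hm hA
  have hκ₁ : 1 ≤ κ₁ := hκ₂.trans hκ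
  have hκ₁0 : 0 < κ₁ := by linarith
  have hκ₂0 : 0 < κ₂ := by linarith
  have hW : 0 < τ * l / (147456 * κ₁ ^ 2 * κ₂ ^ 2) * ε ^ 2 / 2 := by positivity
  have hxx : κ₁ ≤ κ₁ / ε := by rw [le_div_iff₀ hε]; nlinarith
  have hVW : 7 * (l * κ₂) * (D + 1) ^ 2 ≤
      τ * l / (147456 * κ₁ ^ 2 * κ₂ ^ 2) * ε ^ 2 / 2 * (B * (κ₁ / ε) ^ 9) := by
    -- The exponent 9 is `2 + 5 + 2`: from the bound on `1 / τ`, from the powers of `κ₂`, and from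
    -- `κ₁² / ε²`.
    have h1 : κ₂ ^ 5 ≤ (κ₁ / ε) ^ 5 := by gcongr; exact hκ.trans hxx
    have h2 : 7 * (l * κ₂) * (D + 1) ^ 2 * 1 ≤
        7 * (l * κ₂) * (D + 1) ^ 2 * ((A + 2) * (κ₁ / ε) ^ 2 * κ₂ ^ 2 * τ) :=
      mul_le_mul_of_nonneg_left hx (by positivity)
    have h3 : (ε * (κ₁ / ε)) ^ 2 = κ₁ ^ 2 := by rw [mul_div_cancel₀ _ hε.ne']
    rw [mul_one] at h2
    refine h2.trans ?_
    calc 7 * (l * κ₂) * (D + 1) ^ 2 * ((A + 2) * (κ₁ / ε) ^ 2 * κ₂ ^ 2 * τ)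
        = 7 * l * τ * (D + 1) ^ 2 * (A + 2) * (κ₁ / ε) ^ 2 / κ₂ ^ 2 * κ₂ ^ 5 := by field_simp
      _ ≤ 7 * l * τ * (D + 1) ^ 2 * (A + 2) * (κ₁ / ε) ^ 2 / κ₂ ^ 2 * (κ₁ / ε) ^ 5 := by gcongr
      _ = τ * l / (147456 * κ₁ ^ 2 * κ₂ ^ 2) * ε ^ 2 / 2 *
          ((2064384 * (D + 1) ^ 2 * (A + 2)) * (κ₁ / ε) ^ 9) := by field_simp; ring
      _ ≤ _ := by
          gcongr
          rw [hB]
          linarith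
  obtain ⟨T, hT, hTτ⟩ := exists_rounds hB1 hκ₂ hκ hε hε' hτ hτ1 hW hVW
  rw [← hC₀] at hTτ
  have hcomm : 0 ≤ commBound κ₁ κ₂ ε := by
    have := Real.log_nonneg (hκ₁.trans hxx)
    rw [commBound]; positivity
  refine ⟨K, τ, T, hK, hτ, hτ1, hn, hT, ?_, fun h => ?_⟩
  · have h1 : (K : ℝ) * T ≤ (noiseRatio A κ₁ κ₂ ε m + 2) * τ * T :=
      mul_le_mul_of_nonneg_right hKτ (Nat.cast_nonneg T)
    have hQ : 0 ≤ noiseRatio A κ₁ κ₂ ε m := by rw [noiseRatio]; positivity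
    calc (K : ℝ) * T ≤ (noiseRatio A κ₁ κ₂ ε m + 2) * (T * τ) := by linarith
      _ ≤ (noiseRatio A κ₁ κ₂ ε m + 2) * (C₀ * commBound κ₁ κ₂ ε) := by gcongr
      _ = C₀ * (A * sampleBound m κ₁ κ₂ ε + 2 * commBound κ₁ κ₂ ε) := by
          rw [← noiseRatio_mul_commBound]; ring
      _ ≤ C₀ * (A * max (sampleBound m κ₁ κ₂ ε) (commBound κ₁ κ₂ ε) +
            2 * max (sampleBound m κ₁ κ₂ ε) (commBound κ₁ κ₂ ε)) := by
          gcongr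
          · exact le_max_left _ _
          · exact le_max_right _ _
      _ = _ := by ring
  · rw [hc h, mul_one] at hTτ
    refine hTτ.trans (mul_le_mul_of_nonneg_right ?_ hcomm)
    nlinarith

/-! ### Assembly -/

section Main

variable {M d₁ d₂ : ℕ} {Ξ : Type*} [MeasurableSpace Ξ] {P : Problem M d₁ d₂ Ξ}
  {l σ σG μ₁ μ₂ : ℝ}

theorem IsLyapunov.exists_sqError_le {prm : Params} {m : ℕ} {A a c n δ D : ℝ}
    {V : Pt d₁ d₂ → ℝ} (hV : IsLyapunov P prm m A a c n V) (h : P.Assumptions l σ σG μ₁ μ₂)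
    (hl : 0 ≤ l) (hm : m ≤ M) (hη : prm.ηyl = prm.ηxl) (hp : prm.p = 0) (hA : 0 ≤ A) (hc : 0 < c)
    (ha0 : 0 ≤ a) (ha1 : a ≤ 1) (hn : n ≤ c * δ / 2) (T : ℕ)
    (hT : a ^ T * (A * (D + 1) ^ 2) < c * δ / 2) (s₀ : State d₁ d₂)
    (hD : Metric.infDist (pt s₀.x s₀.y) (saddleSet P.obj) ≤ D) :
    ∃ t ≤ T, Integrable (sqError P prm m s₀ t) (runLaw P m prm.K) ∧
      ∫ ω, sqError P prm m s₀ t ω ∂(runLaw P m prm.K) ≤ δ := by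
  have hprob := isProbabilityMeasure_roundLaw P prm.K hm
  -- The slack in `D + 1` gives an actual saddle point without attaining the infimum.
  obtain ⟨s, hs, hsd⟩ := (Metric.infDist_lt_iff h.saddle).1 (hD.trans_lt (lt_add_one D))
  have hV₀ : V (pt s₀.x s₀.y) ≤ A * (D + 1) ^ 2 := by
    refine (hV.le_of_saddle _ s hs).trans ?_
    rw [← dist_eq_norm]
    gcongr
  obtain ⟨t, ht, h1, h2⟩ := exists_time_integral_le (measurable_serverStep h hl hη m)
    hV.measurable hV.nonneg hV.integrable hV.contract
    (((Metric.continuous_infDist_pt (saddleSet P.obj)).pow 2).measurable)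
    (fun w => sq_nonneg _) hc ha0 ha1 (pt s₀.x s₀.y) hn T
    ((mul_le_mul_of_nonneg_left hV₀ (pow_nonneg ha0 T)).trans_lt hT)
  have he : sqError P prm m s₀ t = fun ω => Metric.infDist
      (chain (serverStep P prm m) (pt s₀.x s₀.y) ω t) (saddleSet P.obj) ^ 2 := by
    funext ω
    rw [sqError, run_eq_chain hp]
  refine ⟨t, ht, ?_⟩
  rw [he]
  exact ⟨h1, h2⟩

end Main

theorem exists_params {l μ₁ μ₂ : ℝ} (σ σG : ℝ) (hl : 0 < l) (hμ₁ : 0 < μ₁) (hμ₁l : μ₁ ≤ l)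
    (hμ₂ : 0 < μ₂) (hμ₂l : μ₂ ≤ l) {M m : ℕ} (hm : 1 ≤ m) (hmM : m ≤ M) {K : ℕ} (hK : 1 ≤ K)
    {γ ν : ℝ} (hγ : 0 < γ) (hγl : 48 * l * γ ≤ 1) (hν : 0 < ν) :
    ∃ prm : Params, prm.Valid ∧ prm.p = 0 ∧ prm.K = K ∧ prm.ηyl = prm.ηxl ∧
      ∀ (d₁ d₂ : ℕ) (Ξ : Type*) [MeasurableSpace Ξ] (P : Problem M d₁ d₂ Ξ),
        P.Assumptions l σ σG μ₁ μ₂ →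
        ∃ V, IsLyapunov P prm m (7 * (l ^ 2 / max μ₁ μ₂))
          (1 - γ * max μ₁ μ₂ ^ 2 / (48 * l ^ 2) * min μ₁ μ₂ / 2)
          (γ * max μ₁ μ₂ ^ 2 / (48 * l ^ 2) * min μ₁ μ₂ ^ 2 / 64)
          (4 * l * γ ^ 2 * ((if m = M then 0 else σG ^ 2 / m) + σ ^ 2 / (m * K)) + γ * ν) V := by
  have hmax : 0 < max μ₁ μ₂ := lt_max_of_lt_left hμ₁
  obtain ⟨η, hη, hηl, h1, h2⟩ := exists_stepSize K l (4 * σG ^ 2 + σ ^ 2)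
    (θ := max μ₁ μ₂ ^ 2 / (768 * l ^ 2)) (by positivity) hν
  have hKp : (0 : ℝ) < K := by exact_mod_cast hK
  have hηK : 0 < η * K := mul_pos hη hKp
  have hs : 0 < γ * max μ₁ μ₂ ^ 2 / (48 * l ^ 2) := by positivity
  rcases le_total μ₁ μ₂ with hμ | hμ
  -- Dividing by `η * K` undoes the small local steps. The value `β = 1 / 2` is arbitrary: with `p =
  -- 0` the sequence `z` does not influence `x` and `y`.
  · refine ⟨⟨η, η, γ * max μ₁ μ₂ ^ 2 / (48 * l ^ 2) / (η * K), γ / (η * K), 1 / 2, 0, K⟩,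
      ⟨hη, hη, div_pos hs hηK, div_pos hγ hηK, by norm_num, by norm_num, hK⟩, rfl, rfl, rfl,
      fun d₁ d₂ Ξ _ P h => ?_⟩
    rw [max_eq_right hμ] at h1 ⊢
    rw [min_eq_left hμ]
    exact isLyapunov_of_le h hl hμ₁ hμ hμ₂l hm hmM rfl hη.le hηl hK hγ hγl h1 h2
      (div_mul_cancel₀ _ hηK.ne') (div_mul_cancel₀ _ hηK.ne')
  · refine ⟨⟨η, η, γ / (η * K), γ * max μ₁ μ₂ ^ 2 / (48 * l ^ 2) / (η * K), 1 / 2, 0, K⟩,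
      ⟨hη, hη, div_pos hγ hηK, div_pos hs hηK, by norm_num, by norm_num, hK⟩, rfl, rfl, rfl,
      fun d₁ d₂ Ξ _ P h => ?_⟩
    rw [max_eq_left hμ] at h1 ⊢
    rw [min_eq_right hμ]
    exact isLyapunov_of_ge h hl hμ₂ hμ hμ₁l hm hmM rfl hη.le hηl hK hγ hγl h1 h2
      (div_mul_cancel₀ _ hηK.ne') (div_mul_cancel₀ _ hηK.ne')

theorem kappaMax_eq {l μ₁ μ₂ : ℝ} (hl : 0 ≤ l) (hμ₁ : 0 < μ₁) (hμ₂ : 0 < μ₂) :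
    kappaMax l μ₁ μ₂ = l / min μ₁ μ₂ := by
  rw [kappaMax]
  rcases le_total μ₁ μ₂ with h | h
  · rw [min_eq_left h, max_eq_left (by gcongr)]
  · rw [min_eq_right h, max_eq_right (by gcongr)]

theorem kappaMin_eq {l μ₁ μ₂ : ℝ} (hl : 0 ≤ l) (hμ₁ : 0 < μ₁) (hμ₂ : 0 < μ₂) :
    kappaMin l μ₁ μ₂ = l / max μ₁ μ₂ := by
  rw [kappaMin]
  rcases le_total μ₁ μ₂ with h | h
  · rw [max_eq_right h, min_eq_right (by gcongr)]
  · rw [max_eq_left h, min_eq_left (by gcongr)]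

end FessGda

theorem theorem5 (l σ σG D : ℝ) (hl : 0 < l) (hσ : 0 ≤ σ) (hσG : 0 ≤ σG) (hD : 0 ≤ D) :
    ∃ C : ℝ, 0 < C ∧
      ∀ (μ₁ μ₂ : ℝ), 0 < μ₁ → μ₁ ≤ l → 0 < μ₂ → μ₂ ≤ l →
      ∀ (M m : ℕ), 1 ≤ m → m ≤ M →
      ∀ ε : ℝ, 0 < ε → ε ≤ 1 / 2 →
      ∃ prm : FessGda.Params, prm.Valid ∧ prm.p = 0 ∧
        ∀ (d₁ d₂ : ℕ) (Ξ : Type*) [MeasurableSpace Ξ] (P : FessGda.Problem M d₁ d₂ Ξ),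
          P.Assumptions l σ σG μ₁ μ₂ →
        ∀ s₀ : FessGda.State d₁ d₂,
          Metric.infDist (FessGda.pt s₀.x s₀.y) (FessGda.saddleSet P.obj) ≤ D →
        ∃ T : ℕ,
          (MeasureTheory.Integrable (FessGda.sqError P prm m s₀ T) (FessGda.runLaw P m prm.K) ∧
            ∫ ω, FessGda.sqError P prm m s₀ T ω ∂(FessGda.runLaw P m prm.K) ≤ ε ^ 2) ∧
          (prm.K : ℝ) * T ≤ C * max
            (FessGda.sampleBound m (FessGda.kappaMax l μ₁ μ₂) (FessGda.kappaMin l μ₁ μ₂) ε)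
            (FessGda.commBound (FessGda.kappaMax l μ₁ μ₂) (FessGda.kappaMin l μ₁ μ₂) ε) ∧
          (m = M ∨ σG = 0 →
            (T : ℝ) ≤ C *
              FessGda.commBound (FessGda.kappaMax l μ₁ μ₂) (FessGda.kappaMin l μ₁ μ₂) ε) ∧
          (m < M ∧ 0 < σG →
            (T : ℝ) ≤ C * max
              (FessGda.sampleBound m (FessGda.kappaMax l μ₁ μ₂) (FessGda.kappaMin l μ₁ μ₂) ε)
              (FessGda.commBound (FessGda.kappaMax l μ₁ μ₂) (FessGda.kappaMin l μ₁ μ₂) ε)) := by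
  obtain ⟨C, hC, hsched⟩ := FessGda.exists_schedule l σ σG D hl
  refine ⟨C, hC, fun μ₁ μ₂ hμ₁ hμ₁l hμ₂ hμ₂l M m hm hmM ε hε hε' => ?_⟩
  have hmin : 0 < min μ₁ μ₂ := lt_min hμ₁ hμ₂
  have hmax : 0 < max μ₁ μ₂ := lt_max_of_lt_left hμ₁
  obtain ⟨κ₁, hκ₁⟩ : ∃ κ₁, κ₁ = FessGda.kappaMax l μ₁ μ₂ := ⟨_, rfl⟩
  obtain ⟨κ₂, hκ₂⟩ : ∃ κ₂, κ₂ = FessGda.kappaMin l μ₁ μ₂ := ⟨_, rfl⟩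
  rw [← hκ₁, ← hκ₂]
  rw [FessGda.kappaMax_eq hl.le hμ₁ hμ₂] at hκ₁
  rw [FessGda.kappaMin_eq hl.le hμ₁ hμ₂] at hκ₂
  have hκ₂1 : 1 ≤ κ₂ := by
    rw [hκ₂, one_le_div hmax]
    exact max_le hμ₁l hμ₂l
  have hκ : κ₂ ≤ κ₁ := by
    rw [hκ₁, hκ₂]
    gcongr
    exact min_le_max
  have hκ₂0 : 0 < κ₂ := by linarith
  have hκ₁0 : 0 < κ₁ := by linarith
  have hμs : min μ₁ μ₂ = l / κ₁ := by rw [hκ₁, div_div_cancel₀ hl.ne']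
  have hμf : max μ₁ μ₂ = l / κ₂ := by rw [hκ₂, div_div_cancel₀ hl.ne']
  obtain ⟨K, τ, T, hK, hτ, hτ1, hn, hT, hKT, hTc⟩ := hsched κ₁ κ₂ ε hκ₂1 hκ hε hε' m M hm
  have hc : 0 < τ * l / (147456 * κ₁ ^ 2 * κ₂ ^ 2) := by positivity
  have hγ : 0 < τ / (48 * l) := by positivity
  -- The drift allowance `ν` is set so that `γ ν = c ε² / 4`, half of the admissible noise level.
  -- The stochastic noise takes the other half.
  obtain ⟨prm, hval, hp, hprmK, hη, hLyap⟩ := FessGda.exists_params σ σG hl hμ₁ hμ₁l hμ₂ hμ₂l hm hmM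
    hK hγ (by rw [mul_div_cancel₀ _ (by positivity)]; exact hτ1)
    (ν := τ * l / (147456 * κ₁ ^ 2 * κ₂ ^ 2) * ε ^ 2 / (4 * (τ / (48 * l)))) (by positivity)
  refine ⟨prm, hval, hp, fun d₁ d₂ Ξ _ P h s₀ hs₀ => ?_⟩
  obtain ⟨V, hV⟩ := hLyap d₁ d₂ Ξ P h
  have hA : 7 * (l ^ 2 / max μ₁ μ₂) = 7 * (l * κ₂) := by rw [hμf]; field_simp
  have ha : 1 - τ / (48 * l) * max μ₁ μ₂ ^ 2 / (48 * l ^ 2) * min μ₁ μ₂ / 2 =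
      1 - τ / (4608 * κ₁ * κ₂ ^ 2) := by
    rw [hμf, hμs]; field_simp; ring
  have hce : τ / (48 * l) * max μ₁ μ₂ ^ 2 / (48 * l ^ 2) * min μ₁ μ₂ ^ 2 / 64 =
      τ * l / (147456 * κ₁ ^ 2 * κ₂ ^ 2) := by
    rw [hμf, hμs]; field_simp; norm_num
  rw [hA, ha, hce] at hV
  have hρ : τ / (4608 * κ₁ * κ₂ ^ 2) ≤ 1 := by
    rw [div_le_one (by positivity)]
    have h1 : 1 ≤ κ₁ * κ₂ ^ 2 :=
      one_le_mul_of_one_le_of_one_le (hκ₂1.trans hκ) (one_le_pow₀ hκ₂1)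
    linarith
  have hρ0 : 0 ≤ τ / (4608 * κ₁ * κ₂ ^ 2) := by positivity
  have hnoise : 4 * l * (τ / (48 * l)) ^ 2 *
        ((if m = M then 0 else σG ^ 2 / m) + σ ^ 2 / (m * K)) +
      τ / (48 * l) * (τ * l / (147456 * κ₁ ^ 2 * κ₂ ^ 2) * ε ^ 2 / (4 * (τ / (48 * l)))) ≤
      τ * l / (147456 * κ₁ ^ 2 * κ₂ ^ 2) * ε ^ 2 / 2 := by
    have h1 := mul_le_mul_of_nonneg_left hn (by positivity : 0 ≤ τ / (576 * l))
    have h2 : ∀ N : ℝ, 4 * l * (τ / (48 * l)) ^ 2 * N = τ / (576 * l) * (τ * N) := by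
      intro N; field_simp; ring
    have h3 : τ / (48 * l) * (τ * l / (147456 * κ₁ ^ 2 * κ₂ ^ 2) * ε ^ 2 / (4 * (τ / (48 * l)))) =
        τ * l / (147456 * κ₁ ^ 2 * κ₂ ^ 2) * ε ^ 2 / 4 := by
      field_simp
    have h4 : τ / (576 * l) * (l ^ 2 * ε ^ 2 / (1024 * κ₁ ^ 2 * κ₂ ^ 2)) =
        τ * l / (147456 * κ₁ ^ 2 * κ₂ ^ 2) * ε ^ 2 / 4 := by field_simp; norm_num
    rw [h2, h3]
    linarith
  -- The good time `t` depends on the problem, but lies below the horizon `T` of the schedule, which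
  -- does not. All complexity bounds pass from `T` to `t`.
  obtain ⟨t, htT, hint, hle⟩ := hV.exists_sqError_le h hl.le hmM hη hp (by positivity) hc
    (by linarith) (by linarith) (δ := ε ^ 2) hnoise T hT s₀ hs₀
  have htT' : (t : ℝ) ≤ T := by exact_mod_cast htT
  have hKt : (K : ℝ) * t ≤ C * max (FessGda.sampleBound m κ₁ κ₂ ε)
      (FessGda.commBound κ₁ κ₂ ε) :=
    (mul_le_mul_of_nonneg_left htT' (Nat.cast_nonneg K)).trans hKT
  refine ⟨t, ⟨hint, hle⟩, by rw [hprmK]; exact hKt, fun hf => htT'.trans (hTc hf), fun _ => ?_⟩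
  exact (le_mul_of_one_le_left (Nat.cast_nonneg t) (by exact_mod_cast hK)).trans hKt
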